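/- **Conventions.** $P_-=\{x'+iy' : y'<0\}$, $\mathbb{H}f(\alpha)=\frac{1}{i\pi}\,\mathrm{p.v.}\!\int_{\mathbb{R}}\frac{f(\beta)}{\alpha-\beta}\,d\beta$ (so $\mathbb{H}1=0$; Fourier multiplier $-\operatorname{sgn}\xi$), $|\partial_{\alpha'}|$ is the Fourier multiplier with symbol $|\xi|$, $[A,B]=AB-BA$, and $K_\epsilon(x)=\frac{\epsilon}{\pi(\epsilon^2+x^2)}$ is the Poisson kernel. Let $s\ge 2$ be real and $T>0$. *Riemann mapping system.* $Z:\mathbb{R}\times[0,T]\to\mathbb{C}$, $C^1$ in $\alpha'$ with $Z_{,\alpha'}=\partial_{\alpha'}Z\neq 0$, solves the Riemann mapping system if $$b=-i\mathbb{H}\Big(\tfrac{1}{|Z_{,\alpha'}|^2}\Big),\qquad B_1=-2\,\mathrm{Im}\Big(\Big[\tfrac{1}{\overline{Z}_{,\alpha'}},\mathbb{H}\Big]\partial_{\alpha'}\tfrac{1}{Z_{,\alpha'}}\Big),\qquad (\partial_t+b\,\partial_{\alpha'})\tfrac{1}{Z_{,\alpha'}}=-\tfrac{i}{|Z_{,\alpha'}|^2}\partial_{\alpha'}\tfrac{1}{Z_{,\alpha'}}+\tfrac{B_1}{Z_{,\alpha'}},$$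 and if there is $\Psi(\cdot,t)$, continuous on $\overline{P_-}$ and holomorphic in $P_-$, with $\Psi(\alpha',t)=Z(\alpha',t)$ on $\mathbb{R}$ and $\Psi_{z'}(\cdot+iy,t)=K_{-y}*Z_{,\alpha'}(\cdot,t)$ for all $y<0$, such that $\Psi_{z'}(\cdot,t)$ is holomorphic and has no zero in $P_-$, $\Psi_{z'}(z',t)\to1$ and $\partial_t\Psi(z',t)\to 0$ as $z'\to\infty$ in $P_-$. Then $\log\Psi_{z'}$ denotes the continuous logarithm on $P_-$ that tends to $0$ at infinity, and $\log Z_{,\alpha'}$ its continuous boundary value on $\mathbb{R}$. *$g$-system.* A real-valued $g$ on $\mathbb{R}\times[0,T]$ solves the $g$-system if $$c=e^{-i\mathbb{H}g},\qquad b^*=-i\mathbb{H}(c^2),\qquad (\partial_t+b^*\partial_{\alpha'})g=-c^2|\partial_{\alpha'}|g .$$ Both evolution equations hold pointwise for every $t\in[0,T]$ and $\alpha'\in\mathbb{R}$ (one-sided time derivatives at the end points), $g(\cdot,t)$ is the continuous representative of its class, and membership in $L^\infty([0,T],H^s(\mathbb{R}))$ means that the $H^s$ norms are bounded uniformly in $t\in[0,T]$.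 **Lemma.** The two systems are equivalent: 1. If $Z$ solves the Riemann mapping system with $\big(Z_{,\alpha'}-1,\frac{1}{Z_{,\alpha'}}-1\big)\in L^\infty([0,T],H^s(\mathbb{R})\times H^s(\mathbb{R}))$, then $\log Z_{,\alpha'}$ is defined, and $g=\mathrm{Im}\,\log Z_{,\alpha'}$ solves the $g$-system, belongs to $L^\infty([0,T],H^s(\mathbb{R}))$ and satisfies $Z_{,\alpha'}=e^{i(\mathbb{I}+\mathbb{H})g}$. 2. If $g\in L^\infty([0,T],H^s(\mathbb{R}))$ solves the $g$-system, then there is $Z$ with $Z_{,\alpha'}=e^{i(\mathbb{I}+\mathbb{H})g}$ that solves the Riemann mapping system with $\big(Z_{,\alpha'}-1,\frac{1}{Z_{,\alpha'}}-1\big)\in L^\infty([0,T],H^s(\mathbb{R})\times H^s(\mathbb{R}))$, and $g=\mathrm{Im}\,\log Z_{,\alpha'}$. Such a $Z$ is unique up to addition of a complex constant (independent of $\alpha'$ and $t$). -/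

import Mathlib

open MeasureTheory Filter Topology Set
open scoped ENNReal NNReal Real FourierTransform

noncomputable section

namespace Muskat

/-- The open lower half plane `P₋`. -/
def lowerHalfPlane : Set ℂ := {z | z.im < 0}

/-- The filter of points `z ∈ P₋` with `|z| → ∞`. -/
def atInfty : Filter ℂ := Bornology.cobounded ℂ ⊓ 𝓟 lowerHalfPlane

open Classical in
/-- The Fourier transform (Plancherel) of a function in `L²(ℝ; ℂ)`, with Mathlib's normalization
`∫ e^{-2π i x η} f(x) dx`; so `η` is related to the angular frequency by `ξ = 2 π η`. -/
def fourierL2 (f : ℝ → ℂ) : ℝ → ℂ :=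
  if h : MemLp f 2 volume then ⇑(𝓕 (h.toLp f) : Lp ℂ 2 (volume : Measure ℝ)) else 0

/-- The norm `‖(1 + |ξ|²)^{s/2} f̂‖_{L²(dξ)}` of `H^s(ℝ)`, for the unitary normalization
`f̂(ξ) = (2π)^{-1/2} ∫ e^{-ixξ} f(x) dx`, written in the variable `η = ξ / (2π)`. -/
def sobolevNorm (s : ℝ) (f : ℝ → ℂ) : ℝ≥0∞ :=
  eLpNorm (fun η : ℝ => (((1 + (2 * π * η) ^ 2) ^ (s / 2) : ℝ) : ℂ) * fourierL2 f η) 2 volume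

/-- `f ∈ L^∞([0,T], H^s(ℝ))`. -/
def InLinftyHs (s T : ℝ) (f : ℝ → ℝ → ℂ) : Prop :=
  (∀ t ∈ Icc 0 T, MemLp (f t) 2 volume) ∧
    ∃ C : ℝ≥0, ∀ t ∈ Icc 0 T, sobolevNorm s (f t) ≤ C

/-- The operator `|∂|`, i.e. the Fourier multiplier with symbol `|ξ| = 2π|η|`. -/
def absDeriv (f : ℝ → ℂ) : ℝ → ℂ :=
  𝓕⁻ (fun η : ℝ => ((2 * π * |η| : ℝ) : ℂ) * fourierL2 f η)

/-- The Hilbert transform `(ℍ f)(α) = (1 / (iπ)) p.v. ∫ f(β) / (α - β) dβ`; the principal value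
is taken symmetrically at `β = α` and at infinity, so that `ℍ 1 = 0`. -/
def hilbert (f : ℝ → ℂ) (α : ℝ) : ℂ :=
  1 / (Complex.I * π) *
    limUnder (𝓝[>] (0 : ℝ) ×ˢ (atTop : Filter ℝ)) (fun p : ℝ × ℝ =>
      ∫ β in {β : ℝ | p.1 < |α - β| ∧ |α - β| < p.2}, f β / ((α - β : ℝ) : ℂ))

/-- The Poisson kernel `K_ε(x)`. -/
def poissonKer (ε x : ℝ) : ℝ := ε / (π * (ε ^ 2 + x ^ 2))

/-- The harmonic extension `(K_{-y} * W)(x)` of `W` to points `z = x + iy` with `y < 0`. -/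
def poissonExt (W : ℝ → ℂ) (z : ℂ) : ℂ :=
  ∫ β : ℝ, (poissonKer (-z.im) (z.re - β) : ℂ) * W β

/-- `1 / Z_{,α'}` for the parametrization `Z` of the interface at a fixed time. -/
def invZα (Z : ℝ → ℂ) (α : ℝ) : ℂ := 1 / deriv Z α

/-- `b = - i ℍ (1 / |Z_{,α'}|²)`. -/
def bOf (Z : ℝ → ℂ) (α : ℝ) : ℂ :=
  -Complex.I * hilbert (fun β => ((1 / ‖deriv Z β‖ ^ 2 : ℝ) : ℂ)) α

/-- `B₁ = - 2 Im ([1 / conj Z_{,α'}, ℍ] ∂ (1 / Z_{,α'}))`. -/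
def B1Of (Z : ℝ → ℂ) (α : ℝ) : ℝ :=
  -2 * ((starRingEnd ℂ) (invZα Z α) * hilbert (fun β => deriv (invZα Z) β) α
    - hilbert (fun β => (starRingEnd ℂ) (invZα Z β) * deriv (invZα Z) β) α).im

/-- `Z : [0,T] × ℝ → ℂ` solves the Riemann mapping formulation of the one-phase Muskat problem,
in the class `(Z_{,α'} - 1, 1 / Z_{,α'} - 1) ∈ L^∞([0,T], H^s × H^s)`. -/
structure RiemannMappingSolution (s T : ℝ) (Z : ℝ → ℝ → ℂ) : Prop where
  contDiff : ∀ t ∈ Icc 0 T, ContDiff ℝ 1 (Z t)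
  deriv_ne_zero : ∀ t ∈ Icc 0 T, ∀ α, deriv (Z t) α ≠ 0
  regularity : InLinftyHs s T (fun t α => deriv (Z t) α - 1)
  regularity_inv : InLinftyHs s T (fun t α => 1 / deriv (Z t) α - 1)
  /-- `(∂_t + b ∂) (1/Z_{,α'}) = - (i / |Z_{,α'}|²) ∂ (1/Z_{,α'}) + B₁ / Z_{,α'}` -/
  evolution : ∀ t ∈ Icc 0 T, ∀ α : ℝ, ∃ dt : ℂ,
    HasDerivWithinAt (fun τ => invZα (Z τ) α) dt (Icc 0 T) t ∧
    dt + bOf (Z t) α * deriv (invZα (Z t)) α =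
      -Complex.I * ((1 / ‖deriv (Z t) α‖ ^ 2 : ℝ) : ℂ) * deriv (invZα (Z t)) α
        + (B1Of (Z t) α : ℂ) * invZα (Z t) α
  /-- The harmonic extension of `Z_{,α'}` is holomorphic on `P₋`, has no zeros there and tends
  to `1` at infinity. -/
  holomorphic : ∀ t ∈ Icc 0 T, DifferentiableOn ℂ (poissonExt (deriv (Z t))) lowerHalfPlane
  ext_ne_zero : ∀ t ∈ Icc 0 T, ∀ z ∈ lowerHalfPlane, poissonExt (deriv (Z t)) z ≠ 0
  ext_tendsto : ∀ t ∈ Icc 0 T, Tendsto (poissonExt (deriv (Z t))) atInfty (𝓝 1)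
  /-- The holomorphic map `Ψ(·,t)` on `P₋` with boundary value `Z(·,t)`, whose complex derivative
  is the harmonic extension of `Z_{,α'}`, satisfies `∂_t Ψ → 0` at infinity. -/
  normalization : ∃ Ψ dΨ : ℝ → ℂ → ℂ, ∀ t ∈ Icc 0 T,
    ContinuousOn (Ψ t) (closure lowerHalfPlane) ∧
    (∀ α : ℝ, Ψ t (α : ℂ) = Z t α) ∧
    (∀ z ∈ lowerHalfPlane, HasDerivAt (Ψ t) (poissonExt (deriv (Z t)) z) z) ∧
    (∀ z ∈ lowerHalfPlane, HasDerivWithinAt (fun τ => Ψ τ z) (dΨ t z) (Icc 0 T) t) ∧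
    Tendsto (dΨ t) atInfty (𝓝 0)

/-- `c = e^{-i ℍ g}`. -/
def cOf (g : ℝ → ℝ) (α : ℝ) : ℂ :=
  Complex.exp (-Complex.I * hilbert (fun β => (g β : ℂ)) α)

/-- `b* = - i ℍ (c²)`. -/
def bStarOf (g : ℝ → ℝ) (α : ℝ) : ℂ :=
  -Complex.I * hilbert (fun β => cOf g β ^ 2) α

/-- `g : [0,T] × ℝ → ℝ` solves `(∂_t + b* ∂) g = - c² |∂| g`, in the class
`g ∈ L^∞([0,T], H^s)`. -/
structure GSolution (s T : ℝ) (g : ℝ → ℝ → ℝ) : Prop where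
  /-- `g(·,t)` is the continuous representative of its class. -/
  continuous : ∀ t ∈ Icc 0 T, Continuous (g t)
  regularity : InLinftyHs s T (fun t α => (g t α : ℂ))
  evolution : ∀ t ∈ Icc 0 T, ∀ α : ℝ, ∃ dt : ℝ,
    HasDerivWithinAt (fun τ => g τ α) dt (Icc 0 T) t ∧
    (dt : ℂ) + bStarOf (g t) α * ((deriv (g t) α : ℝ) : ℂ) =
      -(cOf (g t) α ^ 2) * absDeriv (fun β => (g t β : ℂ)) α

/-- `ℓ` is the logarithm of the harmonic extension of `W` on `P₋` that vanishes at infinity,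
together with its continuous extension to the real line, i.e. the function `log W`. -/
def IsLogExtension (W : ℝ → ℂ) (ℓ : ℂ → ℂ) : Prop :=
  ContinuousOn ℓ (closure lowerHalfPlane) ∧
    (∀ z ∈ lowerHalfPlane, Complex.exp (ℓ z) = poissonExt W z) ∧
    Tendsto ℓ atInfty (𝓝 0)

/-- `g = Im (log Z_{,α'})` on `[0,T] × ℝ`. -/
def IsImLog (T : ℝ) (Z : ℝ → ℝ → ℂ) (g : ℝ → ℝ → ℝ) : Prop :=
  ∀ t ∈ Icc 0 T, ∃ ℓ : ℂ → ℂ, IsLogExtension (deriv (Z t)) ℓ ∧ ∀ α : ℝ, g t α = (ℓ (α : ℂ)).im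

/-- `Z_{,α'} = e^{i (I + ℍ) g}` on `[0,T] × ℝ`. -/
def IsExpTransform (T : ℝ) (g : ℝ → ℝ → ℝ) (Z : ℝ → ℝ → ℂ) : Prop :=
  ∀ t ∈ Icc 0 T, ∀ α : ℝ, deriv (Z t) α =
    Complex.exp (Complex.I * ((g t α : ℂ) + hilbert (fun β => (g t β : ℂ)) α))

end Muskat

end

noncomputable section

namespace Muskat

/-! Put `u = log Z_{,α'}`. As the boundary value of a function that is holomorphic in the lower half
plane and vanishes at infinity, `u` satisfies `ℍ u = u`. For real `g` the function `ℍ g` is purely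
imaginary, so `ℍ u = u` together with `g = Im u` is the same as `u = i (I + ℍ) g`, and then `Re u =
i ℍ g`. Hence `c² = e^{-2 Re u} = 1 / |Z_{,α'}|²` and `b* = b`: the coefficients of the two systems
coincide.

Because `∂ (1/Z_{,α'})` is fixed by `ℍ`, the commutator `B₁` can be computed, and the equation for
`1/Z_{,α'}` becomes `∂ₜ u = -rate u` with `rate u = b u' + i c² conj u' + b'` (`B1Of_eq`,
`evolution_iff`). Since `|∂| g = Re u'`, the equation for `g` is exactly the imaginary part of this
one (`gEvolution_iff`). The imaginary part carries the full equation because `rate u` is again a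
holomorphic boundary value: with `Q = b - i (c² - 1)`, which is `-i (I + ℍ)(c² - 1)`, one has `rate
u = (Q - i) u' + Q'` (`rate_eq`, `hilbert_rate`).

From `Z` to `g`, the equation gives the time derivative of `Re u = log |Z_{,α'}|`; applying `ℍ`,
which commutes with pointwise time derivatives (`hasDerivWithinAt_hilbert`), gives that of `Im u`.
The formula `Z_{,α'} = e^u` is a maximum principle argument (`eq_exp_logBdry`). From `g` to `Z`, the
roles of real and imaginary part are exchanged, and `Ψ(z,t) = a(t) + ∫₀^z e^U`, where `U` extends
`u`. The choice of `a` gives `∂ₜ Ψ = -(Q - i) e^U - i`, with `Q` extended in the same way, and this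
vanishes at infinity. Uniqueness holds because the time derivative of the difference of two maps `Ψ`
is constant in `z` and vanishes at infinity.

All functions are represented as inverse Fourier transforms of symbols with a weighted `L²` bound
uniform in time. This class is stable under products, exponentials, `ℍ` and, with loss of one order,
derivatives. Holomorphy of products is handled by `HardyExt`, whose link with `ℍ` is
`HardyExt.hilbert_eq`. -/

/-! ### The `L²` Fourier transform and its integral formula. -/

open Complex in
theorem fourierInv_eq_integral (F : ℝ → ℂ) (x : ℝ) :
    𝓕⁻ F x = ∫ η : ℝ, Complex.exp (2 * π * I * η * x) * F η := by
  rw [Real.fourierInv_eq']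
  refine integral_congr_ae (Eventually.of_forall fun η => ?_)
  simp only [smul_eq_mul]
  congr 2
  simp
  ring

theorem norm_exp_two_pi (η x : ℝ) : ‖Complex.exp (2 * π * Complex.I * η * x)‖ = 1 := by
  rw [Complex.norm_exp]; simp

theorem integrable_exp_mul {F : ℝ → ℂ} (hF : Integrable F) (x : ℝ) :
    Integrable fun η : ℝ => Complex.exp (2 * π * Complex.I * η * x) * F η := by
  refine hF.bdd_mul (c := 1) (Continuous.aestronglyMeasurable (by fun_prop))
    (Eventually.of_forall fun η => (norm_exp_two_pi η x).le)

theorem norm_fourierInv_le (F : ℝ → ℂ) (x : ℝ) : ‖𝓕⁻ F x‖ ≤ ∫ η, ‖F η‖ := by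
  rw [fourierInv_eq_integral]
  refine (norm_integral_le_integral_norm _).trans (le_of_eq ?_)
  simp [norm_exp_two_pi]

theorem continuous_fourierInv {F : ℝ → ℂ} (hF : Integrable F) : Continuous (𝓕⁻ F) := by
  have : 𝓕⁻ F = fun x : ℝ => ∫ η : ℝ, Complex.exp (2 * π * Complex.I * η * x) * F η :=
    funext fun x => fourierInv_eq_integral F x
  rw [this]
  refine continuous_of_dominated (fun x => (integrable_exp_mul hF x).1) (bound := fun η => ‖F η‖)
    (fun x => Eventually.of_forall fun η => by rw [norm_mul, norm_exp_two_pi, one_mul]) hF.norm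
    (Eventually.of_forall fun η => by fun_prop)

/-- Fubini for the Fourier kernel. This duality identifies the `L²` inverse transform by testing,
and in `poissonExt_fourierInv` it turns the Poisson integral into a multiplier. -/
theorem integral_fourierInv_smul {F G : ℝ → ℂ} (hF : Integrable F) (hG : Integrable G) :
    ∫ x, 𝓕⁻ F x • G x = ∫ x, F x • 𝓕⁻ G x := by
  have h1 : ∀ x, 𝓕⁻ F x = 𝓕 (fun y => F (-y)) x := fun x => by
    rw [Real.fourierInv_eq_fourier_comp_neg]
  have h2 : ∀ x, 𝓕⁻ G x = 𝓕 G (-x) := fun x => Real.fourierInv_eq_fourier_neg G x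
  have h := VectorFourier.integral_fourierIntegral_smul_eq_flip (e := Real.fourierChar)
    (μ := volume) (ν := volume) (L := innerₗ ℝ) Real.continuous_fourierChar continuous_inner
    hF.comp_neg hG
  simp only [h1, h2]
  rw [← integral_neg_eq_self (fun x => F x • 𝓕 G (-x))]
  simp only [neg_neg]
  rw [flip_innerₗ] at h
  exact h

/-- On `L¹ ∩ L²` the inverse Fourier transform of `L²` is given by the Fourier integral. -/
theorem coeFn_fourierInv_toLp {F : ℝ → ℂ} (h1 : Integrable F) (h2 : MemLp F 2) :
    ⇑(𝓕⁻ (h2.toLp F) : Lp ℂ 2 (volume : Measure ℝ)) =ᵐ[volume] 𝓕⁻ F := by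
  set G : Lp ℂ 2 (volume : Measure ℝ) := 𝓕⁻ (h2.toLp F) with hG
  refine ae_eq_of_integral_contDiff_smul_eq (μ := volume) ((Lp.memLp G).locallyIntegrable (by norm_num))
    (continuous_fourierInv h1).locallyIntegrable fun g hg hgc => ?_
  have hg₁ : HasCompactSupport (Complex.ofRealCLM ∘ g) := hgc.comp_left rfl
  have hg₂ : ContDiff ℝ ((⊤ : ℕ∞) : WithTop ℕ∞) (Complex.ofRealCLM ∘ g) := by fun_prop
  set φ := hg₁.toSchwartzMap hg₂ with hφ
  have e1 : ∫ x, g x • G x = Lp.toTemperedDistribution G φ := by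
    rw [Lp.toTemperedDistribution_apply]
    refine integral_congr_ae (Eventually.of_forall fun x => ?_)
    simp [hφ]
  have e2 : Lp.toTemperedDistribution G φ = ∫ x, 𝓕⁻ (φ : ℝ → ℂ) x • F x := by
    rw [hG, ← Lp.fourierInv_toTemperedDistribution_eq, TemperedDistribution.fourierInv_apply,
      Lp.toTemperedDistribution_apply]
    refine integral_congr_ae ?_
    filter_upwards [h2.coeFn_toLp] with x hx
    rw [hx, SchwartzMap.fourierInv_coe]
  rw [e1, e2, integral_fourierInv_smul φ.integrable h1]
  refine integral_congr_ae (Eventually.of_forall fun x => ?_)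
  simp [hφ]

theorem memLp_fourierInv {F : ℝ → ℂ} (h1 : Integrable F) (h2 : MemLp F 2) :
    MemLp (𝓕⁻ F) 2 :=
  (memLp_congr_ae (coeFn_fourierInv_toLp h1 h2)).1 (Lp.memLp _)

theorem fourierL2_fourierInv {F : ℝ → ℂ} (h1 : Integrable F) (h2 : MemLp F 2) :
    fourierL2 (𝓕⁻ F) =ᵐ[volume] F := by
  have hm := memLp_fourierInv h1 h2
  have e : hm.toLp _ = (𝓕⁻ (h2.toLp F) : Lp ℂ 2 (volume : Measure ℝ)) :=
    Lp.ext (hm.coeFn_toLp.trans (coeFn_fourierInv_toLp h1 h2).symm)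
  rw [fourierL2, dif_pos hm, e, FourierTransform.fourier_fourierInv_eq]
  exact h2.coeFn_toLp

theorem memLp_fourierL2 (f : ℝ → ℂ) : MemLp (fourierL2 f) 2 := by
  unfold fourierL2
  split_ifs with h
  · exact Lp.memLp _
  · exact MemLp.zero

theorem fourierInv_fourierL2 {f : ℝ → ℂ} (hc : Continuous f) (h2 : MemLp f 2)
    (hF : Integrable (fourierL2 f)) : 𝓕⁻ (fourierL2 f) = f := by
  have h := coeFn_fourierInv_toLp hF (memLp_fourierL2 f)
  have e : (memLp_fourierL2 f).toLp _ = (𝓕 (h2.toLp f) : Lp ℂ 2 (volume : Measure ℝ)) := by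
    refine Lp.ext ((memLp_fourierL2 f).coeFn_toLp.trans ?_)
    rw [fourierL2, dif_pos h2]
  rw [e, FourierTransform.fourierInv_fourier_eq] at h
  exact ((continuous_fourierInv hF).ae_eq_iff_eq volume hc).1 (h.symm.trans h2.coeFn_toLp)

theorem eLpNorm_fourierL2 {f : ℝ → ℂ} (h2 : MemLp f 2) :
    eLpNorm (fourierL2 f) 2 volume = eLpNorm f 2 volume := by
  have h : ‖(𝓕 (h2.toLp f) : Lp ℂ 2 (volume : Measure ℝ))‖ₑ = ‖h2.toLp f‖ₑ := by
    rw [enorm_eq_iff_norm_eq, Lp.norm_fourier_eq]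
  rw [Lp.enorm_def, Lp.enorm_def, eLpNorm_congr_ae h2.coeFn_toLp] at h
  rw [fourierL2, dif_pos h2, h]

/-- The `L²` Fourier transform turns derivatives into multiplication by `2πiη`. -/
theorem fourierL2_deriv {f f' : ℝ → ℂ} (hd : ∀ x, HasDerivAt f (f' x) x) (h2 : MemLp f 2)
    (h2' : MemLp f' 2) :
    fourierL2 f' =ᵐ[volume] fun η : ℝ => 2 * π * Complex.I * η * fourierL2 f η := by
  have hloc : LocallyIntegrable (fourierL2 f) volume :=
    (memLp_fourierL2 f).locallyIntegrable (by norm_num)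
  refine ae_eq_of_integral_contDiff_smul_eq (μ := volume)
    ((memLp_fourierL2 f').locallyIntegrable (by norm_num))
    (hloc.continuous_mul (g := fun η : ℝ => 2 * π * Complex.I * (η : ℂ)) (by fun_prop)) fun g hg hgc => ?_
  have hg₁ : HasCompactSupport (Complex.ofRealCLM ∘ g) := hgc.comp_left rfl
  have hg₂ : ContDiff ℝ ((⊤ : ℕ∞) : WithTop ℕ∞) (Complex.ofRealCLM ∘ g) := by fun_prop
  set φ := hg₁.toSchwartzMap hg₂ with hφ
  have key : ∀ {k : ℝ → ℂ} (hk : MemLp k 2) (ψ : SchwartzMap ℝ ℂ),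
      ∫ x, ψ x • fourierL2 k x = ∫ x, 𝓕 ψ x • k x := by
    intro k hk ψ
    have e : Lp.toTemperedDistribution (𝓕 (hk.toLp k) : Lp ℂ 2 (volume : Measure ℝ)) ψ =
        ∫ x, ψ x • fourierL2 k x := by
      rw [Lp.toTemperedDistribution_apply, fourierL2, dif_pos hk]
    rw [← e, ← Lp.fourier_toTemperedDistribution_eq, TemperedDistribution.fourier_apply,
      Lp.toTemperedDistribution_apply]
    refine integral_congr_ae ?_
    filter_upwards [hk.coeFn_toLp] with x hx
    rw [hx]
  have hI : ∀ (ψ : SchwartzMap ℝ ℂ) {k : ℝ → ℂ}, MemLp k 2 → Integrable fun x => ψ x * k x :=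
    fun ψ k hk => (ψ.memLp 2 volume).integrable_mul hk
  have hmul : ContDiff ℝ ((⊤ : ℕ∞) : WithTop ℕ∞) fun x : ℝ => (2 * π * Complex.I * x) * (Complex.ofRealCLM ∘ g) x := by
    refine ContDiff.mul ?_ hg₂
    exact contDiff_const.mul Complex.ofRealCLM.contDiff
  have hmc : HasCompactSupport fun x : ℝ => (2 * π * Complex.I * x) * (Complex.ofRealCLM ∘ g) x :=
    hg₁.mul_left
  set χ := hmc.toSchwartzMap hmul with hχ
  have e1 : ∫ x, g x • fourierL2 f' x = ∫ x, 𝓕 φ x • f' x := by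
    rw [← key h2']
    exact integral_congr_ae (Eventually.of_forall fun x => by simp [hφ])
  have e2 : ∫ x, g x • (2 * π * Complex.I * x * fourierL2 f x) = ∫ x, 𝓕 χ x • f x := by
    rw [← key h2]
    exact integral_congr_ae (Eventually.of_forall fun x => by simp [hχ]; ring)
  have e3 : ∀ x, HasDerivAt (⇑(𝓕 φ : SchwartzMap ℝ ℂ)) (-((𝓕 χ : SchwartzMap ℝ ℂ) x)) x := by
    intro x
    have := Real.hasDerivAt_fourier (f := φ) φ.integrable (by
      have := (hmc.toSchwartzMap hmul).integrable (μ := volume) |>.const_mul ((2 * π * Complex.I)⁻¹)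
      refine this.congr (Eventually.of_forall fun y => ?_)
      have : (2 * π * Complex.I) ≠ 0 := by simp [Real.pi_ne_zero]
      simp [hφ]
      field_simp
      simp [Complex.I_sq]) x
    rw [SchwartzMap.fourier_coe, SchwartzMap.fourier_coe]
    suffices e : 𝓕 (fun y : ℝ => (-2 * π * Complex.I * y) • φ y) x = -𝓕 (⇑χ) x by rwa [e] at this
    rw [Real.fourier_eq, Real.fourier_eq, ← integral_neg]
    congr 1; ext y
    simp [hφ, hχ, Circle.smul_def]
  rw [e1, e2]
  -- The derivative is moved from `f` to `𝓕 φ`, where `(𝓕 φ)' = -𝓕 χ` with `χ = 2πix φ`.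
  -- Integrability of all three products removes the boundary terms at infinity.
  have := integral_mul_deriv_eq_deriv_mul_of_integrable (u := ⇑(𝓕 φ : SchwartzMap ℝ ℂ)) (v := f)
    (u' := fun x => -((𝓕 χ : SchwartzMap ℝ ℂ) x)) (fun x _ => e3 x) (fun x _ => hd x)
    (hI _ h2') ((hI (𝓕 χ) h2).neg.congr (Eventually.of_forall fun x => by simp)) (hI _ h2)
  simp only [smul_eq_mul]
  rw [this, ← integral_neg]
  congr 1; ext x; ring

/-! ### The sine integral and its truncations. -/

/-- The function `R ↦ ∫_R^∞ sin x / x dx`, written as an absolutely convergent integral. -/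
def sinTail (R : ℝ) : ℝ :=
  ∫ t in Ioi (0 : ℝ), Real.exp (-R * t) * (Real.cos R + t * Real.sin R) / (1 + t ^ 2)

/-- From `|cos R + t sin R| ≤ 1 + tR ≤ e^{tR}`. The bound does not involve `R`, so one dominating
function serves both limits `R → 0` and `R → ∞`. -/
theorem norm_sinTail_integrand_le {R t : ℝ} (hR : 0 < R) (ht : 0 < t) :
    ‖Real.exp (-R * t) * (Real.cos R + t * Real.sin R) / (1 + t ^ 2)‖ ≤ 2 * (1 + t ^ 2)⁻¹ := by
  rw [norm_div, Real.norm_of_nonneg (by positivity : (0 : ℝ) ≤ 1 + t ^ 2), div_eq_mul_inv]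
  refine mul_le_mul_of_nonneg_right ?_ (by positivity)
  rw [norm_mul, Real.norm_of_nonneg (Real.exp_pos _).le, Real.norm_eq_abs]
  have h1 : |Real.cos R + t * Real.sin R| ≤ 1 + t * R := by
    refine (abs_add_le _ _).trans (add_le_add (Real.abs_cos_le_one R) ?_)
    rw [abs_mul, abs_of_pos ht]
    exact mul_le_mul_of_nonneg_left ((Real.abs_sin_le_abs).trans (abs_of_pos hR).le) ht.le
  have h2 : 1 + t * R ≤ Real.exp (t * R) := by linarith [Real.add_one_le_exp (t * R)]
  calc Real.exp (-R * t) * |Real.cos R + t * Real.sin R|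
      ≤ Real.exp (-R * t) * Real.exp (t * R) := by gcongr; exact h1.trans h2
    _ = 1 := by rw [← Real.exp_add]; ring_nf; simp
    _ ≤ 2 := by norm_num

theorem integrableOn_two_mul_inv_one_add_sq :
    IntegrableOn (fun t : ℝ => 2 * (1 + t ^ 2)⁻¹) (Ioi 0) :=
  (integrable_inv_one_add_sq.const_mul 2).integrableOn

theorem continuous_sinTail_integrand (R : ℝ) : Continuous fun t : ℝ =>
    Real.exp (-R * t) * (Real.cos R + t * Real.sin R) / (1 + t ^ 2) :=
  Continuous.div (by fun_prop) (by fun_prop) fun t => by positivity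

theorem norm_sinTail_le {R : ℝ} (hR : 0 < R) : ‖sinTail R‖ ≤ π := by
  have h := norm_integral_le_of_norm_le (μ := volume.restrict (Ioi (0 : ℝ)))
    integrableOn_two_mul_inv_one_add_sq
    (((ae_restrict_iff' measurableSet_Ioi).2 (Eventually.of_forall fun t ht =>
      norm_sinTail_integrand_le hR ht)))
  refine h.trans (le_of_eq ?_)
  rw [integral_const_mul, integral_Ioi_inv_one_add_sq]
  simp
  ring

theorem tendsto_sinTail_atTop : Tendsto sinTail atTop (𝓝 0) := by
  have : (0 : ℝ) = ∫ t in Ioi (0 : ℝ), (0 : ℝ) := by simp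
  rw [this]
  refine tendsto_integral_filter_of_dominated_convergence (fun t => 2 * (1 + t ^ 2)⁻¹)
    (Eventually.of_forall fun R => (continuous_sinTail_integrand R).aestronglyMeasurable) ?_
    integrableOn_two_mul_inv_one_add_sq ?_
  · filter_upwards [eventually_gt_atTop 0] with R hR
    exact (ae_restrict_iff' measurableSet_Ioi).2 (Eventually.of_forall fun t ht =>
      norm_sinTail_integrand_le hR ht)
  · refine (ae_restrict_iff' measurableSet_Ioi).2 (Eventually.of_forall fun t ht => ?_)
    rw [mem_Ioi] at ht
    have h0 : Tendsto (fun R : ℝ => Real.exp (-R * t) * (1 + t)) atTop (𝓝 0) := by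
      rw [show (0 : ℝ) = 0 * (1 + t) by simp]
      refine Tendsto.mul_const _ (Real.tendsto_exp_atBot.comp ?_)
      simp only [neg_mul]
      exact tendsto_neg_atTop_atBot.comp (tendsto_id.atTop_mul_const ht)
    refine squeeze_zero_norm (fun R => ?_) h0
    rw [norm_div, norm_mul, Real.norm_of_nonneg (Real.exp_pos _).le,
      Real.norm_of_nonneg (by positivity : (0 : ℝ) ≤ 1 + t ^ 2)]
    have h1 : ‖Real.cos R + t * Real.sin R‖ ≤ 1 + t := by
      refine (norm_add_le _ _).trans (add_le_add (Real.abs_cos_le_one R) ?_)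
      rw [norm_mul, Real.norm_of_nonneg ht.le]
      exact mul_le_of_le_one_right ht.le (Real.abs_sin_le_one R)
    refine (div_le_self (by positivity) (by nlinarith)).trans (by gcongr)

/-- At `R = 0` the integrand is `1 / (1 + t²)`. With the limit at infinity this evaluates the
Dirichlet integral. -/
theorem tendsto_sinTail_zero : Tendsto sinTail (𝓝[>] 0) (𝓝 (π / 2)) := by
  have : π / 2 = ∫ t in Ioi (0 : ℝ), (1 + t ^ 2)⁻¹ := by
    rw [integral_Ioi_inv_one_add_sq]; simp
  rw [this]
  refine tendsto_integral_filter_of_dominated_convergence (fun t => 2 * (1 + t ^ 2)⁻¹)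
    (Eventually.of_forall fun R => (continuous_sinTail_integrand R).aestronglyMeasurable) ?_
    integrableOn_two_mul_inv_one_add_sq ?_
  · filter_upwards [self_mem_nhdsWithin] with R hR
    exact (ae_restrict_iff' measurableSet_Ioi).2 (Eventually.of_forall fun t ht =>
      norm_sinTail_integrand_le hR ht)
  · refine Eventually.of_forall fun t => ?_
    have hc : Continuous fun R : ℝ =>
        Real.exp (-R * t) * (Real.cos R + t * Real.sin R) / (1 + t ^ 2) := by fun_prop
    have := (hc.tendsto 0).mono_left (nhdsWithin_le_nhds (s := Ioi 0))
    simpa using this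

/-- Differentiation in `R` produces a factor `1 + t²` that cancels the denominator and leaves
`-e^{-Rt} sin R`, whose integral in `t` is elementary. -/
theorem hasDerivAt_sinTail {R : ℝ} (hR : 0 < R) :
    HasDerivAt sinTail (-(Real.sin R / R)) R := by
  have hd : ∀ r t : ℝ, HasDerivAt (fun r : ℝ =>
      Real.exp (-r * t) * (Real.cos r + t * Real.sin r) / (1 + t ^ 2))
      (-(Real.exp (-r * t) * Real.sin r)) r := by
    intro r t
    have h1 : HasDerivAt (fun r : ℝ => Real.exp (-r * t)) (Real.exp (-r * t) * (-1 * t)) r :=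
      (((hasDerivAt_id r).neg.mul_const t).exp)
    have h2 : HasDerivAt (fun r : ℝ => Real.cos r + t * Real.sin r)
        (-Real.sin r + t * Real.cos r) r :=
      (Real.hasDerivAt_cos r).add ((Real.hasDerivAt_sin r).const_mul t)
    refine ((h1.mul h2).div_const (1 + t ^ 2)).congr_deriv ?_
    have : (1 + t ^ 2) ≠ 0 := by positivity
    field_simp
    ring
  have hI : Integrable (fun t : ℝ => Real.exp (-(R / 2) * t)) (volume.restrict (Ioi 0)) :=
    exp_neg_integrableOn_Ioi 0 (half_pos hR)
  have h := hasDerivAt_integral_of_dominated_loc_of_deriv_le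
    (μ := volume.restrict (Ioi (0 : ℝ))) (s := Ioi (R / 2))
    (F := fun r t => Real.exp (-r * t) * (Real.cos r + t * Real.sin r) / (1 + t ^ 2))
    (F' := fun r t => -(Real.exp (-r * t) * Real.sin r)) (x₀ := R)
    (bound := fun t => Real.exp (-(R / 2) * t)) (Ioi_mem_nhds (by linarith))
    (Eventually.of_forall fun R => (continuous_sinTail_integrand R).aestronglyMeasurable)
    (integrableOn_two_mul_inv_one_add_sq.mono' (continuous_sinTail_integrand R).aestronglyMeasurable
      ((ae_restrict_iff' measurableSet_Ioi).2 (Eventually.of_forall fun t ht =>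
      norm_sinTail_integrand_le hR ht)))
    (Continuous.aestronglyMeasurable (by fun_prop))
    ((ae_restrict_iff' measurableSet_Ioi).2 (Eventually.of_forall fun t ht r hr => by
      rw [mem_Ioi] at ht hr
      rw [norm_neg, norm_mul, Real.norm_of_nonneg (Real.exp_pos _).le]
      refine (mul_le_of_le_one_right (Real.exp_pos _).le (Real.abs_sin_le_one r)).trans ?_
      exact Real.exp_le_exp.2 (by nlinarith))) hI
    (Eventually.of_forall fun t r _ => hd r t)
  refine h.2.congr_deriv ?_
  rw [integral_neg, integral_mul_const]
  have : ∫ t in Ioi (0 : ℝ), Real.exp (-R * t) = 1 / R := by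
    rw [integral_exp_mul_Ioi (by linarith)]; simp
  rw [this]; ring

theorem integral_sin_div {a b : ℝ} (ha : 0 < a) (hab : a ≤ b) :
    ∫ x in a..b, Real.sin x / x = sinTail a - sinTail b := by
  have h := intervalIntegral.integral_eq_sub_of_hasDerivAt (a := a) (b := b)
    (f := fun x => -sinTail x) (f' := fun x => Real.sin x / x)
    (fun x hx => by
      rw [uIcc_of_le hab] at hx
      simpa using! (hasDerivAt_sinTail (ha.trans_le hx.1)).neg)
    (ContinuousOn.intervalIntegrable fun x hx => by
      rw [uIcc_of_le hab] at hx
      exact (Real.continuous_sin.continuousAt.div continuousAt_id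
        (ha.trans_le hx.1).ne').continuousWithinAt)
  rw [h]; ring

/-- The truncated sine integral `∫_ε^R sin(2πηx)/x dx`. -/
def truncSign (ε R η : ℝ) : ℝ := ∫ x in ε..R, Real.sin (2 * π * η * x) / x

theorem truncSign_neg (ε R η : ℝ) : truncSign ε R (-η) = -truncSign ε R η := by
  unfold truncSign
  rw [← intervalIntegral.integral_neg]
  congr 1; ext x
  rw [show 2 * π * -η * x = -(2 * π * η * x) by ring, Real.sin_neg]; ring

theorem truncSign_of_pos {ε R η : ℝ} (hε : 0 < ε) (hR : ε ≤ R) (hη : 0 < η) :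
    truncSign ε R η = sinTail (2 * π * η * ε) - sinTail (2 * π * η * R) := by
  have hc : 0 < 2 * π * η := by positivity
  rw [← integral_sin_div (by positivity) (by gcongr),
    ← intervalIntegral.mul_integral_comp_mul_left (f := fun x => Real.sin x / x),
    ← intervalIntegral.integral_const_mul]
  unfold truncSign
  congr 1; ext x
  rcases eq_or_ne x 0 with rfl | hx
  · simp
  · field_simp

/-- Independence of `ε`, `R` and `η` is the point: the constant dominates the truncated multipliers
under the frequency integral. -/
theorem abs_truncSign_le {ε R : ℝ} (hε : 0 < ε) (hR : ε ≤ R) (η : ℝ) :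
    |truncSign ε R η| ≤ 2 * π := by
  have pos : ∀ η : ℝ, 0 < η → |truncSign ε R η| ≤ 2 * π := fun η hη => by
    rw [truncSign_of_pos hε hR hη]
    have h1 := norm_sinTail_le (R := 2 * π * η * ε) (by positivity)
    have h2 := norm_sinTail_le (R := 2 * π * η * R) (by have := hε.trans_le hR; positivity)
    refine (norm_sub_le (sinTail _) _).trans (by linarith)
  rcases lt_trichotomy η 0 with h | rfl | h
  · rw [← neg_neg η, truncSign_neg, abs_neg]; exact pos _ (by linarith)
  · simp [truncSign]; positivity
  · exact pos η h

/-- The filter along which principal values are taken. -/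
abbrev pvFilter : Filter (ℝ × ℝ) := 𝓝[>] (0 : ℝ) ×ˢ (atTop : Filter ℝ)

theorem eventually_pvFilter : ∀ᶠ p : ℝ × ℝ in pvFilter, 0 < p.1 ∧ p.1 ≤ p.2 := by
  have h1 : ∀ᶠ ε in 𝓝[>] (0 : ℝ), 0 < ε ∧ ε < 1 := by
    filter_upwards [Ioo_mem_nhdsGT (zero_lt_one' ℝ)] with ε hε using hε
  filter_upwards [h1.prod_mk (eventually_ge_atTop (1 : ℝ))] with p hp
  exact ⟨hp.1.1, hp.1.2.le.trans hp.2⟩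

theorem tendsto_truncSign (η : ℝ) :
    Tendsto (fun p : ℝ × ℝ => truncSign p.1 p.2 η) pvFilter (𝓝 (π / 2 * SignType.sign η)) := by
  have pos : ∀ η : ℝ, 0 < η → Tendsto (fun p : ℝ × ℝ => truncSign p.1 p.2 η) pvFilter
      (𝓝 (π / 2)) := fun η hη => by
    have hc : 0 < 2 * π * η := by positivity
    have h1 : Tendsto (fun p : ℝ × ℝ => sinTail (2 * π * η * p.1)) pvFilter (𝓝 (π / 2)) := by
      refine tendsto_sinTail_zero.comp ((tendsto_nhdsWithin_iff.2 ⟨?_, ?_⟩).comp tendsto_fst)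
      · have : Continuous fun x : ℝ => 2 * π * η * x := by fun_prop
        simpa using (this.tendsto 0).mono_left (nhdsWithin_le_nhds (s := Ioi 0))
      · filter_upwards [self_mem_nhdsWithin] with x hx
        exact mul_pos hc hx
    have h2 : Tendsto (fun p : ℝ × ℝ => sinTail (2 * π * η * p.2)) pvFilter (𝓝 0) :=
      tendsto_sinTail_atTop.comp ((tendsto_id.const_mul_atTop hc).comp tendsto_snd)
    have h3 := h1.sub h2
    rw [sub_zero] at h3
    refine h3.congr' ?_
    filter_upwards [eventually_pvFilter] with p hp
    rw [truncSign_of_pos hp.1 hp.2 hη]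
  rcases lt_trichotomy η 0 with h | rfl | h
  · have := (pos (-η) (by linarith)).neg
    simp only [truncSign_neg, neg_neg] at this
    simpa [sign_neg h] using this
  · simp [truncSign]
  · simpa [sign_pos h] using pos η h

/-! ### The Hilbert transform as a Fourier multiplier. -/

/-- The truncated principal value integral `∫_{ε<|α-β|<R} f(β)/(α-β) dβ`, folded at `α`. -/
def hilbTrunc (f : ℝ → ℂ) (α : ℝ) (p : ℝ × ℝ) : ℂ :=
  ∫ x in p.1..p.2, (f (α - x) - f (α + x)) / (x : ℂ)

theorem setIntegral_eq_hilbTrunc {f : ℝ → ℂ} (hf : Continuous f) (α : ℝ) {p : ℝ × ℝ}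
    (hp : 0 < p.1 ∧ p.1 ≤ p.2) :
    ∫ β in {β : ℝ | p.1 < |α - β| ∧ |α - β| < p.2}, f β / ((α - β : ℝ) : ℂ) =
      hilbTrunc f α p := by
  obtain ⟨ε, R⟩ := p
  obtain ⟨hε, hR⟩ := hp
  simp only at hε hR ⊢
  have hset : {β : ℝ | ε < |α - β| ∧ |α - β| < R} =
      Ioo (α - R) (α - ε) ∪ Ioo (α + ε) (α + R) := by
    ext β
    simp only [mem_ofPred_eq, mem_union, mem_Ioo]
    constructor
    · rintro ⟨h1, h2⟩
      rcases abs_cases (α - β) with ⟨h, _⟩ | ⟨h, _⟩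
      · left; constructor <;> linarith
      · right; constructor <;> linarith
    · rintro (⟨h1, h2⟩ | ⟨h1, h2⟩)
      · rw [abs_of_pos (by linarith)]; constructor <;> linarith
      · rw [abs_of_neg (by linarith)]; constructor <;> linarith
  have hcont : ∀ s : Set ℝ, (∀ β ∈ s, α - β ≠ 0) →
      ContinuousOn (fun β : ℝ => f β / ((α - β : ℝ) : ℂ)) s := fun s hs =>
    hf.continuousOn.div (by fun_prop) fun β hβ => by exact_mod_cast hs β hβ
  have hi : ∀ a b : ℝ, (∀ β ∈ Icc a b, α - β ≠ 0) →
      IntegrableOn (fun β : ℝ => f β / ((α - β : ℝ) : ℂ)) (Ioo a b) := fun a b h =>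
    ((hcont _ h).integrableOn_Icc).mono_set Ioo_subset_Icc_self
  have hL : ∀ β ∈ Icc (α - R) (α - ε), α - β ≠ 0 := fun β hβ => by
    have := hβ.2; intro h; linarith
  have hRt : ∀ β ∈ Icc (α + ε) (α + R), α - β ≠ 0 := fun β hβ => by
    have := hβ.1; intro h; linarith
  rw [hset, setIntegral_union (by
      refine Set.disjoint_left.2 fun β h1 h2 => ?_
      have := h1.2; have := h2.1; linarith) measurableSet_Ioo (hi _ _ hL) (hi _ _ hRt),
    ← integral_Ioc_eq_integral_Ioo, ← integral_Ioc_eq_integral_Ioo,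
    ← intervalIntegral.integral_of_le (by linarith), ← intervalIntegral.integral_of_le (by linarith),
    ← intervalIntegral.integral_comp_sub_left, ← intervalIntegral.integral_comp_add_left,
    ← intervalIntegral.integral_add]
  · unfold hilbTrunc
    congr 1; ext x
    rw [sub_sub_cancel, sub_add_cancel_left]
    push_cast
    rw [div_neg]; ring
  · refine ContinuousOn.intervalIntegrable ?_
    rw [uIcc_of_le hR]
    refine (hcont {β | α - β ≠ 0} fun β hβ => hβ).comp (by fun_prop) fun x hx => ?_
    have := hx.1
    simp only [mem_ofPred_eq, sub_sub_cancel]; linarith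
  · refine ContinuousOn.intervalIntegrable ?_
    rw [uIcc_of_le hR]
    refine (hcont {β | α - β ≠ 0} fun β hβ => hβ).comp (by fun_prop) fun x hx => ?_
    have := hx.1
    simp only [mem_ofPred_eq]; intro h; linarith

theorem hilbert_eq_limUnder {f : ℝ → ℂ} (hf : Continuous f) (α : ℝ) :
    hilbert f α = 1 / (Complex.I * π) * limUnder pvFilter (hilbTrunc f α) := by
  unfold hilbert limUnder
  congr 2
  refine Filter.map_congr ?_
  filter_upwards [eventually_pvFilter] with p hp
  exact setIntegral_eq_hilbTrunc hf α hp

instance : NeBot pvFilter := by unfold pvFilter; infer_instance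

theorem hilbert_eq_of_tendsto {f : ℝ → ℂ} (hf : Continuous f) {α : ℝ} {L : ℂ}
    (h : Tendsto (hilbTrunc f α) pvFilter (𝓝 L)) : hilbert f α = 1 / (Complex.I * π) * L := by
  rw [hilbert_eq_limUnder hf, h.limUnder_eq]

/-- The folded truncation sees only the differences `f (α - x) - f (α + x)`. This permits replacing
`c²` by the decaying function `c² - 1` under `ℍ`. -/
theorem hilbert_const_add {f : ℝ → ℂ} (hf : Continuous f) (c : ℂ) :
    hilbert (fun x => c + f x) = hilbert f := by
  ext α
  rw [hilbert_eq_limUnder hf, hilbert_eq_limUnder (by fun_prop)]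
  have : hilbTrunc (fun x => c + f x) α = hilbTrunc f α := by
    ext p
    simp [hilbTrunc]
  rw [this]

/-- Since `e^{-iθ} - e^{iθ} = -2i sin θ`, Fubini moves the truncated integral onto the frequency
side; on `ε < x ≤ R` the double integrand is dominated by `(2/ε) ‖F‖`. -/
theorem hilbTrunc_fourierInv {F : ℝ → ℂ} (hF : Integrable F) (α : ℝ) {p : ℝ × ℝ}
    (hp : 0 < p.1 ∧ p.1 ≤ p.2) :
    hilbTrunc (𝓕⁻ F) α p =
      ∫ η : ℝ, (-2 * Complex.I * truncSign p.1 p.2 η) *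
        (Complex.exp (2 * π * Complex.I * η * α) * F η) := by
  obtain ⟨ε, R⟩ := p
  obtain ⟨hε, hR⟩ := hp
  simp only at hε hR ⊢
  have h1 : ∀ x : ℝ, (𝓕⁻ F (α - x) - 𝓕⁻ F (α + x)) / (x : ℂ) =
      ∫ η : ℝ, (-2 * Complex.I * (Real.sin (2 * π * η * x) / x : ℝ)) *
        (Complex.exp (2 * π * Complex.I * η * α) * F η) := by
    intro x
    rw [fourierInv_eq_integral, fourierInv_eq_integral,
      ← integral_sub (integrable_exp_mul hF _) (integrable_exp_mul hF _), ← integral_div]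
    congr 1; ext η
    have e1 : Complex.exp (2 * π * Complex.I * η * ((α - x : ℝ) : ℂ)) =
        Complex.exp (2 * π * Complex.I * η * α) * Complex.exp (-(2 * π * η * x : ℝ) * Complex.I) := by
      rw [← Complex.exp_add]; congr 1; push_cast; ring
    have e2 : Complex.exp (2 * π * Complex.I * η * ((α + x : ℝ) : ℂ)) =
        Complex.exp (2 * π * Complex.I * η * α) * Complex.exp ((2 * π * η * x : ℝ) * Complex.I) := by
      rw [← Complex.exp_add]; congr 1; push_cast; ring
    rw [e1, e2, Complex.ofReal_div, Complex.ofReal_sin, Complex.sin]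
    linear_combination (1 : ℂ) * (Complex.exp (2 * π * Complex.I * η * α)) * F η / x *
      (Complex.exp (-(2 * π * η * x : ℝ) * Complex.I) - Complex.exp ((2 * π * η * x : ℝ) * Complex.I))
      * (Complex.I_sq)
  unfold hilbTrunc
  simp only [h1]
  rw [intervalIntegral.integral_of_le hR, integral_integral_swap]
  · refine integral_congr_ae (Eventually.of_forall fun η => ?_)
    simp only
    rw [integral_mul_const, integral_const_mul]
    congr 2
    rw [truncSign, intervalIntegral.integral_of_le hR, ← integral_complex_ofReal]
  · have hm : Integrable (fun q : ℝ × ℝ => (2 / ε) * ‖F q.2‖)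
        ((volume.restrict (Ioc ε R)).prod volume) :=
      (hF.norm.comp_snd (volume.restrict (Ioc ε R))).const_mul (2 / ε)
    refine hm.mono' ?_ ?_
    · refine AEStronglyMeasurable.mul ?_ (AEStronglyMeasurable.mul ?_ ?_)
      · refine (Measurable.const_mul ?_ _).aestronglyMeasurable
        refine Complex.measurable_ofReal.comp (Measurable.div ?_ measurable_fst)
        exact (by fun_prop : Continuous fun a : ℝ × ℝ => Real.sin (2 * π * a.2 * a.1)).measurable
      · exact (by fun_prop : Continuous fun a : ℝ × ℝ =>
          Complex.exp (2 * π * Complex.I * a.2 * α)).aestronglyMeasurable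
      · exact hF.1.comp_snd
    · have : ∀ᵐ x ∂(volume.restrict (Ioc ε R)), x ∈ Ioc ε R := ae_restrict_mem measurableSet_Ioc
      have h2 := Measure.ae_prod_mem_iff_ae_ae_mem (μ := volume.restrict (Ioc ε R)) (ν := volume)
        (s := Ioc ε R ×ˢ (univ : Set ℝ)) (measurableSet_Ioc.prod MeasurableSet.univ)
      have h3 : ∀ᵐ z ∂((volume.restrict (Ioc ε R)).prod (volume : Measure ℝ)),
          z ∈ Ioc ε R ×ˢ (univ : Set ℝ) := h2.2 (by
        filter_upwards [this] with x hx
        exact Eventually.of_forall fun y => ⟨hx, mem_univ _⟩)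
      filter_upwards [h3] with z hz
      have hz1 : ε < z.1 := hz.1.1
      simp only [Function.uncurry]
      rw [norm_mul, norm_mul (Complex.exp _), norm_exp_two_pi, one_mul]
      rw [norm_mul]
      refine mul_le_mul_of_nonneg_right ?_ (norm_nonneg _)
      rw [Complex.norm_real, norm_div, Real.norm_of_nonneg (hε.trans hz1).le]
      simp only [norm_neg, Complex.norm_ofNat, norm_mul, Complex.norm_I, mul_one]
      rw [← mul_div_assoc]
      refine div_le_div₀ (by norm_num) ?_ hε hz1.le
      nlinarith [Real.abs_sin_le_one (2 * π * z.2 * z.1), Real.norm_eq_abs (Real.sin (2 * π * z.2 * z.1))]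

theorem continuous_truncSign {p : ℝ × ℝ} (hp : 0 < p.1 ∧ p.1 ≤ p.2) :
    Continuous (truncSign p.1 p.2) := by
  unfold truncSign
  simp only [intervalIntegral.integral_of_le hp.2]
  refine continuous_of_dominated (F := fun (η : ℝ) (x : ℝ) => Real.sin (2 * π * η * x) / x)
    (bound := fun x => 1 / p.1) (fun η => ?_) (fun η => ?_) ?_ ?_
  · refine (Measurable.div ?_ measurable_id).aestronglyMeasurable
    exact (by fun_prop : Continuous fun a : ℝ => Real.sin (2 * π * η * a)).measurable
  · filter_upwards [ae_restrict_mem measurableSet_Ioc] with x hx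
    have hx0 : 0 < x := hp.1.trans hx.1
    rw [norm_div, Real.norm_of_nonneg hx0.le]
    exact div_le_div₀ zero_le_one (Real.abs_sin_le_one _) hp.1 hx.1.le
  · exact integrable_const _
  · refine Eventually.of_forall fun x => ?_
    fun_prop

theorem tendsto_hilbTrunc_fourierInv {F : ℝ → ℂ} (hF : Integrable F) (α : ℝ) :
    Tendsto (hilbTrunc (𝓕⁻ F) α) pvFilter
      (𝓝 (Complex.I * π * 𝓕⁻ (fun η : ℝ => -(SignType.sign η : ℂ) * F η) α)) := by
  rw [fourierInv_eq_integral, ← integral_const_mul]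
  have h : Tendsto (fun p : ℝ × ℝ => ∫ η : ℝ, (-2 * Complex.I * truncSign p.1 p.2 η) *
        (Complex.exp (2 * π * Complex.I * η * α) * F η)) pvFilter
      (𝓝 (∫ η : ℝ, Complex.I * π * (Complex.exp (2 * π * Complex.I * η * α) *
        (-(SignType.sign η : ℂ) * F η)))) := by
    refine tendsto_integral_filter_of_dominated_convergence (fun η => 4 * π * ‖F η‖) ?_ ?_
      (hF.norm.const_mul _) ?_
    · filter_upwards [eventually_pvFilter] with p hp
      refine AEStronglyMeasurable.mul (Continuous.aestronglyMeasurable ?_) (integrable_exp_mul hF α).1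
      have := continuous_truncSign hp
      fun_prop
    · filter_upwards [eventually_pvFilter] with p hp
      refine Eventually.of_forall fun η => ?_
      rw [norm_mul, norm_mul (Complex.exp _), norm_exp_two_pi, one_mul]
      refine mul_le_mul_of_nonneg_right ?_ (norm_nonneg _)
      have := abs_truncSign_le hp.1 hp.2 η
      simp
      linarith
    · refine Eventually.of_forall fun η => ?_
      have h1 : Tendsto (fun p : ℝ × ℝ => (truncSign p.1 p.2 η : ℂ)) pvFilter
          (𝓝 ((π / 2 * SignType.sign η : ℝ) : ℂ)) :=
        (Complex.continuous_ofReal.tendsto _).comp (tendsto_truncSign η)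
      have h2 := (h1.const_mul (-2 * Complex.I)).mul_const
        (Complex.exp (2 * π * Complex.I * η * α) * F η)
      convert h2 using 2
      have : (((SignType.sign η : ℝ)) : ℂ) = (SignType.sign η : ℂ) := by
        cases SignType.sign η <;> simp
      push_cast
      rw [this]; ring
  refine h.congr' ?_
  filter_upwards [eventually_pvFilter] with p hp
  rw [hilbTrunc_fourierInv hF α hp]

theorem hilbert_fourierInv {F : ℝ → ℂ} (hF : Integrable F) :
    hilbert (𝓕⁻ F) = 𝓕⁻ (fun η : ℝ => -(SignType.sign η : ℂ) * F η) := by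
  ext α
  rw [hilbert_eq_of_tendsto (continuous_fourierInv hF) (tendsto_hilbTrunc_fourierInv hF α)]
  have : Complex.I * (π : ℂ) ≠ 0 := by simp [Real.pi_ne_zero]
  field_simp

/-! ### Weighted symbols: embedding, products and exponentials. -/

/-- The weight `(1 + |ξ|²)^s` at `ξ = 2πη`. -/
def sobW (s η : ℝ) : ℝ≥0∞ := ENNReal.ofReal ((1 + (2 * π * η) ^ 2) ^ s)

theorem one_le_base (η : ℝ) : (1 : ℝ) ≤ 1 + (2 * π * η) ^ 2 := by nlinarith [sq_nonneg (2 * π * η)]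

theorem sobW_add (s t η : ℝ) : sobW (s + t) η = sobW s η * sobW t η := by
  have := one_le_base η
  rw [sobW, sobW, sobW, ← ENNReal.ofReal_mul (by positivity), Real.rpow_add (by linarith)]

theorem sobW_zero (η : ℝ) : sobW 0 η = 1 := by simp [sobW]

theorem sobW_mono {s t : ℝ} (h : s ≤ t) (η : ℝ) : sobW s η ≤ sobW t η :=
  ENNReal.ofReal_le_ofReal (Real.rpow_le_rpow_of_exponent_le (one_le_base η) h)

theorem one_le_sobW {s : ℝ} (h : 0 ≤ s) (η : ℝ) : 1 ≤ sobW s η := by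
  rw [← sobW_zero η]; exact sobW_mono h η

theorem sobW_one (η : ℝ) : sobW 1 η = 1 + ‖(2 * π * η : ℝ)‖ₑ ^ 2 := by
  rw [sobW, Real.rpow_one, ENNReal.ofReal_add zero_le_one (sq_nonneg _), ENNReal.ofReal_one]
  congr 1
  rw [← ofReal_norm, ← ENNReal.ofReal_pow (norm_nonneg _), Real.norm_eq_abs, sq_abs]

theorem sobW_ne_top (s η : ℝ) : sobW s η ≠ ⊤ := ENNReal.ofReal_ne_top

theorem measurable_sobW (s : ℝ) : Measurable (sobW s) := by unfold sobW; fun_prop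

/-- The squared weighted `L²` norm of a symbol. -/
def symSq (s : ℝ) (F : ℝ → ℂ) : ℝ≥0∞ := ∫⁻ η, sobW s η * ‖F η‖ₑ ^ 2

theorem symSq_congr {s : ℝ} {F G : ℝ → ℂ} (h : F =ᵐ[volume] G) : symSq s F = symSq s G :=
  lintegral_congr_ae (h.mono fun η hη => by simp only [hη])

theorem eLpNorm_two_sq (f : ℝ → ℂ) : eLpNorm f 2 volume ^ 2 = ∫⁻ x, ‖f x‖ₑ ^ 2 := by
  rw [eLpNorm_eq_lintegral_rpow_enorm_toReal (by norm_num) (by norm_num)]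
  simp only [ENNReal.toReal_ofNat, one_div]
  rw [← ENNReal.rpow_natCast, ← ENNReal.rpow_mul]
  simp

theorem sobolevNorm_sq (s : ℝ) (f : ℝ → ℂ) : sobolevNorm s f ^ 2 = symSq s (fourierL2 f) := by
  rw [sobolevNorm, eLpNorm_two_sq, symSq]
  congr 1; ext η
  have h0 : (0 : ℝ) ≤ 1 + (2 * π * η) ^ 2 := by positivity
  rw [enorm_mul, mul_pow]
  congr 1
  rw [← ofReal_norm, Complex.norm_real, Real.norm_of_nonneg (by positivity),
    ← ENNReal.ofReal_pow (by positivity), ← Real.rpow_natCast, ← Real.rpow_mul h0]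
  simp [sobW]

theorem lintegral_mul_sq_le {X : Type*} [MeasurableSpace X] {μ : Measure X} {f g : X → ℝ≥0∞}
    (hf : AEMeasurable f μ) (hg : AEMeasurable g μ) :
    (∫⁻ x, f x * g x ∂μ) ^ 2 ≤ (∫⁻ x, f x ^ 2 ∂μ) * ∫⁻ x, g x ^ 2 ∂μ := by
  have h := ENNReal.lintegral_mul_le_Lp_mul_Lq μ Real.HolderConjugate.two_two hf hg
  have h2 := pow_le_pow_left' h 2
  simp only [Pi.mul_apply] at h2
  refine h2.trans (le_of_eq ?_)
  rw [mul_pow, ← ENNReal.rpow_natCast, ← ENNReal.rpow_natCast, ← ENNReal.rpow_mul,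
    ← ENNReal.rpow_mul]
  simp

/-- `F` is a measurable symbol with squared weighted norm at most `M`. -/
def IsSymbol (s : ℝ) (M : ℝ≥0) (F : ℝ → ℂ) : Prop := Measurable F ∧ symSq s F ≤ M

theorem IsSymbol.mono {s t : ℝ} {M N : ℝ≥0} {F : ℝ → ℂ} (h : IsSymbol s M F) (hst : t ≤ s)
    (hMN : M ≤ N) : IsSymbol t N F := by
  refine ⟨h.1, le_trans ?_ (h.2.trans (ENNReal.coe_le_coe.2 hMN))⟩
  exact lintegral_mono fun η => mul_le_mul_left (sobW_mono hst η) _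

theorem IsSymbol.of_le {s t : ℝ} {M K : ℝ≥0} {F G : ℝ → ℂ} (h : IsSymbol s M F) (hG : Measurable G)
    (hle : ∀ η, sobW t η * ‖G η‖ₑ ^ 2 ≤ K * (sobW s η * ‖F η‖ₑ ^ 2)) : IsSymbol t (K * M) G := by
  refine ⟨hG, (lintegral_mono hle).trans ?_⟩
  rw [lintegral_const_mul' _ _ ENNReal.coe_ne_top, ENNReal.coe_mul]
  exact mul_le_mul_right h.2 _

theorem IsSymbol.of_norm_le {s : ℝ} {M : ℝ≥0} {F G : ℝ → ℂ} (h : IsSymbol s M F)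
    (hG : Measurable G) (hle : ∀ η, ‖G η‖ ≤ ‖F η‖) : IsSymbol s M G := by
  have := h.of_le (K := 1) (t := s) hG fun η => by
    rw [ENNReal.coe_one, one_mul]
    gcongr
    exact enorm_le_iff_norm_le.2 (hle η)
  rwa [one_mul] at this

theorem IsSymbol.const_mul {s : ℝ} {M : ℝ≥0} {F : ℝ → ℂ} (h : IsSymbol s M F) (c : ℂ) :
    IsSymbol s (‖c‖₊ ^ 2 * M) fun η => c * F η := by
  refine h.of_le (h.1.const_mul c) fun η => le_of_eq ?_
  rw [enorm_mul, mul_pow, ENNReal.coe_pow, ← enorm_eq_nnnorm]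
  ring

theorem IsSymbol.add {s : ℝ} {M N : ℝ≥0} {F G : ℝ → ℂ} (hF : IsSymbol s M F) (hG : IsSymbol s N G) :
    IsSymbol s (2 * M + 2 * N) fun η => F η + G η := by
  refine ⟨hF.1.add hG.1, ?_⟩
  have hle : ∀ η, sobW s η * ‖F η + G η‖ₑ ^ 2 ≤
      2 * (sobW s η * ‖F η‖ₑ ^ 2) + 2 * (sobW s η * ‖G η‖ₑ ^ 2) := fun η => by
    have h1 : ‖F η + G η‖ₑ ^ 2 ≤ 2 * ‖F η‖ₑ ^ 2 + 2 * ‖G η‖ₑ ^ 2 := by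
      simp only [enorm_eq_nnnorm]
      norm_cast
      rw [← NNReal.coe_le_coe]
      push_cast
      have := norm_add_le (F η) (G η)
      nlinarith [sq_nonneg (‖F η‖ - ‖G η‖), norm_nonneg (F η + G η), norm_nonneg (F η),
        norm_nonneg (G η)]
    calc sobW s η * ‖F η + G η‖ₑ ^ 2 ≤ sobW s η * (2 * ‖F η‖ₑ ^ 2 + 2 * ‖G η‖ₑ ^ 2) := by gcongr
      _ = _ := by ring
  refine (lintegral_mono hle).trans ?_
  rw [lintegral_add_left (f := fun η => 2 * (sobW s η * ‖F η‖ₑ ^ 2)) (((measurable_sobW s).mul (hF.1.enorm.pow_const 2)).const_mul 2),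
    lintegral_const_mul' _ _ (by simp), lintegral_const_mul' _ _ (by simp)]
  push_cast
  exact add_le_add (mul_le_mul_right hF.2 _) (mul_le_mul_right hG.2 _)

theorem IsSymbol.lintegral_sq_le {s : ℝ} {M : ℝ≥0} {F : ℝ → ℂ} (h : IsSymbol s M F) (hs : 0 ≤ s) :
    ∫⁻ η, ‖F η‖ₑ ^ 2 ≤ M := by
  refine le_trans (lintegral_mono fun η => ?_) h.2
  exact le_mul_of_one_le_left zero_le (one_le_sobW hs η)

theorem IsSymbol.memLp {s : ℝ} {M : ℝ≥0} {F : ℝ → ℂ} (h : IsSymbol s M F) (hs : 0 ≤ s) :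
    MemLp F 2 := by
  refine ⟨h.1.aestronglyMeasurable, ?_⟩
  have h1 := eLpNorm_two_sq F
  have h2 : eLpNorm F 2 volume ^ 2 < ⊤ := by
    rw [h1]; exact (h.lintegral_sq_le hs).trans_lt ENNReal.coe_lt_top
  exact (ENNReal.pow_lt_top_iff.1 h2).resolve_right (by norm_num)

/-- For `s = 1` the integral of `1 / (1 + (2πη)²)` is `1/2`; larger `s` only decreases the
integrand. -/
theorem lintegral_sobW_neg_le {s : ℝ} (hs : 1 ≤ s) : ∫⁻ η, sobW (-s) η ≤ 1 := by
  refine (lintegral_mono fun η => sobW_mono (neg_le_neg hs) η).trans ?_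
  have hi : Integrable fun η : ℝ => (1 + (2 * π * η) ^ 2)⁻¹ :=
    integrable_inv_one_add_sq.comp_mul_left' (by positivity)
  have he : ∀ η, sobW (-1) η = ENNReal.ofReal ((1 + (2 * π * η) ^ 2)⁻¹) := fun η => by
    rw [sobW, Real.rpow_neg_one]
  simp only [he]
  rw [← ofReal_integral_eq_lintegral_ofReal hi (Eventually.of_forall fun η => by positivity),
    Measure.integral_comp_mul_left (fun x : ℝ => (1 + x ^ 2)⁻¹), integral_univ_inv_one_add_sq,
    ENNReal.ofReal_le_one, smul_eq_mul, abs_of_pos (by positivity)]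
  have := Real.pi_pos
  field_simp
  norm_num

/-- Cauchy–Schwarz against the weight. This is the embedding of `H^s` into functions with integrable
Fourier transform, on which continuity, boundedness and all pointwise Fourier integrals rest. -/
theorem IsSymbol.lintegral_enorm_sq_le {s : ℝ} {M : ℝ≥0} {F : ℝ → ℂ} (h : IsSymbol s M F)
    (hs : 1 ≤ s) : (∫⁻ η, ‖F η‖ₑ) ^ 2 ≤ M := by
  have e : ∀ η, ‖F η‖ₑ = sobW (-s / 2) η * (sobW (s / 2) η * ‖F η‖ₑ) := fun η => by
    rw [← mul_assoc, ← sobW_add, show -s / 2 + s / 2 = 0 by ring, sobW_zero, one_mul]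
  have e2 : ∀ (t η : ℝ), sobW (t / 2) η ^ 2 = sobW t η := fun t η => by
    rw [sq, ← sobW_add, add_halves]
  rw [lintegral_congr e]
  refine (lintegral_mul_sq_le (g := fun η => sobW (s / 2) η * ‖F η‖ₑ)
    (measurable_sobW _).aemeasurable ((measurable_sobW _).mul h.1.enorm).aemeasurable).trans ?_
  simp only [mul_pow, e2]
  calc _ ≤ 1 * (M : ℝ≥0∞) := mul_le_mul' (lintegral_sobW_neg_le hs) h.2
    _ = M := one_mul _

theorem IsSymbol.integrable {s : ℝ} {M : ℝ≥0} {F : ℝ → ℂ} (h : IsSymbol s M F) (hs : 1 ≤ s) :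
    Integrable F := by
  refine ⟨h.1.aestronglyMeasurable, ?_⟩
  exact (ENNReal.pow_lt_top_iff.1 ((h.lintegral_enorm_sq_le hs).trans_lt
    ENNReal.coe_lt_top)).resolve_right (by norm_num)

theorem IsSymbol.integral_norm_le {s : ℝ} {M K : ℝ≥0} {F : ℝ → ℂ} (h : IsSymbol s M F) (hs : 1 ≤ s)
    (hK : M ≤ K ^ 2) : ∫ η, ‖F η‖ ≤ K := by
  rw [integral_norm_eq_lintegral_enorm h.1.aestronglyMeasurable]
  refine ENNReal.toReal_le_coe_of_le_coe ?_
  have h1 : (∫⁻ η, ‖F η‖ₑ) ^ 2 ≤ (K : ℝ≥0∞) ^ 2 :=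
    (h.lintegral_enorm_sq_le hs).trans (by exact_mod_cast hK)
  exact (ENNReal.pow_le_pow_left_iff (by norm_num)).1 h1

/-- If `|a| ≤ |b|`, then `(a + b)² ≤ 4 b²`, so the weight at a sum is controlled by the weight at
the larger frequency. This inequality makes `H^s` an algebra. -/
theorem sobW_le_add {s : ℝ} (hs : 0 ≤ s) (a b : ℝ) :
    sobW s (a + b) ≤ ENNReal.ofReal (4 ^ s) * (sobW s a + sobW s b) := by
  unfold sobW
  rw [← ENNReal.ofReal_add (by positivity) (by positivity), ← ENNReal.ofReal_mul (by positivity)]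
  refine ENNReal.ofReal_le_ofReal ?_
  have key : ∀ x y : ℝ, 1 ≤ x → x ≤ y → (4 * y) ^ s ≤ 4 ^ s * (x ^ s + y ^ s) := fun x y hx hy => by
    rw [Real.mul_rpow (by norm_num) (by linarith)]
    have : 0 ≤ x ^ s := by positivity
    have : 0 ≤ (4 : ℝ) ^ s := by positivity
    nlinarith
  have hle : ∀ a b : ℝ, 1 + (2 * π * a) ^ 2 ≤ 1 + (2 * π * b) ^ 2 →
      1 + (2 * π * (a + b)) ^ 2 ≤ 4 * (1 + (2 * π * b) ^ 2) := fun a b h => by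
    nlinarith [sq_nonneg (2 * π * a - 2 * π * b)]
  rcases le_total (1 + (2 * π * a) ^ 2) (1 + (2 * π * b) ^ 2) with h | h
  · exact (Real.rpow_le_rpow (by positivity) (hle a b h) hs).trans (key _ _ (one_le_base a) h)
  · rw [add_comm a b, add_comm ((1 + (2 * π * a) ^ 2) ^ s)]
    exact (Real.rpow_le_rpow (by positivity) (hle b a h) hs).trans (key _ _ (one_le_base b) h)

open scoped Convolution in
/-- Products of functions correspond to convolutions of symbols. -/
theorem IsSymbol.conv {s : ℝ} (hs : 1 ≤ s) {M N : ℝ≥0} {F G : ℝ → ℂ} (hF : IsSymbol s M F)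
    (hG : IsSymbol s N G) :
    ∃ H, IsSymbol s (Real.toNNReal (4 ^ s) * 2 * M * N) H ∧ ∀ x, 𝓕⁻ H x = 𝓕⁻ F x * 𝓕⁻ G x := by
  refine ⟨F ⋆[ContinuousLinearMap.mul ℂ ℂ] G, ⟨?_, ?_⟩, fun x => ?_⟩
  · have : StronglyMeasurable fun x : ℝ => ∫ t, F t * G (x - t) :=
      StronglyMeasurable.integral_prod_right (f := fun x t => F t * G (x - t))
        (Measurable.stronglyMeasurable ((hF.1.comp measurable_snd).mul
          (hG.1.comp (measurable_fst.sub measurable_snd))))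
    exact this.measurable
  · have e2 : ∀ (t η : ℝ), sobW (t / 2) η ^ 2 = sobW t η := fun t η => by
      rw [sq, ← sobW_add, add_halves]
    have hcan : ∀ (t η : ℝ), sobW (-t) η * sobW t η = 1 := fun t η => by
      rw [← sobW_add, neg_add_cancel, sobW_zero]
    set P : ℝ → ℝ≥0∞ := fun t => sobW s t * ‖F t‖ₑ ^ 2 with hP
    set Q : ℝ → ℝ≥0∞ := fun t => sobW s t * ‖G t‖ₑ ^ 2 with hQ
    have hPm : Measurable P := (measurable_sobW s).mul (hF.1.enorm.pow_const 2)
    have hQm : Measurable Q := (measurable_sobW s).mul (hG.1.enorm.pow_const 2)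
    -- Cauchy–Schwarz in `t` with the weights at `t` and `x - t` split off. The reciprocal weights,
    -- multiplied by the weight at `x`, integrate to at most `4^s * 2` by `sobW_le_add`; what
    -- remains is a convolution of two integrable functions.
    have step : ∀ x, sobW s x * ‖(F ⋆[ContinuousLinearMap.mul ℂ ℂ] G) x‖ₑ ^ 2 ≤
        (ENNReal.ofReal (4 ^ s) * 2) * ∫⁻ t, P t * Q (x - t) := by
      intro x
      have h1 : ‖(F ⋆[ContinuousLinearMap.mul ℂ ℂ] G) x‖ₑ ≤ ∫⁻ t, ‖F t‖ₑ * ‖G (x - t)‖ₑ := by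
        refine (enorm_integral_le_lintegral_enorm _).trans (le_of_eq ?_)
        simp [enorm_mul]
      have h2 : ∀ t, ‖F t‖ₑ * ‖G (x - t)‖ₑ = (sobW (-s / 2) t * sobW (-s / 2) (x - t)) *
          ((sobW (s / 2) t * ‖F t‖ₑ) * (sobW (s / 2) (x - t) * ‖G (x - t)‖ₑ)) := fun t => by
        have a1 := hcan (s / 2) t
        have a2 := hcan (s / 2) (x - t)
        rw [show -(s / 2) = -s / 2 by ring] at a1 a2
        calc ‖F t‖ₑ * ‖G (x - t)‖ₑ = (sobW (-s / 2) t * sobW (s / 2) t) *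
            (sobW (-s / 2) (x - t) * sobW (s / 2) (x - t)) * (‖F t‖ₑ * ‖G (x - t)‖ₑ) := by
              rw [a1, a2, one_mul, one_mul]
          _ = _ := by ring
      have h3 : ‖(F ⋆[ContinuousLinearMap.mul ℂ ℂ] G) x‖ₑ ^ 2 ≤
          (∫⁻ t, sobW (-s) t * sobW (-s) (x - t)) * ∫⁻ t, P t * Q (x - t) := by
        refine (pow_le_pow_left' h1 2).trans ?_
        simp only [h2]
        refine (lintegral_mul_sq_le ?_ ?_).trans (le_of_eq ?_)
        · exact ((measurable_sobW _).mul ((measurable_sobW _).comp (by fun_prop))).aemeasurable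
        · refine (((measurable_sobW _).mul hF.1.enorm).mul (Measurable.mul ?_ ?_)).aemeasurable
          · exact (measurable_sobW _).comp (by fun_prop)
          · exact hG.1.enorm.comp (by fun_prop)
        · simp only [mul_pow, e2, hP, hQ]
      have h4 : sobW s x * ∫⁻ t, sobW (-s) t * sobW (-s) (x - t) ≤ ENNReal.ofReal (4 ^ s) * 2 := by
        rw [← lintegral_const_mul' _ _ (sobW_ne_top s x)]
        have : ∀ t, sobW s x * (sobW (-s) t * sobW (-s) (x - t)) ≤
            ENNReal.ofReal (4 ^ s) * (sobW (-s) (x - t) + sobW (-s) t) := fun t => by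
          have h := sobW_le_add (s := s) (by linarith) t (x - t)
          rw [add_sub_cancel] at h
          calc _ ≤ (ENNReal.ofReal (4 ^ s) * (sobW s t + sobW s (x - t))) *
                (sobW (-s) t * sobW (-s) (x - t)) := by gcongr
            _ = ENNReal.ofReal (4 ^ s) * ((sobW (-s) t * sobW s t) * sobW (-s) (x - t) +
                (sobW (-s) (x - t) * sobW s (x - t)) * sobW (-s) t) := by ring
            _ = _ := by rw [hcan, hcan, one_mul, one_mul]
        refine (lintegral_mono this).trans ?_
        rw [lintegral_const_mul' _ _ ENNReal.ofReal_ne_top,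
          lintegral_add_right _ (measurable_sobW _), lintegral_sub_left_eq_self (sobW (-s)) x]
        gcongr
        calc _ ≤ (1 : ℝ≥0∞) + 1 :=
              add_le_add (lintegral_sobW_neg_le hs) (lintegral_sobW_neg_le hs)
          _ = 2 := by norm_num
      calc _ ≤ sobW s x * ((∫⁻ t, sobW (-s) t * sobW (-s) (x - t)) * ∫⁻ t, P t * Q (x - t)) := by
            gcongr
        _ = (sobW s x * ∫⁻ t, sobW (-s) t * sobW (-s) (x - t)) * ∫⁻ t, P t * Q (x - t) := by ring
        _ ≤ _ := by gcongr
    refine (lintegral_mono step).trans ?_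
    rw [lintegral_const_mul' _ _ (ENNReal.mul_ne_top ENNReal.ofReal_ne_top (by simp)),
      lintegral_lintegral_swap ((hPm.comp measurable_snd).mul
        (hQm.comp (measurable_fst.sub measurable_snd))).aemeasurable]
    have : ∀ t, ∫⁻ x, P t * Q (x - t) = P t * ∫⁻ x, Q x := fun t => by
      rw [lintegral_const_mul (P t) (f := fun x => Q (x - t)) (hQm.comp (by fun_prop)),
        lintegral_sub_right_eq_self Q t]
    simp only [this]
    rw [lintegral_mul_const _ hPm]
    push_cast
    rw [mul_assoc (_ * _) (M : ℝ≥0∞)]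
    exact mul_le_mul' le_rfl (mul_le_mul' hF.2 hG.2)
  · rw [Real.fourierInv_eq_fourier_neg, Real.fourierInv_eq_fourier_neg,
      Real.fourierInv_eq_fourier_neg, Real.fourier_mul_convolution_eq (hF.integrable hs)
        (hG.integrable hs)]

theorem tsum_mul_sq_le (a b : ℕ → ℝ≥0∞) : (∑' n, a n * b n) ^ 2 ≤ (∑' n, a n ^ 2) * ∑' n, b n ^ 2 := by
  have := lintegral_mul_sq_le (μ := Measure.count) (f := a) (g := b)
    (measurable_of_countable a).aemeasurable (measurable_of_countable b).aemeasurable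
  simpa only [lintegral_count] using this

/-- The `s`-norm of `e^f - 1` is controlled by that of `f`. -/
theorem IsSymbol.exp {s : ℝ} (hs : 1 ≤ s) (M : ℝ≥0) : ∃ N : ℝ≥0, ∀ F : ℝ → ℂ, IsSymbol s M F →
    ∃ V, IsSymbol s N V ∧ ∀ x, 𝓕⁻ V x = Complex.exp (𝓕⁻ F x) - 1 := by
  set C : ℝ≥0 := Real.toNNReal (4 ^ s) * 2 with hC
  -- `K` dominates `M`, `C * M` and `1`. By the first two, induction with the product constant `C`
  -- bounds the symbol of the power `n + 1` by `K ^ (n + 1)`.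
  set K : ℝ≥0 := C * M + M + 1 with hK
  have hK1 : 1 ≤ K := by rw [hK]; exact le_add_self
  have hMK : M ≤ K := by rw [hK, add_assoc]; exact le_add_of_nonneg_of_le zero_le le_self_add
  have hCK : C * M ≤ K := by rw [hK, add_assoc]; exact le_self_add
  have hsum : Summable fun n : ℕ => ((4 * K ^ 2 : ℝ≥0) : ℝ) ^ (n + 1) / (n + 1).factorial :=
    (summable_nat_add_iff 1).2 (Real.summable_pow_div_factorial _)
  have hsumN : Summable fun n : ℕ => (4 * K ^ 2) ^ (n + 1) / ((n + 1).factorial : ℝ≥0) := by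
    rw [← NNReal.summable_coe]; simpa using hsum
  refine ⟨2 * ∑' n : ℕ, (4 * K ^ 2) ^ (n + 1) / ((n + 1).factorial : ℝ≥0), fun F hF => ?_⟩
  -- The bound is weakened to a perfect square, using `1 ≤ K`, because `integral_norm_le` takes the
  -- square root of a squared norm.
  have hpow : ∀ n : ℕ, ∃ G, IsSymbol s ((K ^ (n + 1)) ^ 2) G ∧ ∀ x, 𝓕⁻ G x = 𝓕⁻ F x ^ (n + 1) := by
    have h0 : ∀ n : ℕ, ∃ G, IsSymbol s (K ^ (n + 1)) G ∧ ∀ x, 𝓕⁻ G x = 𝓕⁻ F x ^ (n + 1) := by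
      intro n
      induction n with
      | zero => exact ⟨F, hF.mono le_rfl (by simpa using hMK), fun x => by simp⟩
      | succ n ih =>
        obtain ⟨G, hG, hGx⟩ := ih
        obtain ⟨H, hH, hHx⟩ := hF.conv hs hG
        refine ⟨H, hH.mono le_rfl ?_, fun x => by rw [hHx, hGx]; ring⟩
        rw [pow_succ' K (n + 1)]
        exact mul_le_mul_left hCK _
    intro n
    obtain ⟨G, hG, hGx⟩ := h0 n
    refine ⟨G, hG.mono le_rfl ?_, hGx⟩
    rw [← pow_mul]
    exact pow_le_pow_right₀ hK1 (by omega)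
  choose G hG hGx using hpow
  set A : ℕ → ℝ → ℂ := fun n η => ((n + 1).factorial : ℂ)⁻¹ * G n η with hA
  have hAint : ∀ n, Integrable (A n) := fun n => ((hG n).integrable hs).const_mul _
  have hAnorm : ∀ n, ∫ η, ‖A n η‖ ≤ (K : ℝ) ^ (n + 1) / (n + 1).factorial := fun n => by
    simp only [hA, norm_mul, norm_inv, Complex.norm_natCast]
    rw [integral_const_mul, inv_mul_eq_div]
    gcongr
    exact_mod_cast (hG n).integral_norm_le hs le_rfl
  have hsum1 : Summable fun n => ∫ η, ‖A n η‖ := by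
    refine Summable.of_nonneg_of_le (fun n => integral_nonneg fun η => norm_nonneg _) hAnorm ?_
    exact (summable_nat_add_iff 1).2 (Real.summable_pow_div_factorial _)
  have hAm : ∀ n, Measurable (A n) := fun n => (hG n).1.const_mul _
  refine ⟨fun η => ∑' n, A n η, ⟨?_, ?_⟩, fun x => ?_⟩
  · exact Measurable.tsum hAm
  -- Cauchy–Schwarz with the weights `2^{-n}` and `2^n` replaces the square of the exponential
  -- series by a series of squares. The price `4^n` is absorbed by the factorials, which explains
  -- the powers of `4 * K ^ 2` in the final constant.
  · have hb : ∀ η, sobW s η * ‖∑' n, A n η‖ₑ ^ 2 ≤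
        2 * ∑' n, (4 ^ n * (sobW s η * ‖A n η‖ₑ ^ 2)) := fun η => by
      have h1 : ‖∑' n, A n η‖ₑ ≤ ∑' n, (2⁻¹ : ℝ≥0∞) ^ n * (2 ^ n * ‖A n η‖ₑ) := by
        refine enorm_tsum_le_tsum_enorm.trans (le_of_eq ?_)
        congr 1; ext n
        rw [← mul_assoc, ← mul_pow, ENNReal.inv_mul_cancel (by simp) (by simp), one_pow, one_mul]
      have h2 : ∑' n, ((2⁻¹ : ℝ≥0∞) ^ n) ^ 2 ≤ 2 := by
        calc ∑' n, ((2⁻¹ : ℝ≥0∞) ^ n) ^ 2 ≤ ∑' n, (2⁻¹ : ℝ≥0∞) ^ n := by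
              refine ENNReal.tsum_le_tsum fun n => ?_
              rw [sq]
              exact mul_le_of_le_one_left zero_le (pow_le_one₀ zero_le (by simp))
          _ = 2 := by rw [ENNReal.tsum_geometric, ENNReal.one_sub_inv_two, inv_inv]
      calc _ ≤ sobW s η * (2 * ∑' n, (2 ^ n * ‖A n η‖ₑ) ^ 2) := by
            gcongr
            exact (pow_le_pow_left' h1 2).trans ((tsum_mul_sq_le _ _).trans (by gcongr))
        _ = 2 * ∑' n, (sobW s η * (2 ^ n * ‖A n η‖ₑ) ^ 2) := by
            rw [ENNReal.tsum_mul_left]; ring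
        _ = _ := by
            congr 2; ext n
            rw [mul_pow, ← pow_mul, mul_comm n 2, pow_mul]; norm_num; ring
    refine (lintegral_mono hb).trans ?_
    rw [lintegral_const_mul' _ _ (by simp), lintegral_tsum (f := fun n η => 4 ^ n * (sobW s η * ‖A n η‖ₑ ^ 2))
      fun n => (((measurable_sobW s).mul ((hAm n).enorm.pow_const 2)).const_mul _).aemeasurable,
      ENNReal.coe_mul, ENNReal.coe_tsum hsumN]
    gcongr with n
    · simp
    · rw [lintegral_const_mul' _ _ (by simp)]
      have h1 : symSq s (A n) ≤ _ := ((hG n).const_mul ((n + 1).factorial : ℂ)⁻¹).2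
      calc _ ≤ (4 : ℝ≥0∞) ^ n * _ := mul_le_mul_right h1 _
        _ ≤ _ := by
          have e : (4 * K ^ 2) ^ (n + 1) / ((n + 1).factorial : ℝ≥0) =
              4 ^ (n + 1) * ((((n + 1).factorial : ℝ≥0))⁻¹ * (K ^ (n + 1)) ^ 2) := by
            rw [div_eq_mul_inv, mul_pow, ← pow_mul, ← pow_mul, mul_comm (n + 1) 2]; ring
          have h1 : (1 : ℝ≥0) ≤ ((n + 1).factorial : ℝ≥0) := by
            exact_mod_cast Nat.factorial_pos (n + 1)
          have h2 : (4 : ℝ≥0) ^ n * (‖((n + 1).factorial : ℂ)⁻¹‖₊ ^ 2 * (K ^ (n + 1)) ^ 2) ≤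
              (4 * K ^ 2) ^ (n + 1) / ((n + 1).factorial : ℝ≥0) := by
            rw [e, nnnorm_inv, Complex.nnnorm_natCast]
            exact mul_le_mul' (pow_le_pow_right₀ (by norm_num) (by omega)) (mul_le_mul'
              (pow_le_of_le_one zero_le (inv_le_one_of_one_le₀ h1) two_ne_zero) le_rfl)
          exact_mod_cast ENNReal.coe_le_coe.2 h2
  · have h := hasSum_integral_of_summable_integral_norm
      (F := fun n (η : ℝ) => Complex.exp (2 * π * Complex.I * η * x) * A n η)
      (fun n => integrable_exp_mul (hAint n) x) (by simpa [norm_exp_two_pi] using hsum1)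
    have h2 : ∀ n, ∫ η : ℝ, Complex.exp (2 * π * Complex.I * η * x) * A n η =
        𝓕⁻ F x ^ (n + 1) / (n + 1).factorial := fun n => by
      rw [← hGx, fourierInv_eq_integral, ← integral_div]
      congr 1; ext η
      simp only [hA]; ring
    simp only [h2] at h
    have h3 := NormedSpace.expSeries_div_hasSum_exp (𝔸 := ℂ) (𝓕⁻ F x)
    rw [← hasSum_nat_add_iff' 1, ← Complex.exp_eq_exp_ℂ] at h3
    have h4 := h.unique h3
    simp only [tsum_mul_left] at h4
    rw [fourierInv_eq_integral, h4]
    simp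

/-! ### Families of functions bounded in `H^s`. -/

theorem fourierInv_const_mul (c : ℂ) (F : ℝ → ℂ) (x : ℝ) :
    𝓕⁻ (fun η => c * F η) x = c * 𝓕⁻ F x := by
  rw [fourierInv_eq_integral, fourierInv_eq_integral, ← integral_const_mul]
  congr 1; ext η; ring

theorem fourierInv_add {F G : ℝ → ℂ} (hF : Integrable F) (hG : Integrable G) (x : ℝ) :
    𝓕⁻ (fun η => F η + G η) x = 𝓕⁻ F x + 𝓕⁻ G x := by
  rw [fourierInv_eq_integral, fourierInv_eq_integral, fourierInv_eq_integral,
    ← integral_add (integrable_exp_mul hF x) (integrable_exp_mul hG x)]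
  congr 1; ext η; ring

theorem fourierInv_conj (F : ℝ → ℂ) (x : ℝ) :
    𝓕⁻ (fun η => (starRingEnd ℂ) (F (-η))) x = (starRingEnd ℂ) (𝓕⁻ F x) := by
  rw [fourierInv_eq_integral, fourierInv_eq_integral, ← integral_conj, ← integral_neg_eq_self]
  congr 1; ext η
  rw [map_mul, ← Complex.exp_conj, neg_neg]
  congr 2
  simp [Complex.conj_ofNat]

theorem fourierInv_congr {F G : ℝ → ℂ} (h : F =ᵐ[volume] G) (x : ℝ) : 𝓕⁻ F x = 𝓕⁻ G x :=
  Real.fourierInv_congr_ae h x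

/-- A family of functions on `ℝ` which is bounded in `H^s`, given by integrable symbols. -/
def UnifSob {ι : Type*} (s : ℝ) (f : ι → ℝ → ℂ) : Prop :=
  ∃ M : ℝ≥0, ∀ i, ∃ F, IsSymbol s M F ∧ f i = 𝓕⁻ F

/-- A single function of class `H^s`. -/
abbrev Sob (s : ℝ) (f : ℝ → ℂ) : Prop := UnifSob s fun _ : Unit => f

namespace UnifSob

variable {ι : Type*} {s : ℝ} {f g : ι → ℝ → ℂ}

theorem apply (h : UnifSob s f) (i : ι) : Sob s (f i) := by
  obtain ⟨M, hM⟩ := h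
  exact ⟨M, fun _ => hM i⟩

theorem mono {t : ℝ} (h : UnifSob s f) (hst : t ≤ s) : UnifSob t f := by
  obtain ⟨M, hM⟩ := h
  refine ⟨M, fun i => ?_⟩
  obtain ⟨F, hF, e⟩ := hM i
  exact ⟨F, hF.mono hst le_rfl, e⟩

theorem const_mul (h : UnifSob s f) (c : ℂ) : UnifSob s fun i x => c * f i x := by
  obtain ⟨M, hM⟩ := h
  refine ⟨‖c‖₊ ^ 2 * M, fun i => ?_⟩
  obtain ⟨F, hF, e⟩ := hM i
  refine ⟨_, hF.const_mul c, ?_⟩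
  ext x
  beta_reduce
  rw [e, fourierInv_const_mul]

theorem neg (h : UnifSob s f) : UnifSob s fun i x => -f i x := by
  simpa using h.const_mul (-1)

theorem add (hs : 1 ≤ s) (hf : UnifSob s f) (hg : UnifSob s g) :
    UnifSob s fun i x => f i x + g i x := by
  obtain ⟨M, hM⟩ := hf
  obtain ⟨N, hN⟩ := hg
  refine ⟨2 * M + 2 * N, fun i => ?_⟩
  obtain ⟨F, hF, e⟩ := hM i
  obtain ⟨G, hG, e'⟩ := hN i
  refine ⟨_, hF.add hG, ?_⟩
  ext x
  beta_reduce
  rw [e, e', fourierInv_add (hF.integrable hs) (hG.integrable hs)]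

theorem sub (hs : 1 ≤ s) (hf : UnifSob s f) (hg : UnifSob s g) :
    UnifSob s fun i x => f i x - g i x := by
  simpa [sub_eq_add_neg] using hf.add hs hg.neg

theorem mul (hs : 1 ≤ s) (hf : UnifSob s f) (hg : UnifSob s g) :
    UnifSob s fun i x => f i x * g i x := by
  obtain ⟨M, hM⟩ := hf
  obtain ⟨N, hN⟩ := hg
  refine ⟨Real.toNNReal (4 ^ s) * 2 * M * N, fun i => ?_⟩
  obtain ⟨F, hF, e⟩ := hM i
  obtain ⟨G, hG, e'⟩ := hN i
  obtain ⟨H, hH, hx⟩ := hF.conv hs hG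
  exact ⟨H, hH, by ext x; beta_reduce; rw [e, e', hx]⟩

theorem exp (hs : 1 ≤ s) (hf : UnifSob s f) : UnifSob s fun i x => Complex.exp (f i x) - 1 := by
  obtain ⟨M, hM⟩ := hf
  obtain ⟨N, hN⟩ := IsSymbol.exp hs M
  refine ⟨N, fun i => ?_⟩
  obtain ⟨F, hF, e⟩ := hM i
  obtain ⟨V, hV, hx⟩ := hN F hF
  exact ⟨V, hV, by ext x; beta_reduce; rw [e, hx]⟩

theorem conj (hf : UnifSob s f) : UnifSob s fun i x => (starRingEnd ℂ) (f i x) := by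
  obtain ⟨M, hM⟩ := hf
  refine ⟨M, fun i => ?_⟩
  obtain ⟨F, hF, e⟩ := hM i
  refine ⟨fun η => (starRingEnd ℂ) (F (-η)), ⟨?_, ?_⟩, ?_⟩
  · exact Complex.continuous_conj.measurable.comp (hF.1.comp measurable_neg)
  · refine le_trans (le_of_eq ?_) hF.2
    unfold symSq
    rw [← lintegral_neg_eq_self (fun η => sobW s η * ‖F η‖ₑ ^ 2)]
    refine lintegral_congr fun η => ?_
    have e1 : ‖(starRingEnd ℂ) (F (-η))‖ₑ = ‖F (-η)‖ₑ := by
      rw [enorm_eq_iff_norm_eq, RCLike.norm_conj]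
    have e2 : sobW s (-η) = sobW s η := by simp [sobW]
    rw [e1, e2]
  · ext x
    beta_reduce
    rw [e, fourierInv_conj]

theorem re (hs : 1 ≤ s) (hf : UnifSob s f) : UnifSob s fun i x => ((f i x).re : ℂ) := by
  have := (hf.add hs hf.conj).const_mul (1 / 2)
  convert this using 3 with i x
  rw [Complex.add_conj]; push_cast; ring

theorem im (hs : 1 ≤ s) (hf : UnifSob s f) : UnifSob s fun i x => ((f i x).im : ℂ) := by
  have := (hf.sub hs hf.conj).const_mul (1 / (2 * Complex.I))
  convert this using 3 with i x
  rw [Complex.sub_conj]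
  have := Complex.I_ne_zero
  field_simp
  push_cast; ring

theorem continuous (hs : 1 ≤ s) (hf : UnifSob s f) (i : ι) : Continuous (f i) := by
  obtain ⟨M, hM⟩ := hf
  obtain ⟨F, hF, e⟩ := hM i
  rw [e]; exact continuous_fourierInv (hF.integrable hs)

theorem bounded (hs : 1 ≤ s) (hf : UnifSob s f) : ∃ C : ℝ, ∀ i x, ‖f i x‖ ≤ C := by
  obtain ⟨M, hM⟩ := hf
  refine ⟨(M + 1 : ℝ≥0), fun i x => ?_⟩
  obtain ⟨F, hF, e⟩ := hM i
  rw [e]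
  refine (norm_fourierInv_le F x).trans (hF.integral_norm_le hs ?_)
  rw [← NNReal.coe_le_coe]; push_cast
  nlinarith [M.coe_nonneg]

theorem memLp (hs : 1 ≤ s) (hf : UnifSob s f) (i : ι) : MemLp (f i) 2 := by
  obtain ⟨M, hM⟩ := hf
  obtain ⟨F, hF, e⟩ := hM i
  rw [e]; exact memLp_fourierInv (hF.integrable hs) (hF.memLp (by linarith))

theorem zero_at_infty (hf : UnifSob s f) (i : ι) : Tendsto (f i) (cocompact ℝ) (𝓝 0) := by
  obtain ⟨M, hM⟩ := hf
  obtain ⟨F, hF, e⟩ := hM i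
  have : f i = fun x => 𝓕 F (-x) := by
    ext x; rw [e, Real.fourierInv_eq_fourier_neg]
  rw [this]
  exact (Real.zero_at_infty_fourier F).comp (Homeomorph.neg ℝ).isClosedEmbedding.tendsto_cocompact

theorem sobolevNorm_le (hs : 1 ≤ s) (hf : UnifSob s f) :
    ∃ C : ℝ≥0, ∀ i, sobolevNorm s (f i) ≤ C := by
  obtain ⟨M, hM⟩ := hf
  refine ⟨M + 1, fun i => ?_⟩
  obtain ⟨F, hF, e⟩ := hM i
  have h1 : sobolevNorm s (f i) ^ 2 ≤ M := by
    rw [sobolevNorm_sq, e, symSq_congr (fourierL2_fourierInv (hF.integrable hs)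
      (hF.memLp (by linarith)))]
    exact hF.2
  refine (ENNReal.pow_le_pow_left_iff two_ne_zero).1 (h1.trans ?_)
  norm_cast
  rw [← NNReal.coe_le_coe]; push_cast
  nlinarith [M.coe_nonneg]

end UnifSob

/-- The `L²` transform is only a class modulo null sets, so a measurable representative is chosen as
symbol. Continuity of `f` upgrades the inversion formula from almost every point to every point. -/
theorem exists_isSymbol_of_ae {s : ℝ} {f : ℝ → ℂ} (hs : 1 ≤ s) (hc : Continuous f)
    (h2 : MemLp f 2) {N : ℝ≥0} (hN : symSq s (fourierL2 f) ≤ N) : ∃ F, IsSymbol s N F ∧ f = 𝓕⁻ F := by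
  have hm : AEStronglyMeasurable (fourierL2 f) volume := (memLp_fourierL2 f).1
  have hF : IsSymbol s N (hm.mk _) := ⟨hm.stronglyMeasurable_mk.measurable, by
    rwa [symSq_congr hm.ae_eq_mk.symm]⟩
  refine ⟨_, hF, ?_⟩
  have e := fourierInv_fourierL2 hc h2 ((hF.integrable hs).congr hm.ae_eq_mk.symm)
  refine e.symm.trans ?_
  ext x
  rw [fourierInv_eq_integral, fourierInv_eq_integral]
  refine integral_congr_ae ?_
  filter_upwards [hm.ae_eq_mk] with η hη
  rw [hη]

theorem unifSob_of_sobolevNorm_le {ι : Type*} {s : ℝ} {f : ι → ℝ → ℂ} (hs : 1 ≤ s)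
    (hc : ∀ i, Continuous (f i)) (h2 : ∀ i, MemLp (f i) 2) {C : ℝ≥0}
    (hC : ∀ i, sobolevNorm s (f i) ≤ C) : UnifSob s f := by
  refine ⟨C ^ 2, fun i => exists_isSymbol_of_ae hs (hc i) (h2 i) ?_⟩
  rw [← sobolevNorm_sq]
  push_cast
  exact pow_le_pow_left' (hC i) 2

theorem inLinftyHs_iff {s T : ℝ} {f : ℝ → ℝ → ℂ} (hs : 1 ≤ s)
    (hc : ∀ t ∈ Icc 0 T, Continuous (f t)) :
    InLinftyHs s T f ↔ UnifSob s fun t : Icc (0 : ℝ) T => f t := by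
  constructor
  · rintro ⟨h2, C, hC⟩
    exact unifSob_of_sobolevNorm_le hs (fun t => hc t t.2) (fun t => h2 t t.2) fun t => hC t t.2
  · intro h
    obtain ⟨C, hC⟩ := h.sobolevNorm_le hs
    exact ⟨fun t ht => h.memLp hs ⟨t, ht⟩, C, fun t ht => hC ⟨t, ht⟩⟩

theorem two_pi_mul_sq_le_sobW (η : ℝ) : ‖(2 * π * Complex.I * η : ℂ)‖ₑ ^ 2 ≤ sobW 1 η := by
  rw [sobW_one]
  refine le_trans (le_of_eq ?_) le_add_self
  congr 1
  rw [enorm_eq_iff_norm_eq]; simp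

theorem IsSymbol.deriv {s : ℝ} {M : ℝ≥0} {F : ℝ → ℂ} (h : IsSymbol s M F) :
    IsSymbol (s - 1) M fun η => 2 * π * Complex.I * η * F η := by
  have := h.of_le (t := s - 1) (K := 1) (G := fun η => 2 * π * Complex.I * η * F η)
    ((Measurable.const_mul (Complex.measurable_ofReal) _).mul h.1) fun η => by
      rw [ENNReal.coe_one, one_mul, enorm_mul, mul_pow, ← mul_assoc]
      gcongr
      calc _ ≤ sobW (s - 1) η * sobW 1 η := by gcongr; exact two_pi_mul_sq_le_sobW η
        _ = sobW s η := by rw [← sobW_add, sub_add_cancel]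
  rwa [one_mul] at this

/-- For `2 ≤ s` the symbol `2πiη F` has weight order at least one and is integrable, so the
derivative passes under the integral and is classical at every point. -/
theorem IsSymbol.hasDerivAt {s : ℝ} {M : ℝ≥0} {F : ℝ → ℂ} (hs : 2 ≤ s) (h : IsSymbol s M F) (x : ℝ) :
    HasDerivAt (𝓕⁻ F) (𝓕⁻ (fun η : ℝ => 2 * π * Complex.I * η * F η) x) x := by
  have h1 : Integrable F := h.integrable (by linarith)
  have h2 := h.deriv.integrable (by linarith)
  have hd := hasDerivAt_integral_of_dominated_loc_of_deriv_le (μ := volume) (s := univ)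
    (F := fun (x η : ℝ) => Complex.exp (2 * π * Complex.I * η * x) * F η)
    (F' := fun (x η : ℝ) => Complex.exp (2 * π * Complex.I * η * x) *
      (2 * π * Complex.I * η * F η)) (x₀ := x)
    (bound := fun η => ‖2 * π * Complex.I * η * F η‖) univ_mem
    (Eventually.of_forall fun x => (integrable_exp_mul h1 x).1) (integrable_exp_mul h1 x)
    (integrable_exp_mul h2 x).1
    (Eventually.of_forall fun η x _ => by rw [norm_mul, norm_exp_two_pi, one_mul]) h2.norm
    (Eventually.of_forall fun η x _ => by
      have h3 : HasDerivAt (fun x : ℝ => 2 * π * Complex.I * η * (x : ℂ)) (2 * π * Complex.I * η) x := by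
        simpa using (Complex.ofRealCLM.hasDerivAt (x := x)).const_mul (2 * π * Complex.I * η)
      refine (h3.cexp.mul_const (F η)).congr_deriv ?_
      ring)
  have e : 𝓕⁻ F = fun x : ℝ => ∫ η : ℝ, Complex.exp (2 * π * Complex.I * η * x) * F η :=
    funext fun x => fourierInv_eq_integral F x
  rw [e, fourierInv_eq_integral]
  exact hd.2

theorem measurable_sign_coe : Measurable fun η : ℝ => (SignType.sign η : ℂ) := by
  have : (fun η : ℝ => (SignType.sign η : ℂ)) = fun η =>
      if 0 < η then 1 else if η < 0 then -1 else 0 := by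
    ext η
    rcases lt_trichotomy η 0 with h | rfl | h
    · simp [sign_neg h, h, h.le]
    · simp
    · simp [sign_pos h, h]
  rw [this]
  exact Measurable.ite measurableSet_Ioi measurable_const
    (Measurable.ite measurableSet_Iio measurable_const measurable_const)

namespace UnifSob

variable {ι : Type*} {s : ℝ} {f f' : ι → ℝ → ℂ}

theorem hasDerivAt (hs : 2 ≤ s) (hf : UnifSob s f) (i : ι) (x : ℝ) :
    HasDerivAt (f i) (deriv (f i) x) x := by
  obtain ⟨M, hM⟩ := hf
  obtain ⟨F, hF, e⟩ := hM i
  rw [e]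
  exact (hF.hasDerivAt hs x).differentiableAt.hasDerivAt

theorem deriv (hs : 2 ≤ s) (hf : UnifSob s f) : UnifSob (s - 1) fun i => deriv (f i) := by
  obtain ⟨M, hM⟩ := hf
  refine ⟨M, fun i => ?_⟩
  obtain ⟨F, hF, e⟩ := hM i
  refine ⟨_, hF.deriv, ?_⟩
  ext x
  beta_reduce
  rw [e, (hF.hasDerivAt hs x).deriv]

/-- An `L²`-bounded family whose derivatives are bounded in `H^{s-1}` is bounded in `H^s`. -/
theorem of_hasDerivAt (hs : 2 ≤ s) (hd : ∀ i x, HasDerivAt (f i) (f' i x) x)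
    (hf' : UnifSob (s - 1) f') (h2 : ∀ i, MemLp (f i) 2) {C : ℝ≥0}
    (hC : ∀ i, eLpNorm (f i) 2 volume ≤ C) : UnifSob s f := by
  obtain ⟨M, hM⟩ := hf'
  refine ⟨Real.toNNReal (2 ^ s) * C ^ 2 + 2 * M, fun i => ?_⟩
  obtain ⟨G, hG, e⟩ := hM i
  have hG2 := hG.memLp (by linarith)
  have hG1 := hG.integrable (by linarith)
  have h2' : MemLp (f' i) 2 := by rw [e]; exact memLp_fourierInv hG1 hG2
  have hae : G =ᵐ[volume] fun η : ℝ => 2 * π * Complex.I * η * fourierL2 (f i) η := by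
    refine EventuallyEq.trans ?_ (fourierL2_deriv (hd i) (h2 i) h2')
    rw [e]; exact (fourierL2_fourierInv hG1 hG2).symm
  refine exists_isSymbol_of_ae (by linarith)
    (continuous_iff_continuousAt.2 fun x => (hd i x).continuousAt) (h2 i) ?_
  -- Low and high frequencies are separated at `|ξ| = 1`: below, the weight is at most `2^s` and the
  -- `L²` norm suffices; above, `1 + ξ² ≤ 2 ξ²` turns one order of the weight into the derivative.
  have hle : ∀ᵐ η, sobW s η * ‖fourierL2 (f i) η‖ₑ ^ 2 ≤
      ENNReal.ofReal (2 ^ s) * ‖fourierL2 (f i) η‖ₑ ^ 2 + 2 * (sobW (s - 1) η * ‖G η‖ₑ ^ 2) := by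
    filter_upwards [hae] with η hη
    rw [hη, enorm_mul, mul_pow]
    rcases le_total ((2 * π * η) ^ 2) 1 with h | h
    · refine le_trans ?_ le_self_add
      gcongr
      exact ENNReal.ofReal_le_ofReal (Real.rpow_le_rpow (by positivity) (by linarith) (by linarith))
    · refine le_trans ?_ le_add_self
      have h1 : sobW 1 η ≤ 2 * ‖(2 * π * Complex.I * η : ℂ)‖ₑ ^ 2 := by
        have e3 : ‖(2 * π * Complex.I * η : ℂ)‖ₑ = ‖(2 * π * η : ℝ)‖ₑ := by
          rw [enorm_eq_iff_norm_eq]; simp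
        have h3 : (1 : ℝ≥0∞) ≤ ‖(2 * π * η : ℝ)‖ₑ ^ 2 := by
          rw [← ofReal_norm, ← ENNReal.ofReal_pow (norm_nonneg _), ENNReal.one_le_ofReal,
            Real.norm_eq_abs, sq_abs]
          exact h
        rw [sobW_one, e3]
        exact (add_le_add h3 le_rfl).trans (two_mul _).symm.le
      calc _ = sobW (s - 1) η * sobW 1 η * ‖fourierL2 (f i) η‖ₑ ^ 2 := by
            rw [← sobW_add, sub_add_cancel]
        _ ≤ sobW (s - 1) η * (2 * ‖(2 * π * Complex.I * η : ℂ)‖ₑ ^ 2) * ‖fourierL2 (f i) η‖ₑ ^ 2 := by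
            gcongr
        _ = _ := by ring
  refine (lintegral_mono_ae hle).trans ?_
  rw [lintegral_add_right (g := fun η => 2 * (sobW (s - 1) η * ‖G η‖ₑ ^ 2)) _
    (((measurable_sobW _).mul (hG.1.enorm.pow_const 2)).const_mul 2),
    lintegral_const_mul' _ _ ENNReal.ofReal_ne_top, lintegral_const_mul' _ _ (by simp),
    ← eLpNorm_two_sq, eLpNorm_fourierL2 (h2 i)]
  push_cast
  exact add_le_add (mul_le_mul' le_rfl (pow_le_pow_left' (hC i) 2)) (mul_le_mul' le_rfl hG.2)

theorem hilbert_eq (hs : 1 ≤ s) (hf : UnifSob s f) :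
    ∃ M : ℝ≥0, ∀ i, ∃ F, IsSymbol s M F ∧ IsSymbol s M (fun η => -(SignType.sign η : ℂ) * F η) ∧
      f i = 𝓕⁻ F ∧ Muskat.hilbert (f i) = 𝓕⁻ (fun η : ℝ => -(SignType.sign η : ℂ) * F η) := by
  obtain ⟨M, hM⟩ := hf
  refine ⟨M, fun i => ?_⟩
  obtain ⟨F, hF, e⟩ := hM i
  refine ⟨F, hF, hF.of_norm_le ?_ fun η => ?_, e, ?_⟩
  · exact measurable_sign_coe.neg.mul hF.1
  · rcases lt_trichotomy η 0 with h | h | h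
    · simp [sign_neg h]
    · simp [h]
    · simp [sign_pos h]
  · rw [e, hilbert_fourierInv (hF.integrable hs)]

theorem hilbert (hs : 1 ≤ s) (hf : UnifSob s f) : UnifSob s fun i => Muskat.hilbert (f i) := by
  obtain ⟨M, hM⟩ := hf.hilbert_eq hs
  refine ⟨M, fun i => ?_⟩
  obtain ⟨F, -, hF, -, e⟩ := hM i
  exact ⟨_, hF, e⟩

end UnifSob

/-! ### Algebraic rules for the Hilbert transform. -/

section HilbertAlgebra

variable {f g : ℝ → ℂ}

theorem Sob.exists_symbol {s : ℝ} (hf : Sob s f) : ∃ M F, IsSymbol s M F ∧ f = 𝓕⁻ F := by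
  obtain ⟨M, hM⟩ := hf
  obtain ⟨F, hF, e⟩ := hM ()
  exact ⟨M, F, hF, e⟩

theorem Sob.continuous (hf : Sob 1 f) : Continuous f := UnifSob.continuous le_rfl hf ()

theorem Sob.hasDerivAt (hf : Sob 2 f) (x : ℝ) : HasDerivAt f (deriv f x) x :=
  UnifSob.hasDerivAt le_rfl hf () x

theorem hilbert_const_mul (hf : Sob 1 f) (c : ℂ) :
    hilbert (fun x => c * f x) = fun x => c * hilbert f x := by
  obtain ⟨M, F, hF, rfl⟩ := hf.exists_symbol
  have hi := hF.integrable le_rfl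
  have e : (fun x => c * 𝓕⁻ F x) = 𝓕⁻ (fun η => c * F η) := by
    ext x; rw [fourierInv_const_mul]
  rw [e, hilbert_fourierInv (hi.const_mul c), hilbert_fourierInv hi]
  ext x
  rw [← fourierInv_const_mul]
  exact fourierInv_congr (Eventually.of_forall fun η => by ring) x

theorem hilbert_neg (hf : Sob 1 f) : hilbert (fun x => -f x) = fun x => -hilbert f x := by
  simpa using hilbert_const_mul hf (-1)

theorem hilbert_add (hf : Sob 1 f) (hg : Sob 1 g) :
    hilbert (fun x => f x + g x) = fun x => hilbert f x + hilbert g x := by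
  obtain ⟨M, F, hF, rfl⟩ := hf.exists_symbol
  obtain ⟨N, G, hG, rfl⟩ := hg.exists_symbol
  have hF1 := hF.integrable le_rfl
  have hG1 := hG.integrable le_rfl
  have e : (fun x => 𝓕⁻ F x + 𝓕⁻ G x) = 𝓕⁻ (fun η => F η + G η) := by
    ext x; rw [fourierInv_add hF1 hG1]
  have hb : ∀ {F : ℝ → ℂ}, Integrable F → Integrable fun η : ℝ => -(SignType.sign η : ℂ) * F η :=
    fun hF => hF.bdd_mul (c := 1) measurable_sign_coe.neg.aestronglyMeasurable
      (Eventually.of_forall fun η => by cases SignType.sign η <;> simp)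
  rw [e, hilbert_fourierInv (F := fun η => F η + G η) (hF1.add hG1), hilbert_fourierInv hF1, hilbert_fourierInv hG1]
  ext x
  rw [← fourierInv_add (hb hF1) (hb hG1)]
  exact fourierInv_congr (Eventually.of_forall fun η => by ring) x

theorem hilbert_sub (hf : Sob 1 f) (hg : Sob 1 g) :
    hilbert (fun x => f x - g x) = fun x => hilbert f x - hilbert g x := by
  simp only [sub_eq_add_neg]
  rw [hilbert_add hf hg.neg, hilbert_neg hg]

/-- Conjugation reflects the frequency, and the multiplier is real and odd; hence the sign. -/
theorem hilbert_conj (hf : Sob 1 f) :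
    hilbert (fun x => (starRingEnd ℂ) (f x)) = fun x => -(starRingEnd ℂ) (hilbert f x) := by
  obtain ⟨M, F, hF, rfl⟩ := hf.exists_symbol
  have hi := hF.integrable le_rfl
  have e : (fun x => (starRingEnd ℂ) (𝓕⁻ F x)) = 𝓕⁻ (fun η => (starRingEnd ℂ) (F (-η))) := by
    ext x; rw [fourierInv_conj]
  have hc : Integrable fun η => (starRingEnd ℂ) (F (-η)) := by
    refine ⟨Complex.continuous_conj.comp_aestronglyMeasurable hi.comp_neg.1, ?_⟩
    exact hi.comp_neg.2.congr' (Eventually.of_forall fun η => (RCLike.norm_conj _).symm)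
  rw [e, hilbert_fourierInv hc, hilbert_fourierInv hi]
  ext x
  rw [← fourierInv_conj, ← neg_one_mul, ← fourierInv_const_mul]
  refine fourierInv_congr (Eventually.of_forall fun η => ?_) x
  rw [map_mul, Left.sign_neg]
  cases SignType.sign η <;> simp

/-- The multiplier squares to one except at frequency zero, a null set. -/
theorem hilbert_hilbert (hf : Sob 1 f) : hilbert (hilbert f) = f := by
  obtain ⟨M, hM⟩ := UnifSob.hilbert_eq le_rfl hf
  obtain ⟨F, hF, hF', e, e'⟩ := hM ()
  rw [e', hilbert_fourierInv (hF'.integrable le_rfl)]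
  refine Eq.trans ?_ e.symm
  ext x
  refine fourierInv_congr ?_ x
  filter_upwards [compl_mem_ae_iff.2 (measure_singleton (0 : ℝ))] with η hη
  rcases lt_or_gt_of_ne hη with h | h
  · simp [sign_neg h]
  · simp [sign_pos h]

theorem deriv_hilbert (hf : Sob 2 f) : deriv (hilbert f) = hilbert (deriv f) := by
  obtain ⟨M, hM⟩ := UnifSob.hilbert_eq (by norm_num) hf
  obtain ⟨F, hF, hF', e, e'⟩ := hM ()
  rw [e', e]
  have e1 : deriv (𝓕⁻ F) = 𝓕⁻ (fun η : ℝ => 2 * π * Complex.I * η * F η) := by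
    ext x; exact (hF.hasDerivAt le_rfl x).deriv
  rw [e1, hilbert_fourierInv (hF.deriv.integrable (by norm_num))]
  ext x
  rw [(hF'.hasDerivAt le_rfl x).deriv]
  exact fourierInv_congr (Eventually.of_forall fun η => by ring) x

/-- On symbols, `|ξ| = i · (iξ) · (-sgn ξ)`. -/
theorem absDeriv_eq (hf : Sob 2 f) : absDeriv f = fun x => Complex.I * deriv (hilbert f) x := by
  obtain ⟨M, hM⟩ := UnifSob.hilbert_eq (by norm_num) hf
  obtain ⟨F, hF, hF', e, e'⟩ := hM ()
  rw [e']
  ext x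
  rw [(hF'.hasDerivAt le_rfl x).deriv, ← fourierInv_const_mul, absDeriv]
  refine fourierInv_congr ?_ x
  have := fourierL2_fourierInv (hF.integrable (by norm_num)) (hF.memLp (by norm_num))
  rw [e]
  filter_upwards [this] with η hη
  rw [hη]
  rcases lt_trichotomy η 0 with h | rfl | h
  · have hs : (SignType.sign η : ℂ) = -1 := by simp [sign_neg h]
    rw [abs_of_neg h, hs]; push_cast
    linear_combination -(2 * π * η * F η * Complex.I_sq)
  · simp
  · have hs : (SignType.sign η : ℂ) = 1 := by simp [sign_pos h]
    rw [abs_of_pos h, hs]; push_cast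
    linear_combination 2 * π * η * F η * Complex.I_sq

/-- Functions with `ℍ f = f` have symbols supported on the negative half line. -/
theorem Sob.exists_symbol_of_hilbert_eq {s : ℝ} (hs : 1 ≤ s) (hf : Sob s f) (h : hilbert f = f) :
    ∃ M F, IsSymbol s M F ∧ f = 𝓕⁻ F ∧ ∀ η, 0 < η → F η = 0 := by
  obtain ⟨M, hM⟩ := UnifSob.hilbert_eq hs hf
  obtain ⟨F, hF, hF', e, e'⟩ := hM ()
  refine ⟨_, fun η => 1 / 2 * (F η + -(SignType.sign η : ℂ) * F η), (hF.add hF').const_mul _, ?_,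
    fun η hη => by simp [sign_pos hη]⟩
  ext x
  rw [fourierInv_const_mul, fourierInv_add (hF.integrable hs) (hF'.integrable hs), ← e', ← e, h]
  ring

end HilbertAlgebra

/-! ### Time derivatives under integrals and under the Hilbert transform. -/

section Time

variable {T : ℝ}

/-- Termwise differentiation on a closed interval, one-sided at its ends. The mean value inequality
applied to `φ p - φ q`, followed by the limit in `q`, compares the increments of `φ p` and `ψ`; no
continuity of the derivatives is needed. -/
theorem hasDerivWithinAt_of_uniform {P : Type*} {l : Filter P} [NeBot l] {φ φ' : P → ℝ → ℂ}
    {ψ ψ' : ℝ → ℂ} (h0 : ∀ τ ∈ Icc 0 T, Tendsto (fun p => φ p τ) l (𝓝 (ψ τ)))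
    (h1 : ∀ ε > 0, ∀ᶠ p in l, ∀ τ ∈ Icc 0 T, ‖φ' p τ - ψ' τ‖ ≤ ε)
    (hd : ∀ᶠ p in l, ∀ τ ∈ Icc 0 T, HasDerivWithinAt (φ p) (φ' p τ) (Icc 0 T) τ) {t : ℝ}
    (ht : t ∈ Icc 0 T) : HasDerivWithinAt ψ (ψ' t) (Icc 0 T) t := by
  rw [hasDerivWithinAt_iff_isLittleO, Asymptotics.isLittleO_iff]
  intro c hc
  -- The total error is `4ε`: `2ε` from comparing increments, `ε` from differentiability of `φ p` at
  -- `t`, and `ε` from `φ' p t - ψ' t`.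
  set ε := c / 4 with hε
  have hε0 : 0 < ε := by positivity
  obtain ⟨p, hp1, hpd⟩ := ((h1 ε hε0).and hd).exists
  have hdiff : ∀ τ ∈ Icc 0 T, ‖(φ p τ - ψ τ) - (φ p t - ψ t)‖ ≤ 2 * ε * ‖τ - t‖ := by
    intro τ hτ
    have hlim : Tendsto (fun q => ‖(φ p τ - φ q τ) - (φ p t - φ q t)‖) l
        (𝓝 ‖(φ p τ - ψ τ) - (φ p t - ψ t)‖) :=
      (((h0 τ hτ).const_sub _).sub ((h0 t ht).const_sub _)).norm
    refine le_of_tendsto hlim ?_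
    filter_upwards [h1 ε hε0, hd] with q hq1 hqd
    refine (convex_Icc 0 T).norm_image_sub_le_of_norm_hasDerivWithin_le
      (f := fun τ => φ p τ - φ q τ) (f' := fun τ => φ' p τ - φ' q τ)
      (fun x hx => (hpd x hx).sub (hqd x hx)) (fun x hx => ?_) ht hτ
    calc ‖φ' p x - φ' q x‖ = ‖(φ' p x - ψ' x) - (φ' q x - ψ' x)‖ := by congr 1; ring
      _ ≤ _ := (norm_sub_le _ _).trans (by linarith [hp1 x hx, hq1 x hx])
  have hlo := (hasDerivWithinAt_iff_isLittleO.1 (hpd t ht))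
  rw [Asymptotics.isLittleO_iff] at hlo
  filter_upwards [hlo hε0, self_mem_nhdsWithin] with τ hτ hτm
  have e : ψ τ - ψ t - (τ - t) • ψ' t = (φ p τ - φ p t - (τ - t) • φ' p t) -
      ((φ p τ - ψ τ) - (φ p t - ψ t)) + (τ - t) • (φ' p t - ψ' t) := by
    simp only [smul_sub]; ring
  rw [e]
  refine (norm_add_le _ _).trans ((add_le_add_left (norm_sub_le _ _) _).trans ?_)
  rw [norm_smul]
  have a1 := hdiff τ hτm
  have a2 := mul_le_mul_of_nonneg_left (hp1 t ht) (norm_nonneg (τ - t))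
  have : c = 4 * ε := by rw [hε]; ring
  rw [this]
  linarith

/-- A uniform bound on the pointwise derivatives bounds all difference quotients by the mean value
inequality, and dominated convergence follows without continuity of `f'` in time. -/
theorem hasDerivWithinAt_integral_mul {X : Type*} [MeasurableSpace X] {μ : Measure X}
    {f f' : ℝ → X → ℂ} {k : X → ℂ} {C : ℝ} (hk : Integrable k μ)
    (hd : ∀ t ∈ Icc 0 T, ∀ x, HasDerivWithinAt (fun τ => f τ x) (f' t x) (Icc 0 T) t)
    (hb : ∀ t ∈ Icc 0 T, ∀ x, ‖f' t x‖ ≤ C)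
    (hm : ∀ t ∈ Icc 0 T, Integrable (fun x => k x * f t x) μ) {t : ℝ} (ht : t ∈ Icc 0 T) :
    HasDerivWithinAt (fun τ => ∫ x, k x * f τ x ∂μ) (∫ x, k x * f' t x ∂μ) (Icc 0 T) t := by
  rw [hasDerivWithinAt_iff_tendsto_slope]
  have hlim : Tendsto (fun τ => ∫ x, (τ - t)⁻¹ • (k x * f τ x - k x * f t x) ∂μ)
      (𝓝[Icc 0 T \ {t}] t) (𝓝 (∫ x, k x * f' t x ∂μ)) := by
    refine tendsto_integral_filter_of_dominated_convergence (fun x => ‖k x‖ * C) ?_ ?_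
      (hk.norm.mul_const C) ?_
    · filter_upwards [self_mem_nhdsWithin] with τ hτ
      exact (((hm τ hτ.1).sub (hm t ht)).smul (τ - t)⁻¹).1
    · filter_upwards [self_mem_nhdsWithin] with τ hτ
      refine Eventually.of_forall fun x => ?_
      rw [← mul_sub, norm_smul, norm_mul, norm_inv]
      have h1 := (convex_Icc 0 T).norm_image_sub_le_of_norm_hasDerivWithin_le
        (f := fun τ => f τ x) (f' := fun τ => f' τ x) (fun s hs => hd s hs x)
        (fun s hs => hb s hs x) ht hτ.1
      have h2 : 0 < ‖τ - t‖ := norm_pos_iff.2 (sub_ne_zero.2 hτ.2)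
      calc ‖τ - t‖⁻¹ * (‖k x‖ * ‖f τ x - f t x‖) ≤ ‖τ - t‖⁻¹ * (‖k x‖ * (C * ‖τ - t‖)) := by gcongr
        _ = ‖k x‖ * C := by field_simp
    · refine Eventually.of_forall fun x => ?_
      have h1 := (hasDerivWithinAt_iff_tendsto_slope.1 (hd t ht x)).const_mul (k x)
      refine h1.congr fun τ => ?_
      simp only [slope, vsub_eq_sub]
      rw [← mul_sub, mul_smul_comm]
  refine hlim.congr' ?_
  filter_upwards [self_mem_nhdsWithin] with τ hτ
  rw [integral_smul, integral_sub (hm τ hτ.1) (hm t ht), slope, vsub_eq_sub]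

/-- The truncated multipliers converge pointwise and stay bounded, so the weight `(1 + ξ²)⁻¹` turns
this into convergence in a weighted `L²` space, the one dual to the `H^1` bound on symbols. The
constant `5π` is `2 · 2π + π`. -/
theorem tendsto_lintegral_truncSign : Tendsto (fun p : ℝ × ℝ => ∫⁻ η, sobW (-1) η *
    ‖(2 * truncSign p.1 p.2 η - π * (SignType.sign η : ℝ) : ℝ)‖ₑ ^ 2) pvFilter (𝓝 0) := by
  have : (0 : ℝ≥0∞) = ∫⁻ η : ℝ, 0 := by simp
  rw [this]
  refine tendsto_lintegral_filter_of_dominated_convergence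
    (fun η => sobW (-1) η * ENNReal.ofReal (5 * π) ^ 2) ?_ ?_ ?_ ?_
  · filter_upwards [eventually_pvFilter] with p hp
    refine (measurable_sobW _).mul (Measurable.pow_const (Measurable.enorm ?_) 2)
    refine Measurable.sub ((continuous_truncSign hp).measurable.const_mul 2)
      (Measurable.const_mul ?_ _)
    have := Complex.measurable_re.comp measurable_sign_coe
    convert this using 1
    ext η
    simp only [Function.comp]
    cases SignType.sign η <;> simp
  · filter_upwards [eventually_pvFilter] with p hp
    refine Eventually.of_forall fun η => ?_
    gcongr
    rw [← ofReal_norm]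
    refine ENNReal.ofReal_le_ofReal ((norm_sub_le _ _).trans ?_)
    have h1 := abs_truncSign_le hp.1 hp.2 η
    have h2 : ‖π * (SignType.sign η : ℝ)‖ ≤ π := by
      rw [norm_mul, Real.norm_of_nonneg Real.pi_pos.le]
      refine mul_le_of_le_one_right Real.pi_pos.le ?_
      cases SignType.sign η <;> simp
    rw [norm_mul, Real.norm_eq_abs, Real.norm_eq_abs, abs_two]
    linarith
  · have h5 : ENNReal.ofReal (5 * π) ^ 2 ≠ ⊤ := ENNReal.pow_ne_top ENNReal.ofReal_ne_top
    rw [lintegral_mul_const' _ _ h5]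
    exact ENNReal.mul_ne_top ((lintegral_sobW_neg_le le_rfl).trans_lt ENNReal.one_lt_top).ne h5
  · refine Eventually.of_forall fun η => ?_
    have h1 : Tendsto (fun p : ℝ × ℝ => 2 * truncSign p.1 p.2 η - π * (SignType.sign η : ℝ)) pvFilter
        (𝓝 0) := by
      have := ((tendsto_truncSign η).const_mul 2).sub_const (π * (SignType.sign η : ℝ))
      convert this using 2
      ring
    have h2 := h1.enorm
    rw [enorm_zero] at h2
    have h3 := ENNReal.Tendsto.const_mul (a := sobW (-1) η) (ENNReal.Tendsto.pow (n := 2) h2) (Or.inr (sobW_ne_top _ _))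
    simpa using h3

/-- Cauchy–Schwarz pairs the weighted error of the multiplier with the `H^1` norm of the symbol. The
rate depends only on the common bound, hence neither on the member of the family nor on the point.
-/
theorem UnifSob.hilbTrunc_uniform {ι : Type*} {f : ι → ℝ → ℂ} (hf : UnifSob 1 f) {ε : ℝ}
    (hε : 0 < ε) : ∀ᶠ p in pvFilter, ∀ i α,
      ‖1 / (Complex.I * π) * hilbTrunc (f i) α p - Muskat.hilbert (f i) α‖ ≤ ε := by
  obtain ⟨M, hM⟩ := hf.hilbert_eq le_rfl
  set δ : ℝ≥0∞ := ENNReal.ofReal ε ^ 2 / (M + 1) with hδ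
  have hδ0 : 0 < δ := ENNReal.div_pos (ENNReal.pow_pos (ENNReal.ofReal_pos.2 hε) 2).ne' (by simp)
  filter_upwards [eventually_pvFilter, tendsto_lintegral_truncSign.eventually_le_const hδ0]
    with p hp hpδ i α
  obtain ⟨F, hF, hF', e, e'⟩ := hM i
  have hi := hF.integrable le_rfl
  have hi' := hF'.integrable le_rfl
  rw [e', e, hilbTrunc_fourierInv hi α hp, fourierInv_eq_integral, ← integral_const_mul,
    ← integral_sub]
  · have hb : ‖∫ η : ℝ, (1 / (Complex.I * π) * ((-2 * Complex.I * truncSign p.1 p.2 η) *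
        (Complex.exp (2 * π * Complex.I * η * α) * F η)) -
        Complex.exp (2 * π * Complex.I * η * α) * (-(SignType.sign η : ℂ) * F η))‖ₑ ≤
        ∫⁻ η, ‖(2 * truncSign p.1 p.2 η - π * (SignType.sign η : ℝ) : ℝ)‖ₑ * ‖F η‖ₑ := by
      refine (enorm_integral_le_lintegral_enorm _).trans (lintegral_mono fun η => ?_)
      have e3 : 1 / (Complex.I * π) * ((-2 * Complex.I * truncSign p.1 p.2 η) *
        (Complex.exp (2 * π * Complex.I * η * α) * F η)) -
        Complex.exp (2 * π * Complex.I * η * α) * (-(SignType.sign η : ℂ) * F η) =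
        -(1 / π : ℝ) * ((2 * truncSign p.1 p.2 η - π * (SignType.sign η : ℝ) : ℝ) : ℂ) *
          (Complex.exp (2 * π * Complex.I * η * α) * F η) := by
        have : ((SignType.sign η : ℝ) : ℂ) = (SignType.sign η : ℂ) := by
          cases SignType.sign η <;> simp
        push_cast
        rw [this]
        have := Real.pi_ne_zero
        have : (π : ℂ) ≠ 0 := by exact_mod_cast this
        field_simp
        ring
      rw [e3, enorm_mul, enorm_mul, enorm_mul]
      have e4 : ‖Complex.exp (2 * π * Complex.I * η * α)‖ₑ = 1 := by
        rw [← ofReal_norm, norm_exp_two_pi, ENNReal.ofReal_one]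
      have e5 : ‖(-(1 / π : ℝ) : ℂ)‖ₑ ≤ 1 := by
        rw [← ofReal_norm, norm_neg, Complex.norm_real, Real.norm_of_nonneg (by positivity),
          ENNReal.ofReal_le_one]
        rw [div_le_one Real.pi_pos]
        linarith [Real.pi_gt_three]
      have e6 : ∀ r : ℝ, ‖(r : ℂ)‖ₑ = ‖r‖ₑ := fun r => by
        rw [enorm_eq_iff_norm_eq, Complex.norm_real]
      rw [e4, one_mul, e6]
      exact mul_le_mul' (mul_le_of_le_one_left zero_le e5) le_rfl
    have hcs : (∫⁻ η, ‖(2 * truncSign p.1 p.2 η - π * (SignType.sign η : ℝ) : ℝ)‖ₑ * ‖F η‖ₑ) ^ 2 ≤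
        δ * M := by
      have e7 : ∀ η, ‖(2 * truncSign p.1 p.2 η - π * (SignType.sign η : ℝ) : ℝ)‖ₑ * ‖F η‖ₑ =
          (sobW (-1 / 2) η * ‖(2 * truncSign p.1 p.2 η - π * (SignType.sign η : ℝ) : ℝ)‖ₑ) *
          (sobW (1 / 2) η * ‖F η‖ₑ) := fun η => by
        have : sobW (-1 / 2) η * sobW (1 / 2) η = 1 := by
          rw [← sobW_add, show (-1 / 2 : ℝ) + 1 / 2 = 0 by ring, sobW_zero]
        calc _ = (sobW (-1 / 2) η * sobW (1 / 2) η) *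
            (‖(2 * truncSign p.1 p.2 η - π * (SignType.sign η : ℝ) : ℝ)‖ₑ * ‖F η‖ₑ) := by
              rw [this, one_mul]
          _ = _ := by ring
      have e2 : ∀ (t η : ℝ), sobW (t / 2) η ^ 2 = sobW t η := fun t η => by
        rw [sq, ← sobW_add, add_halves]
      rw [lintegral_congr e7]
      refine (lintegral_mul_sq_le ?_ ((measurable_sobW _).mul hF.1.enorm).aemeasurable).trans ?_
      · refine ((measurable_sobW _).mul (Measurable.enorm ?_)).aemeasurable
        refine Measurable.sub ((continuous_truncSign hp).measurable.const_mul 2)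
          (Measurable.const_mul ?_ _)
        have := Complex.measurable_re.comp measurable_sign_coe
        convert this using 1
        ext η
        simp only [Function.comp]
        cases SignType.sign η <;> simp
      · simp only [Pi.mul_apply, mul_pow, e2]
        exact mul_le_mul' hpδ hF.2
    have hfin := (pow_le_pow_left' hb 2).trans (hcs.trans (show δ * M ≤ ENNReal.ofReal ε ^ 2 by
      calc δ * M ≤ δ * (M + 1) := by gcongr; exact le_self_add
        _ = _ := ENNReal.div_mul_cancel (by simp) (by simp)))
    have := (ENNReal.pow_le_pow_left_iff two_ne_zero).1 hfin
    rwa [← ofReal_norm, ENNReal.ofReal_le_ofReal_iff hε.le] at this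
  · refine ((integrable_exp_mul hi α).bdd_mul (c := 4 * π) (Continuous.aestronglyMeasurable ?_)
      (Eventually.of_forall fun η => ?_)).const_mul _
    · have := continuous_truncSign hp
      fun_prop
    · have := abs_truncSign_le hp.1 hp.2 η
      simp
      linarith
  · exact integrable_exp_mul hi' α

theorem hilbTrunc_eq_integral (f : ℝ → ℂ) (α : ℝ) {p : ℝ × ℝ} (hp : p.1 ≤ p.2) :
    hilbTrunc f α p = ∫ x in Ioc p.1 p.2, (x : ℂ)⁻¹ * (f (α - x) - f (α + x)) := by
  rw [hilbTrunc, intervalIntegral.integral_of_le hp]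
  congr 1; ext x; rw [div_eq_mul_inv, mul_comm]

/-- Pointwise time derivatives commute with the Hilbert transform. -/
theorem hasDerivWithinAt_hilbert {f f' : ℝ → ℝ → ℂ} (hf : UnifSob 1 fun t : Icc (0 : ℝ) T => f t)
    (hf' : UnifSob 1 fun t : Icc (0 : ℝ) T => f' t)
    (hd : ∀ t ∈ Icc 0 T, ∀ x, HasDerivWithinAt (fun τ => f τ x) (f' t x) (Icc 0 T) t) (α : ℝ) {t : ℝ}
    (ht : t ∈ Icc 0 T) :
    HasDerivWithinAt (fun τ => hilbert (f τ) α) (hilbert (f' t) α) (Icc 0 T) t := by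
  obtain ⟨C, hC⟩ := hf'.bounded le_rfl
  refine hasDerivWithinAt_of_uniform (l := pvFilter)
    (φ := fun p τ => 1 / (Complex.I * π) * hilbTrunc (f τ) α p)
    (φ' := fun p τ => 1 / (Complex.I * π) * hilbTrunc (f' τ) α p)
    (ψ' := fun τ => hilbert (f' τ) α) (fun τ hτ => ?_) (fun ε hε => ?_) ?_ ht
  · rw [Metric.tendsto_nhds]
    intro ε hε
    filter_upwards [hf.hilbTrunc_uniform (half_pos hε)] with p hp
    rw [dist_eq_norm]
    exact (hp ⟨τ, hτ⟩ α).trans_lt (half_lt_self hε)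
  · filter_upwards [hf'.hilbTrunc_uniform hε] with p hp τ hτ
    exact hp ⟨τ, hτ⟩ α
  -- A truncated transform is an integral over a bounded interval away from the singularity, so
  -- differentiation under the integral applies to it directly.
  · filter_upwards [eventually_pvFilter] with p hp τ hτ
    refine HasDerivWithinAt.const_mul _ ?_
    simp only [hilbTrunc_eq_integral _ _ hp.2]
    have hk : ContinuousOn (fun x : ℝ => (x : ℂ)⁻¹) (Icc p.1 p.2) := by
      refine ContinuousOn.inv₀ (by fun_prop) fun x hx => ?_
      exact_mod_cast (hp.1.trans_le hx.1).ne'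
    refine hasDerivWithinAt_integral_mul (f := fun τ x => f τ (α - x) - f τ (α + x))
      (f' := fun τ x => f' τ (α - x) - f' τ (α + x)) (C := C + C)
      (hk.integrableOn_Icc.mono_set Ioc_subset_Icc_self)
      (fun t ht x => (hd t ht _).sub (hd t ht _))
      (fun t ht x => (norm_sub_le _ _).trans (add_le_add (hC ⟨t, ht⟩ _) (hC ⟨t, ht⟩ _)))
      (fun t ht => ?_) hτ
    have hc : Continuous (f t) := hf.continuous le_rfl ⟨t, ht⟩
    refine (ContinuousOn.integrableOn_Icc ?_).mono_set Ioc_subset_Icc_self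
    exact hk.mul (by fun_prop)

end Time

/-! ### Maximum principles on the lower half plane. -/

theorem mem_lowerHalfPlane {z : ℂ} : z ∈ lowerHalfPlane ↔ z.im < 0 := Iff.rfl

theorem isOpen_lowerHalfPlane : IsOpen lowerHalfPlane :=
  isOpen_lt Complex.continuous_im continuous_const

theorem closure_lowerHalfPlane : closure lowerHalfPlane = {z | z.im ≤ 0} :=
  Complex.closure_setOfPred_im_lt 0

theorem convex_lowerHalfPlane : Convex ℝ lowerHalfPlane := convex_halfSpace_im_lt 0

theorem ofReal_mem_closure (x : ℝ) : (x : ℂ) ∈ closure lowerHalfPlane := by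
  rw [closure_lowerHalfPlane]; simp

theorem eventually_atInfty {p : ℂ → Prop} :
    (∀ᶠ z in atInfty, p z) ↔ ∃ R : ℝ, ∀ z ∈ lowerHalfPlane, R ≤ ‖z‖ → p z := by
  rw [atInfty, eventually_inf_principal, hasBasis_cobounded_norm.eventually_iff]
  constructor
  · rintro ⟨R, -, h⟩
    exact ⟨R, fun z hz hR => h hR hz⟩
  · rintro ⟨R, h⟩
    exact ⟨R, trivial, fun z hR hz => h z hz hR⟩

instance : NeBot atInfty := by
  refine ⟨fun h => ?_⟩
  have h1 : ∀ᶠ z in atInfty, False := by rw [h]; exact eventually_bot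
  obtain ⟨R, hR⟩ := eventually_atInfty.1 h1
  refine hR (-((|R| + 1 : ℝ) : ℂ) * Complex.I) ?_ ?_
  · have := abs_nonneg R
    simp only [mem_lowerHalfPlane, Complex.mul_im, Complex.neg_re, Complex.ofReal_re,
      Complex.I_im, Complex.neg_im, Complex.ofReal_im, Complex.I_re]
    linarith
  · rw [norm_mul, norm_neg, Complex.norm_I, mul_one, Complex.norm_real,
      Real.norm_of_nonneg (by positivity)]
    linarith [le_abs_self R]

/-- Maximum modulus principle on the lower half plane. -/
theorem norm_le_of_boundary {f : ℂ → ℂ} {C : ℝ} (hc : ContinuousOn f (closure lowerHalfPlane))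
    (hd : DifferentiableOn ℂ f lowerHalfPlane) (hb : ∀ x : ℝ, ‖f x‖ ≤ C)
    (hl : ∀ ε > 0, ∀ᶠ z in atInfty, ‖f z‖ ≤ C + ε) {z : ℂ} (hz : z ∈ lowerHalfPlane) :
    ‖f z‖ ≤ C := by
  refine le_of_forall_pos_le_add fun ε hε => ?_
  obtain ⟨R, hR⟩ := eventually_atInfty.1 (hl ε hε)
  -- The half disc must contain `z`, and its circular arc must lie where the bound at infinity
  -- already holds.
  set r : ℝ := max R (‖z‖ + 1) with hr
  set U : Set ℂ := Metric.ball 0 r ∩ lowerHalfPlane with hU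
  have hsub : closure U ⊆ closure lowerHalfPlane := closure_mono inter_subset_right
  have hUo : IsOpen U := Metric.isOpen_ball.inter isOpen_lowerHalfPlane
  refine Complex.norm_le_of_forall_mem_frontier_norm_le (U := U)
    (Metric.isBounded_ball.subset inter_subset_left)
    ⟨hd.mono inter_subset_right, hc.mono hsub⟩ (fun w hw => ?_) (subset_closure ⟨?_, hz⟩)
  · have hw1 : w ∈ closure lowerHalfPlane := hsub hw.1
    rw [closure_lowerHalfPlane] at hw1
    rcases (show w.im ≤ 0 from hw1).lt_or_eq with h | h
    · refine hR w h ?_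
      by_contra hlt
      refine hw.2 ?_
      rw [hUo.interior_eq]
      refine ⟨?_, h⟩
      rw [mem_ball_zero_iff]
      exact (not_le.1 hlt).trans_le (le_max_left _ _)
    · have : w = (w.re : ℂ) := Complex.ext (by simp) (by simp [h])
      rw [this]
      exact (hb _).trans (by linarith)
  · rw [mem_ball_zero_iff, hr]
    exact (lt_add_one _).trans_le (le_max_right _ _)

theorem eq_of_boundary {f : ℂ → ℂ} {a : ℂ} (hc : ContinuousOn f (closure lowerHalfPlane))
    (hd : DifferentiableOn ℂ f lowerHalfPlane) (hb : ∀ x : ℝ, f x = a)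
    (hl : Tendsto f atInfty (𝓝 a)) {z : ℂ} (hz : z ∈ lowerHalfPlane) : f z = a := by
  have h := norm_le_of_boundary (f := fun z => f z - a) (C := 0) (hc.sub continuousOn_const)
    (hd.sub_const a) (fun x => by simp [hb]) (fun ε hε => by
      filter_upwards [hl.eventually (Metric.closedBall_mem_nhds a hε)] with w hw
      simpa [dist_eq_norm] using hw) hz
  exact sub_eq_zero.1 (norm_le_zero_iff.1 h)

/-- A function without zeros which has unimodular boundary values and tends to `1` at infinity is
equal to `1`. -/
theorem eq_one_of_norm_boundary {f : ℂ → ℂ} (hc : ContinuousOn f (closure lowerHalfPlane))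
    (hd : DifferentiableOn ℂ f lowerHalfPlane) (h0 : ∀ z ∈ closure lowerHalfPlane, f z ≠ 0)
    (hb : ∀ x : ℝ, ‖f x‖ = 1) (hl : Tendsto f atInfty (𝓝 1)) :
    ∀ z ∈ closure lowerHalfPlane, f z = 1 := by
  have key : ∀ {f : ℂ → ℂ}, ContinuousOn f (closure lowerHalfPlane) →
      DifferentiableOn ℂ f lowerHalfPlane → (∀ x : ℝ, ‖f x‖ = 1) → Tendsto f atInfty (𝓝 1) →
      ∀ z ∈ lowerHalfPlane, ‖f z‖ ≤ 1 := fun hc hd hb hl z hz =>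
    norm_le_of_boundary hc hd (fun x => (hb x).le) (fun ε hε => by
      have := hl.norm
      rw [norm_one] at this
      exact this.eventually_le_const (by linarith)) hz
  have h1 := key hc hd hb hl
  have h2 := key (f := fun z => (f z)⁻¹) (hc.inv₀ h0)
    (hd.inv fun z hz => h0 z (subset_closure hz)) (fun x => by simp [hb])
    (by simpa using hl.inv₀ one_ne_zero)
  have h3 : ∀ z ∈ lowerHalfPlane, ‖f z‖ = 1 := fun z hz => by
    refine le_antisymm (h1 z hz) ?_
    have := h2 z hz
    rw [norm_inv] at this
    have h4 := norm_pos_iff.2 (h0 z (subset_closure hz))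
    exact (inv_le_one₀ h4).1 this
  -- The image lies in the unit circle, which has empty interior, so the open mapping theorem
  -- excludes nonconstant `f`.
  have hconst : ∃ w, ∀ z ∈ lowerHalfPlane, f z = w := by
    rcases (hd.analyticOnNhd isOpen_lowerHalfPlane).is_constant_or_isOpen
      convex_lowerHalfPlane.isPreconnected with h | h
    · exact h
    · exfalso
      have ho := h _ subset_rfl isOpen_lowerHalfPlane
      have hz : (-Complex.I) ∈ lowerHalfPlane := by simp [mem_lowerHalfPlane]
      have hm : f (-Complex.I) ∈ interior (Metric.sphere (0 : ℂ) 1) := by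
        refine interior_maximal ?_ ho ⟨_, hz, rfl⟩
        rintro _ ⟨w, hw, rfl⟩
        simpa using h3 w hw
      rw [interior_sphere' (0 : ℂ) 1] at hm
      exact hm
  obtain ⟨w, hw⟩ := hconst
  have hw1 : w = 1 := by
    refine tendsto_nhds_unique (f := fun _ : ℂ => w) tendsto_const_nhds (hl.congr' ?_)
    exact eventually_atInfty.2 ⟨0, fun z hz _ => hw z hz⟩
  intro z hz
  have hcl : closure lowerHalfPlane ⊆ closure lowerHalfPlane := subset_rfl
  exact Set.EqOn.of_subset_closure (s := lowerHalfPlane) (t := closure lowerHalfPlane)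
    (f := f) (g := fun _ => 1) (fun z hz => (hw z hz).trans hw1) hc continuousOn_const
    subset_closure subset_rfl hz

/-- For every real `c` the function `e^{i c f}` is zero-free, unimodular on the line and tends to
`1`, hence equals `1`. Differentiating at `c = 0` gives `i f = 0`. -/
theorem eq_zero_of_real_boundary {f : ℂ → ℂ} (hc : ContinuousOn f (closure lowerHalfPlane))
    (hd : DifferentiableOn ℂ f lowerHalfPlane) (hb : ∀ x : ℝ, (f x).im = 0)
    (hl : Tendsto f atInfty (𝓝 0)) : ∀ z ∈ closure lowerHalfPlane, f z = 0 := by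
  intro z hz
  have h1 : ∀ c : ℝ, Complex.exp (c * (Complex.I * f z)) = 1 := fun c => by
    refine eq_one_of_norm_boundary (f := fun z => Complex.exp (c * (Complex.I * f z))) ?_ ?_
      (fun _ _ => Complex.exp_ne_zero _) (fun x => ?_) ?_ z hz
    · exact Complex.continuous_exp.comp_continuousOn
        (continuousOn_const.mul (continuousOn_const.mul hc))
    · exact ((hd.const_mul Complex.I).const_mul (c : ℂ)).cexp
    · rw [Complex.norm_exp]; simp [hb]
    · have := (hl.const_mul Complex.I).const_mul (c : ℂ)
      simpa [Function.comp_def] using (Complex.continuous_exp.tendsto _).comp this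
  have h2 : HasDerivAt (fun c : ℝ => Complex.exp (c * (Complex.I * f z))) (Complex.I * f z) 0 := by
    have h3 : HasDerivAt (fun c : ℝ => (c : ℂ) * (Complex.I * f z)) (Complex.I * f z) 0 := by
      simpa using (Complex.ofRealCLM.hasDerivAt (x := 0)).mul_const (Complex.I * f z)
    simpa using h3.cexp
  simp only [h1] at h2
  have h4 := h2.unique (hasDerivAt_const (0 : ℝ) (1 : ℂ))
  simpa using h4

/-- Logarithms on the half plane which vanish at infinity are unique. -/
theorem eqOn_of_exp_eq {f g : ℂ → ℂ} (hf : ContinuousOn f (closure lowerHalfPlane))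
    (hg : ContinuousOn g (closure lowerHalfPlane)) (hf0 : Tendsto f atInfty (𝓝 0))
    (hg0 : Tendsto g atInfty (𝓝 0))
    (h : ∀ z ∈ lowerHalfPlane, Complex.exp (f z) = Complex.exp (g z)) :
    EqOn f g (closure lowerHalfPlane) := by
  refine Set.EqOn.of_subset_closure (s := lowerHalfPlane) ?_ hf hg subset_closure subset_rfl
  intro z hz
  have hex : ∀ z ∈ lowerHalfPlane, ∃ n : ℤ, f z = g z + n * (2 * π * Complex.I) := fun z hz =>
    Complex.exp_eq_exp_iff_exists_int.1 (h z hz)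
  have hdc : ContinuousOn (fun z => (f z - g z).im) lowerHalfPlane :=
    Complex.continuous_im.comp_continuousOn ((hf.sub hg).mono subset_closure)
  have him : ∀ z ∈ lowerHalfPlane, ∃ n : ℤ, (f z - g z).im = n * (2 * π) := fun z hz => by
    obtain ⟨n, hn⟩ := hex z hz
    exact ⟨n, by rw [hn]; simp⟩
  have hlim : Tendsto (fun z => (f z - g z).im) atInfty (𝓝 0) := by
    have := (Complex.continuous_im.tendsto _).comp (hf0.sub hg0)
    simpa [Function.comp_def] using this
  have hev : ∀ᶠ z in atInfty, z ∈ lowerHalfPlane ∧ |(f z - g z).im| < π := by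
    refine Filter.Eventually.and (eventually_atInfty.2 ⟨0, fun z hz _ => hz⟩) ?_
    have := hlim.eventually (Metric.ball_mem_nhds 0 Real.pi_pos)
    filter_upwards [this] with w hw
    simpa using hw
  obtain ⟨w, hw, hwπ⟩ := hev.exists
  obtain ⟨n, hn⟩ := hex z hz
  have hnim : (f z - g z).im = n * (2 * π) := by rw [hn]; simp
  rcases eq_or_ne n 0 with rfl | hn0
  · simpa using hn
  exfalso
  have hpi := Real.pi_pos
  have hbig : 2 * π ≤ |(f z - g z).im| := by
    rw [hnim, abs_mul, abs_of_pos (by positivity : (0 : ℝ) < 2 * π)]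
    have : (1 : ℝ) ≤ |(n : ℝ)| := by exact_mod_cast Int.one_le_abs hn0
    nlinarith
  -- `Im (f - g)` is continuous with values in `2πℤ` and is small near infinity. A nonzero value
  -- would force its modulus to pass through `π`, which is not a multiple of `2π`.
  obtain ⟨y, hy, hye⟩ := convex_lowerHalfPlane.isPreconnected.intermediate_value hw hz hdc.abs
    (⟨hwπ.le, by linarith⟩ : π ∈ Icc |(f w - g w).im| |(f z - g z).im|)
  obtain ⟨m, hm⟩ := him y hy
  simp only [hm, abs_mul, abs_of_pos (by positivity : (0 : ℝ) < 2 * π)] at hye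
  have h2 : 2 * |(m : ℝ)| = 1 := by
    have h3 : |(m : ℝ)| * (2 * π) - π = 0 := by linarith
    have h4 : π * (2 * |(m : ℝ)| - 1) = 0 := by linarith
    rcases mul_eq_zero.1 h4 with h5 | h5
    · exact absurd h5 hpi.ne'
    · linarith
  have h6 : (2 * |m| : ℤ) = 1 := by exact_mod_cast h2
  omega

/-! ### The Poisson kernel and harmonic extension. -/

theorem poissonKer_nonneg {ε : ℝ} (hε : 0 < ε) (x : ℝ) : 0 ≤ poissonKer ε x := by
  unfold poissonKer; positivity

theorem integrable_poissonKer {ε : ℝ} (hε : 0 < ε) : Integrable (poissonKer ε) := by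
  have h : poissonKer ε = fun x => (1 / (π * ε)) * (1 + (ε⁻¹ * x) ^ 2)⁻¹ := by
    ext x
    unfold poissonKer
    have := Real.pi_pos
    field_simp
  rw [h]
  exact (integrable_inv_one_add_sq.comp_mul_left' (inv_ne_zero hε.ne')).const_mul _

/-- The symbol of the Poisson kernel. -/
def poissonSymbol (ε η : ℝ) : ℂ := Complex.exp ((-(2 * π * ε * |η|) : ℝ) : ℂ)

theorem continuous_poissonSymbol (ε : ℝ) : Continuous (poissonSymbol ε) := by
  unfold poissonSymbol; fun_prop

theorem norm_poissonSymbol (ε η : ℝ) : ‖poissonSymbol ε η‖ = Real.exp (-(2 * π * ε * |η|)) := by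
  rw [poissonSymbol, Complex.norm_exp_ofReal]

theorem poissonSymbol_integral {ε : ℝ} (hε : 0 < ε) (x : ℝ) :
    Integrable (fun η : ℝ => Complex.exp (2 * π * Complex.I * η * x) * poissonSymbol ε η) ∧
    ∫ η : ℝ, Complex.exp (2 * π * Complex.I * η * x) * poissonSymbol ε η = poissonKer ε x := by
  have hpi := Real.pi_pos
  set a : ℂ := 2 * π * (x * Complex.I - ε) with ha
  set b : ℂ := 2 * π * (x * Complex.I + ε) with hb
  have har : a.re < 0 := by simp [ha]; positivity
  have hbr : 0 < b.re := by simp [hb]; positivity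
  have e1 : EqOn (fun η : ℝ => Complex.exp (2 * π * Complex.I * η * x) * poissonSymbol ε η)
      (fun η : ℝ => Complex.exp (a * η)) (Ioi 0) := fun η hη => by
    simp only [poissonSymbol]
    rw [← Complex.exp_add, abs_of_pos hη]; congr 1; rw [ha]; push_cast; ring
  have e2 : EqOn (fun η : ℝ => Complex.exp (2 * π * Complex.I * η * x) * poissonSymbol ε η)
      (fun η : ℝ => Complex.exp (b * η)) (Iic 0) := fun η hη => by
    simp only [poissonSymbol]
    rw [← Complex.exp_add, abs_of_nonpos hη]; congr 1; rw [hb]; push_cast; ring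
  have i1 := (integrableOn_congr_fun e1 measurableSet_Ioi).2 (integrableOn_exp_mul_complex_Ioi har 0)
  have i2 := (integrableOn_congr_fun e2 measurableSet_Iic).2 (integrableOn_exp_mul_complex_Iic hbr 0)
  have hi := i2.union i1
  rw [Iic_union_Ioi, integrableOn_univ] at hi
  refine ⟨hi, ?_⟩
  rw [← intervalIntegral.integral_Iic_add_Ioi i2 i1, setIntegral_congr_fun measurableSet_Ioi e1,
    setIntegral_congr_fun measurableSet_Iic e2, integral_exp_mul_complex_Ioi har,
    integral_exp_mul_complex_Iic hbr]
  have ha0 : a ≠ 0 := fun h => by rw [h] at har; simp at har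
  have hb0 : b ≠ 0 := fun h => by rw [h] at hbr; simp at hbr
  have hab : b - a = 4 * π * ε := by rw [ha, hb]; ring
  have hab2 : a * b = -(4 * π ^ 2 * (ε ^ 2 + x ^ 2)) := by
    rw [ha, hb]; linear_combination 4 * π ^ 2 * x ^ 2 * Complex.I_sq
  have e3 : Complex.exp (b * (0 : ℝ)) / b + -Complex.exp (a * (0 : ℝ)) / a = -(b - a) / (a * b) := by
    simp only [Complex.ofReal_zero, mul_zero, Complex.exp_zero]
    field_simp
    ring
  rw [e3, hab, hab2, poissonKer]
  have hpc : (π : ℂ) ≠ 0 := by exact_mod_cast hpi.ne'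
  have hex : ((ε : ℂ) ^ 2 + x ^ 2) ≠ 0 := by
    have : ε ^ 2 + x ^ 2 ≠ 0 := by positivity
    exact_mod_cast this
  push_cast
  field_simp

theorem fourierInv_poissonSymbol {ε : ℝ} (hε : 0 < ε) :
    𝓕⁻ (poissonSymbol ε) = fun x => (poissonKer ε x : ℂ) := by
  ext x
  rw [fourierInv_eq_integral, (poissonSymbol_integral hε x).2]

theorem integrable_poissonSymbol {ε : ℝ} (hε : 0 < ε) : Integrable (poissonSymbol ε) := by
  simpa using (poissonSymbol_integral hε 0).1

theorem fourierInv_poissonKer {ε : ℝ} (hε : 0 < ε) :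
    𝓕⁻ (fun x => (poissonKer ε x : ℂ)) = poissonSymbol ε := by
  have hk : Integrable fun x => (poissonKer ε x : ℂ) := (integrable_poissonKer hε).ofReal
  have h1 : 𝓕 (𝓕⁻ (poissonSymbol ε)) = poissonSymbol ε := by
    refine (continuous_poissonSymbol ε).fourier_fourierInv_eq (integrable_poissonSymbol hε) ?_
    have : 𝓕 (poissonSymbol ε) = 𝓕⁻ (poissonSymbol ε) := by
      rw [Real.fourierInv_eq_fourier_comp_neg]
      congr 1; ext η; simp [poissonSymbol]
    rw [this, fourierInv_poissonSymbol hε]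
    exact hk
  rw [fourierInv_poissonSymbol hε] at h1
  rw [Real.fourierInv_eq_fourier_comp_neg, ← h1]
  congr 1; ext x; simp [poissonKer]

/-- The extension to the closed lower half plane of the function with symbol `F`. -/
def symbolExt (F : ℝ → ℂ) (z : ℂ) : ℂ :=
  ∫ η : ℝ, Complex.exp (2 * π * Complex.I * η * z.re) * (poissonSymbol (-z.im) η * F η)

theorem symbolExt_ofReal (F : ℝ → ℂ) (x : ℝ) : symbolExt F x = 𝓕⁻ F x := by
  rw [symbolExt, fourierInv_eq_integral]
  congr 1; ext η; simp [poissonSymbol]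

theorem poissonExt_fourierInv {F : ℝ → ℂ} (hF : Integrable F) {z : ℂ} (hz : z ∈ lowerHalfPlane) :
    poissonExt (𝓕⁻ F) z = symbolExt F z := by
  have hε : 0 < -z.im := neg_pos.2 hz
  have hk : Integrable fun x : ℝ => (poissonKer (-z.im) (z.re - x) : ℂ) :=
    ((integrable_poissonKer hε).comp_sub_left z.re).ofReal
  have h := integral_fourierInv_smul hF hk
  simp only [smul_eq_mul] at h
  rw [poissonExt, symbolExt]
  calc _ = ∫ x, 𝓕⁻ F x * (poissonKer (-z.im) (z.re - x) : ℂ) := by congr 1; ext x; ring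
    _ = ∫ x, F x * 𝓕⁻ (fun x => (poissonKer (-z.im) (z.re - x) : ℂ)) x := h
    _ = _ := by
      congr 1; ext η
      have e : 𝓕⁻ (fun x => (poissonKer (-z.im) (z.re - x) : ℂ)) η =
          Complex.exp (2 * π * Complex.I * η * z.re) * poissonSymbol (-z.im) (-η) := by
        rw [← fourierInv_poissonKer hε, fourierInv_eq_integral, fourierInv_eq_integral,
          ← integral_sub_left_eq_self _ volume z.re, ← integral_const_mul]
        congr 1; ext x
        rw [sub_sub_cancel, ← mul_assoc, ← Complex.exp_add]
        congr 2
        push_cast; ring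
      rw [e]
      have e2 : poissonSymbol (-z.im) (-η) = poissonSymbol (-z.im) η := by simp [poissonSymbol]
      rw [e2]; ring

theorem norm_poissonSymbol_le {ε : ℝ} (hε : 0 ≤ ε) (η : ℝ) : ‖poissonSymbol ε η‖ ≤ 1 := by
  rw [norm_poissonSymbol, Real.exp_le_one_iff]
  have := Real.pi_pos
  have : 0 ≤ 2 * π * ε * |η| := by positivity
  linarith

theorem continuousOn_symbolExt {F : ℝ → ℂ} (hF : Integrable F) :
    ContinuousOn (symbolExt F) (closure lowerHalfPlane) := by
  intro z hz
  refine continuousWithinAt_of_dominated (bound := fun η => ‖F η‖)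
    (F := fun (z : ℂ) (η : ℝ) => Complex.exp (2 * π * Complex.I * η * z.re) *
      (poissonSymbol (-z.im) η * F η)) ?_ ?_ hF.norm ?_
  · refine Eventually.of_forall fun w => ?_
    refine AEStronglyMeasurable.mul (Continuous.aestronglyMeasurable (by fun_prop))
      (AEStronglyMeasurable.mul (continuous_poissonSymbol _).aestronglyMeasurable hF.1)
  · filter_upwards [self_mem_nhdsWithin] with w hw
    rw [closure_lowerHalfPlane] at hw
    refine Eventually.of_forall fun η => ?_
    rw [norm_mul, norm_exp_two_pi, one_mul, norm_mul]
    exact mul_le_of_le_one_left (norm_nonneg _) (norm_poissonSymbol_le (neg_nonneg.2 hw) η)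
  · refine Eventually.of_forall fun η => Continuous.continuousWithinAt ?_
    unfold poissonSymbol
    fun_prop

/-- For `η ≤ 0` the damping of the Poisson symbol and the oscillation combine into `e^{2πiηz}`,
which is holomorphic in `z`. Symbols on the negative half line therefore give holomorphic
extensions. -/
theorem symbolExt_eq {F : ℝ → ℂ} (hneg : ∀ η, 0 < η → F η = 0) :
    symbolExt F = fun z : ℂ => ∫ η : ℝ, Complex.exp (2 * π * Complex.I * η * z) * F η := by
  ext z
  rw [symbolExt]
  congr 1; ext η
  rcases le_or_gt η 0 with h | h
  · rw [← mul_assoc, poissonSymbol, ← Complex.exp_add]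
    congr 2
    rw [abs_of_nonpos h]
    conv_rhs => rw [← Complex.re_add_im z]
    push_cast
    linear_combination -(2 * π * η * z.im * Complex.I_sq)
  · rw [hneg η h]; simp

theorem differentiableOn_symbolExt {F : ℝ → ℂ} (hF : Integrable F) (hneg : ∀ η, 0 < η → F η = 0) :
    DifferentiableOn ℂ (symbolExt F) lowerHalfPlane := by
  rw [symbolExt_eq hneg]
  intro z hz
  set δ : ℝ := -z.im / 2 with hδ
  have hδ0 : 0 < δ := by have : z.im < 0 := hz; rw [hδ]; linarith
  have hm : ∀ w : ℂ, AEStronglyMeasurable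
      (fun η : ℝ => Complex.exp (2 * π * Complex.I * η * w) * F η) volume := fun w =>
    AEStronglyMeasurable.mul (Continuous.aestronglyMeasurable (by fun_prop)) hF.1
  have hexp : ∀ w : ℂ, ∀ η : ℝ, ‖Complex.exp (2 * π * Complex.I * η * w)‖ =
      Real.exp (-(2 * π * η * w.im)) := fun w η => by
    rw [Complex.norm_exp]; congr 1; simp
  have hpi := Real.pi_pos
  have hle : ∀ w : ℂ, w.im < 0 → ∀ η : ℝ, ‖Complex.exp (2 * π * Complex.I * η * w) * F η‖ ≤
      ‖F η‖ := fun w hw η => by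
    rcases le_or_gt η 0 with h | h
    · rw [norm_mul, hexp]
      refine mul_le_of_le_one_left (norm_nonneg _) (Real.exp_le_one_iff.2 ?_)
      have : 0 ≤ η * w.im := mul_nonneg_of_nonpos_of_nonpos h hw.le
      nlinarith
    · simp [hneg η h]
  -- The factor `η` from the derivative is paid for by the decay below the line `Im w = -δ`, through
  -- `x e^{-x} ≤ 1`; integrability of `F` alone suffices.
  have hle' : ∀ w : ℂ, w.im < -δ → ∀ η : ℝ, ‖Complex.exp (2 * π * Complex.I * η * w) *
      (2 * π * Complex.I * η) * F η‖ ≤ δ⁻¹ * ‖F η‖ := fun w hw η => by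
    rcases le_or_gt η 0 with h | h
    · rw [norm_mul, norm_mul, hexp]
      refine mul_le_mul_of_nonneg_right ?_ (norm_nonneg _)
      have hn : ‖(2 * π * Complex.I * η : ℂ)‖ = 2 * π * -η := by
        simp [abs_of_nonpos h, abs_of_pos hpi]
      rw [hn, inv_eq_one_div, le_div_iff₀ hδ0]
      have h1 : Real.exp (-(2 * π * η * w.im)) ≤ Real.exp (-(2 * π * -η * δ)) := by
        refine Real.exp_le_exp.2 ?_
        nlinarith [mul_nonneg (mul_nonneg hpi.le (neg_nonneg.2 h)) (by linarith : 0 ≤ -δ - w.im)]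
      have h2 : 2 * π * -η * δ ≤ Real.exp (2 * π * -η * δ) :=
        (by linarith : 2 * π * -η * δ ≤ 2 * π * -η * δ + 1).trans (Real.add_one_le_exp _)
      have h3 : 0 ≤ 2 * π * -η * δ := by
        have := neg_nonneg.2 h; positivity
      calc _ = Real.exp (-(2 * π * η * w.im)) * (2 * π * -η * δ) := by ring
        _ ≤ Real.exp (-(2 * π * -η * δ)) * Real.exp (2 * π * -η * δ) :=
          mul_le_mul h1 h2 h3 (Real.exp_nonneg _)
        _ = 1 := by rw [← Real.exp_add]; simp
    · simp [hneg η h]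
  have hzδ : z.im < -δ := by
    have : z.im < 0 := hz
    rw [hδ]; linarith
  have h := hasDerivAt_integral_of_dominated_loc_of_deriv_le (μ := volume) (x₀ := z)
    (s := {w : ℂ | w.im < -δ})
    (F := fun (w : ℂ) (η : ℝ) => Complex.exp (2 * π * Complex.I * η * w) * F η)
    (F' := fun (w : ℂ) (η : ℝ) => Complex.exp (2 * π * Complex.I * η * w) *
      (2 * π * Complex.I * η) * F η)
    (bound := fun η => δ⁻¹ * ‖F η‖)
    ((isOpen_lt Complex.continuous_im continuous_const).mem_nhds hzδ)
    (Eventually.of_forall hm)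
    (hF.norm.mono' (hm z) (Eventually.of_forall (hle z hz)))
    (AEStronglyMeasurable.mul (Continuous.aestronglyMeasurable (by fun_prop)) hF.1)
    (Eventually.of_forall fun η w hw => hle' w hw η) (hF.norm.const_mul _)
    (Eventually.of_forall fun η w _ => ?_)
  · exact h.2.differentiableAt.differentiableWithinAt
  · have h4 := ((hasDerivAt_id w).const_mul (2 * π * Complex.I * η : ℂ)).cexp
    simpa using h4.mul_const (F η)

theorem integral_poissonKer {ε : ℝ} (hε : 0 < ε) : ∫ x, poissonKer ε x = 1 := by
  have h := congrFun (fourierInv_poissonKer hε) 0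
  rw [fourierInv_eq_integral] at h
  simp only [Complex.ofReal_zero, mul_zero, Complex.exp_zero, one_mul, poissonSymbol, abs_zero,
    neg_zero] at h
  rw [integral_complex_ofReal] at h
  exact_mod_cast h

theorem integrable_poissonKer_sub {ε : ℝ} (hε : 0 < ε) (x : ℝ) :
    Integrable fun β => (poissonKer ε (x - β) : ℂ) :=
  ((integrable_poissonKer hε).comp_sub_left x).ofReal

theorem integral_poissonKer_sub {ε : ℝ} (hε : 0 < ε) (x : ℝ) :
    ∫ β, (poissonKer ε (x - β) : ℂ) = 1 := by
  rw [integral_complex_ofReal, integral_sub_left_eq_self (poissonKer ε) volume x,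
    integral_poissonKer hε, Complex.ofReal_one]

theorem integrable_poissonKer_mul {f : ℝ → ℂ} (hf : Continuous f) {C : ℝ} (hC : ∀ x, ‖f x‖ ≤ C)
    {ε : ℝ} (hε : 0 < ε) (x : ℝ) : Integrable fun β => (poissonKer ε (x - β) : ℂ) * f β :=
  (integrable_poissonKer_sub hε x).mul_bdd (c := C) hf.aestronglyMeasurable (Eventually.of_forall hC)

theorem poissonExt_const_add {f : ℝ → ℂ} (hf : Continuous f) {C : ℝ} (hC : ∀ x, ‖f x‖ ≤ C) (a : ℂ)
    {z : ℂ} (hz : z ∈ lowerHalfPlane) :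
    poissonExt (fun x => a + f x) z = a + poissonExt f z := by
  have hε : 0 < -z.im := neg_pos.2 hz
  rw [poissonExt, poissonExt]
  simp only [mul_add]
  rw [integral_add ((integrable_poissonKer_sub hε _).mul_const a)
    (integrable_poissonKer_mul hf hC hε _), integral_mul_const, integral_poissonKer_sub hε, one_mul]

theorem poissonKer_le {z : ℂ} (hz : z ∈ lowerHalfPlane) {M β : ℝ} (hM : |β| ≤ M) (h : M < ‖z‖) :
    poissonKer (-z.im) (z.re - β) ≤ 1 / (‖z‖ - M) := by
  have hε : 0 < -z.im := neg_pos.2 hz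
  have hd : 0 < ‖z‖ - M := sub_pos.2 h
  have h1 : ‖z - β‖ ^ 2 = (-z.im) ^ 2 + (z.re - β) ^ 2 := by
    rw [← Complex.normSq_eq_norm_sq, Complex.normSq_apply]; simp; ring
  have h2 : ‖z‖ - M ≤ ‖z - β‖ := by
    have := norm_sub_norm_le z (β : ℂ)
    rw [Complex.norm_real, Real.norm_eq_abs] at this
    linarith
  have h3 : -z.im ≤ ‖z - β‖ := by
    refine le_trans ?_ (Complex.abs_im_le_norm _)
    simpa using neg_le_abs z.im
  have h4 : 0 < ‖z - β‖ := hd.trans_le h2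
  rw [poissonKer, ← h1, div_le_div_iff₀ (by positivity) hd, one_mul]
  calc -z.im * (‖z‖ - M) ≤ ‖z - β‖ * ‖z - β‖ := mul_le_mul h3 h2 hd.le h4.le
    _ ≤ π * ‖z - β‖ ^ 2 := by nlinarith [Real.pi_gt_three, sq_nonneg ‖z - β‖]

/-- Points may approach infinity tangentially to the real line, so decay in `Im z` is not available.
Instead `f` is small off a bounded interval, while over that interval the kernel is at most the
inverse of `‖z‖ - N`, by `poissonKer_le`. -/
theorem tendsto_poissonExt {f : ℝ → ℂ} {C : ℝ} (hC : ∀ x, ‖f x‖ ≤ C)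
    (h0 : Tendsto f (cocompact ℝ) (𝓝 0)) : Tendsto (poissonExt f) atInfty (𝓝 0) := by
  have hC0 : 0 ≤ C := (norm_nonneg _).trans (hC 0)
  rw [Metric.tendsto_nhds]
  intro ε hε
  obtain ⟨M, hM⟩ : ∃ M : ℝ, ∀ x, M < |x| → ‖f x‖ ≤ ε / 2 := by
    have h1 := h0.eventually (Metric.closedBall_mem_nhds 0 (half_pos hε))
    rw [← Metric.cobounded_eq_cocompact, hasBasis_cobounded_norm.eventually_iff] at h1
    obtain ⟨M, -, hM⟩ := h1
    exact ⟨M, fun x hx => by simpa using hM (show M ≤ ‖x‖ from hx.le)⟩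
  set N : ℝ := |M| with hN
  refine eventually_atInfty.2 ⟨N + 1 + 4 * C * (2 * N) / ε, fun z hz hR => ?_⟩
  have hy : 0 < -z.im := neg_pos.2 hz
  have hN0 : 0 ≤ N := abs_nonneg _
  have hq : 0 ≤ 4 * C * (2 * N) / ε := by positivity
  have hd : 0 < ‖z‖ - N := by linarith
  set d := ‖z‖ - N with hd'
  have hi1 : Integrable fun β => ε / 2 * poissonKer (-z.im) (z.re - β) :=
    ((integrable_poissonKer hy).comp_sub_left z.re).const_mul _
  have hi2 : Integrable ((Icc (-N) N).indicator fun _ => C * (1 / d)) :=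
    (integrable_indicator_iff measurableSet_Icc).2 (integrableOn_const (by simp))
  have hle : ∀ β, ‖(poissonKer (-z.im) (z.re - β) : ℂ) * f β‖ ≤
      ε / 2 * poissonKer (-z.im) (z.re - β) + (Icc (-N) N).indicator (fun _ => C * (1 / d)) β := by
    intro β
    have hk := poissonKer_nonneg hy (z.re - β)
    rw [norm_mul, Complex.norm_real, Real.norm_of_nonneg hk]
    by_cases hβ : β ∈ Icc (-N) N
    · rw [indicator_of_mem hβ]
      have h1 := poissonKer_le hz (abs_le.2 hβ) (by linarith)
      calc _ ≤ 1 / d * C := mul_le_mul h1 (hC β) (norm_nonneg _) (by positivity)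
        _ = C * (1 / d) := mul_comm _ _
        _ ≤ _ := le_add_of_nonneg_left (by positivity)
    · rw [indicator_of_notMem hβ, add_zero, mul_comm]
      refine mul_le_mul_of_nonneg_right (hM β ?_) hk
      by_contra h
      exact hβ (abs_le.1 ((not_lt.1 h).trans (le_abs_self M)))
  rw [dist_zero_right]
  calc ‖poissonExt f z‖ ≤ ∫ β, (ε / 2 * poissonKer (-z.im) (z.re - β) +
        (Icc (-N) N).indicator (fun _ => C * (1 / d)) β) :=
        norm_integral_le_of_norm_le (hi1.add hi2) (Eventually.of_forall hle)
    _ = ε / 2 + 2 * N * (C * (1 / d)) := by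
        rw [integral_add hi1 hi2, integral_const_mul,
          integral_sub_left_eq_self (poissonKer (-z.im)) volume z.re, integral_poissonKer hy,
          integral_indicator measurableSet_Icc, setIntegral_const, mul_one]
        simp only [Measure.real, Real.volume_Icc, smul_eq_mul]
        rw [ENNReal.toReal_ofReal (by linarith)]
        ring
    _ < ε := by
        have h2 : 4 * C * (2 * N) / ε < d := by linarith
        rw [div_lt_iff₀ hε] at h2
        have h3 : 2 * N * (C * (1 / d)) < ε / 2 := by
          rw [mul_one_div, ← mul_div_assoc, div_lt_iff₀ hd]
          nlinarith [mul_nonneg hC0 hN0, mul_pos hε hd]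
        linarith

/-! ### Holomorphic extensions vanishing at infinity. -/

/-- The extension of `f` to the closed lower half plane by its Poisson integral. -/
def bdryExt (f : ℝ → ℂ) (z : ℂ) : ℂ := if z.im < 0 then poissonExt f z else f z.re

theorem bdryExt_of_mem (f : ℝ → ℂ) {z : ℂ} (hz : z ∈ lowerHalfPlane) :
    bdryExt f z = poissonExt f z := if_pos hz

theorem bdryExt_ofReal (f : ℝ → ℂ) (x : ℝ) : bdryExt f x = f x := by simp [bdryExt]

theorem bdryExt_fourierInv {F : ℝ → ℂ} (hF : Integrable F) :
    EqOn (bdryExt (𝓕⁻ F)) (symbolExt F) (closure lowerHalfPlane) := by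
  intro z hz
  rw [closure_lowerHalfPlane] at hz
  rcases (show z.im ≤ 0 from hz).lt_or_eq with h | h
  · rw [bdryExt_of_mem _ h, poissonExt_fourierInv hF h]
  · have : z = (z.re : ℂ) := Complex.ext (by simp) (by simp [h])
    rw [this, bdryExt_ofReal, symbolExt_ofReal]

theorem Sob.continuousOn_bdryExt {f : ℝ → ℂ} (hf : Sob 1 f) :
    ContinuousOn (bdryExt f) (closure lowerHalfPlane) := by
  obtain ⟨M, F, hF, rfl⟩ := hf.exists_symbol
  exact (continuousOn_symbolExt (hF.integrable le_rfl)).congr (bdryExt_fourierInv (hF.integrable le_rfl))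

theorem Sob.bounded {f : ℝ → ℂ} (hf : Sob 1 f) : ∃ C : ℝ, ∀ x, ‖f x‖ ≤ C := by
  obtain ⟨C, hC⟩ := UnifSob.bounded le_rfl hf
  exact ⟨C, hC ()⟩

theorem Sob.tendsto_poissonExt {f : ℝ → ℂ} (hf : Sob 1 f) :
    Tendsto (poissonExt f) atInfty (𝓝 0) := by
  obtain ⟨C, hC⟩ := hf.bounded
  exact Muskat.tendsto_poissonExt hC (UnifSob.zero_at_infty hf ())

theorem eventually_mem_lowerHalfPlane : ∀ᶠ z in atInfty, z ∈ lowerHalfPlane :=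
  eventually_atInfty.2 ⟨0, fun _ hz _ => hz⟩

/-- `Φ` is a holomorphic function on the lower half plane which vanishes at infinity and has
continuous boundary values `φ`. -/
structure HardyExt (φ : ℝ → ℂ) (Φ : ℂ → ℂ) : Prop where
  continuousOn : ContinuousOn Φ (closure lowerHalfPlane)
  differentiableOn : DifferentiableOn ℂ Φ lowerHalfPlane
  tendsto : Tendsto Φ atInfty (𝓝 0)
  boundary : ∀ x : ℝ, Φ x = φ x

theorem Sob.hardyExt {f : ℝ → ℂ} (hf : Sob 1 f) (h : hilbert f = f) : HardyExt f (bdryExt f) where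
  continuousOn := hf.continuousOn_bdryExt
  differentiableOn := by
    obtain ⟨M, F, hF, rfl, hneg⟩ := hf.exists_symbol_of_hilbert_eq le_rfl h
    exact (differentiableOn_symbolExt (hF.integrable le_rfl) hneg).congr
      ((bdryExt_fourierInv (hF.integrable le_rfl)).mono subset_closure)
  tendsto := hf.tendsto_poissonExt.congr' (by
    filter_upwards [eventually_mem_lowerHalfPlane] with z hz
    rw [bdryExt_of_mem _ hz])
  boundary := bdryExt_ofReal f

namespace HardyExt

variable {φ ψ : ℝ → ℂ} {Φ Ψ : ℂ → ℂ}

theorem add (h : HardyExt φ Φ) (k : HardyExt ψ Ψ) :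
    HardyExt (fun x => φ x + ψ x) (fun z => Φ z + Ψ z) where
  continuousOn := h.1.add k.1
  differentiableOn := h.2.add k.2
  tendsto := by simpa using h.3.add k.3
  boundary x := by rw [h.4, k.4]

theorem sub (h : HardyExt φ Φ) (k : HardyExt ψ Ψ) :
    HardyExt (fun x => φ x - ψ x) (fun z => Φ z - Ψ z) where
  continuousOn := h.1.sub k.1
  differentiableOn := h.2.sub k.2
  tendsto := by simpa using h.3.sub k.3
  boundary x := by rw [h.4, k.4]

theorem mul (h : HardyExt φ Φ) (k : HardyExt ψ Ψ) :
    HardyExt (fun x => φ x * ψ x) (fun z => Φ z * Ψ z) where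
  continuousOn := h.1.mul k.1
  differentiableOn := h.2.mul k.2
  tendsto := by simpa using h.3.mul k.3
  boundary x := by rw [h.4, k.4]

theorem const_mul (h : HardyExt φ Φ) (c : ℂ) :
    HardyExt (fun x => c * φ x) (fun z => c * Φ z) where
  continuousOn := continuousOn_const.mul h.1
  differentiableOn := h.2.const_mul c
  tendsto := by simpa using h.3.const_mul c
  boundary x := by rw [h.4]

theorem exp (h : HardyExt φ Φ) :
    HardyExt (fun x => Complex.exp (φ x) - 1) (fun z => Complex.exp (Φ z) - 1) where
  continuousOn := (Complex.continuous_exp.comp_continuousOn h.1).sub continuousOn_const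
  differentiableOn := h.2.cexp.sub_const 1
  tendsto := by
    simpa [Function.comp_def] using ((Complex.continuous_exp.tendsto _).comp h.3).sub_const 1
  boundary x := by rw [h.4]

/-- Boundary values in the Sobolev space are fixed by the Hilbert transform. -/
theorem hilbert_eq (h : HardyExt φ Φ) (hφ : Sob 1 φ) : hilbert φ = φ := by
  have hH : Sob 1 (hilbert φ) := UnifSob.hilbert le_rfl hφ
  have hp : Sob 1 fun x => φ x - hilbert φ x := UnifSob.sub le_rfl hφ hH
  have hm : Sob 1 fun x => φ x + hilbert φ x := UnifSob.add le_rfl hφ hH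
  have e1 : hilbert (fun x => φ x + hilbert φ x) = fun x => φ x + hilbert φ x := by
    rw [hilbert_add hφ hH, hilbert_hilbert hφ]; ext x; ring
  have e2 : hilbert (fun x => (starRingEnd ℂ) (φ x - hilbert φ x)) =
      fun x => (starRingEnd ℂ) (φ x - hilbert φ x) := by
    rw [hilbert_conj hp, hilbert_sub hφ hH, hilbert_hilbert hφ]
    ext x; rw [← map_neg]; congr 1; ring
  -- With `p = φ - ℍ φ`, both `p = 2φ - (φ + ℍ φ)` and `conj p` extend holomorphically, the latter
  -- because `ℍ p = -p`. Their product has the real boundary value `|p|²`, so it vanishes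
  -- identically.
  have key := ((h.add h).sub (hm.hardyExt e1)).mul (Sob.hardyExt (UnifSob.conj hp) e2)
  ext x
  have h0 := eq_zero_of_real_boundary key.1 key.2 (fun x => by
    rw [key.4]
    have : φ x + φ x - (φ x + hilbert φ x) = φ x - hilbert φ x := by ring
    rw [this, Complex.mul_conj, Complex.ofReal_im]) key.3 x (ofReal_mem_closure x)
  rw [key.4] at h0
  have : φ x + φ x - (φ x + hilbert φ x) = φ x - hilbert φ x := by ring
  rw [this, Complex.mul_conj] at h0
  have h1 : φ x - hilbert φ x = 0 := Complex.normSq_eq_zero.1 (by exact_mod_cast h0)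
  exact (sub_eq_zero.1 h1).symm

/-- A holomorphic function on the half plane is the Poisson integral of its boundary values. -/
theorem eq_poissonExt (h : HardyExt φ Φ) (hφ : Sob 1 φ) {z : ℂ} (hz : z ∈ lowerHalfPlane) :
    Φ z = poissonExt φ z := by
  have k := h.sub (hφ.hardyExt (h.hilbert_eq hφ))
  have := eq_of_boundary k.1 k.2 (fun x => by rw [k.4, sub_self]) k.3 hz
  rw [sub_eq_zero.1 this, bdryExt_of_mem _ hz]

end HardyExt

/-! ### Both evolution equations in terms of the logarithm `u`. -/

/-- `c² = e^{-2 Re u} = 1 / |e^u|²`. -/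
def cSq (u : ℝ → ℂ) (x : ℝ) : ℂ := Complex.exp (-(u x + (starRingEnd ℂ) (u x)))

/-- The drift `b = -i ℍ (c²)`. -/
def drift (u : ℝ → ℂ) : ℝ → ℂ := fun x => -Complex.I * hilbert (fun y => cSq u y - 1) x

/-- The right-hand side of the evolution equation `∂ₜ u = -rate u` for `u = log Z_{,α'}`. -/
def rate (u : ℝ → ℂ) (x : ℝ) : ℂ :=
  drift u x * deriv u x + Complex.I * cSq u x * (starRingEnd ℂ) (deriv u x) + deriv (drift u) x

/-- `i (I + ℍ) g`. -/
def logTransform (g : ℝ → ℝ) (x : ℝ) : ℂ :=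
  Complex.I * ((g x : ℂ) + hilbert (fun β => (g β : ℂ)) x)

section Unif

variable {ι : Type*} {s : ℝ} {u : ι → ℝ → ℂ}

theorem UnifSob.cSq (hs : 1 ≤ s) (hu : UnifSob s u) : UnifSob s fun i x => cSq (u i) x - 1 :=
  ((hu.add hs hu.conj).neg).exp hs

theorem UnifSob.drift (hs : 1 ≤ s) (hu : UnifSob s u) : UnifSob s fun i => drift (u i) :=
  ((hu.cSq hs).hilbert hs).const_mul (-Complex.I)

/-- Only first derivatives occur, so `H^2` control of `u` leaves the rate in the algebra `H^1`.
Writing `c² = (c² - 1) + 1` keeps every factor in a Sobolev class. -/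
theorem UnifSob.rate (hu : UnifSob 2 u) : UnifSob 1 fun i => rate (u i) := by
  have h1 : (1 : ℝ) ≤ 2 := by norm_num
  have e : (2 : ℝ) - 1 = 1 := by norm_num
  have hd : UnifSob 1 fun i => _root_.deriv (u i) := e ▸ hu.deriv le_rfl
  have hb := hu.drift h1
  have hb' : UnifSob 1 fun i => _root_.deriv (Muskat.drift (u i)) := e ▸ hb.deriv le_rfl
  have hc := ((hu.cSq h1).mono h1).mul le_rfl hd.conj
  have := (((hb.mono h1).mul le_rfl hd).add le_rfl
    ((hc.add le_rfl hd.conj).const_mul Complex.I)).add le_rfl hb'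
  convert this using 3 with i x
  unfold Muskat.rate
  ring

theorem UnifSob.logTransform {g : ι → ℝ → ℝ} (hs : 1 ≤ s) (hg : UnifSob s fun i x => (g i x : ℂ)) :
    UnifSob s fun i => logTransform (g i) :=
  (hg.add hs (hg.hilbert hs)).const_mul Complex.I

end Unif

section SingleTime

variable {u : ℝ → ℂ}

theorem one_le_two_real : (1 : ℝ) ≤ 2 := by norm_num

theorem Sob.deriv (hu : Sob 2 u) : Sob 1 (deriv u) := by
  have := UnifSob.deriv le_rfl hu
  norm_num at this
  exact this

theorem cSq_eq (u : ℝ → ℂ) (x : ℝ) : cSq u x = ((1 / ‖Complex.exp (u x)‖ ^ 2 : ℝ) : ℂ) := by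
  rw [cSq, Complex.add_conj, Complex.norm_exp, ← Real.exp_nat_mul, one_div, ← Real.exp_neg,
    Complex.ofReal_exp]
  push_cast; rfl

theorem cSq_eq_mul (u : ℝ → ℂ) (x : ℝ) :
    cSq u x = (starRingEnd ℂ) (Complex.exp (-u x)) * Complex.exp (-u x) := by
  rw [cSq, ← Complex.exp_conj, ← Complex.exp_add, map_neg]; congr 1; ring

theorem conj_cSq (u : ℝ → ℂ) (x : ℝ) : (starRingEnd ℂ) (cSq u x) = cSq u x := by
  rw [cSq_eq, Complex.conj_ofReal]

theorem conj_drift (hu : Sob 1 u) (x : ℝ) : (starRingEnd ℂ) (drift u x) = drift u x := by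
  have h : Sob 1 fun x => cSq u x - 1 := UnifSob.cSq le_rfl hu
  have h1 := congrFun (hilbert_conj h) x
  simp only [map_sub, map_one, conj_cSq] at h1
  simp only [drift, map_mul, map_neg, Complex.conj_I]
  rw [← neg_eq_iff_eq_neg.2 h1]
  ring

theorem conj_deriv {f : ℝ → ℂ} (hf : ∀ x, (starRingEnd ℂ) (f x) = f x) (x : ℝ) :
    (starRingEnd ℂ) (deriv f x) = deriv f x := by
  by_cases h : DifferentiableAt ℝ f x
  · have h1 : HasDerivAt (fun x => (starRingEnd ℂ) (f x)) ((starRingEnd ℂ) (deriv f x)) x :=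
      h.hasDerivAt.star
    simp only [hf] at h1
    exact h1.deriv.symm
  · rw [deriv_zero_of_not_differentiableAt h, map_zero]

theorem hasDerivAt_conj {f : ℝ → ℂ} {f' : ℂ} {x : ℝ} (h : HasDerivAt f f' x) :
    HasDerivAt (fun x => (starRingEnd ℂ) (f x)) ((starRingEnd ℂ) f') x := h.star

theorem hasDerivAt_cSq (hu : Sob 2 u) (x : ℝ) : HasDerivAt (cSq u)
    (-(deriv u x + (starRingEnd ℂ) (deriv u x)) * cSq u x) x := by
  have h : HasDerivAt (fun x => -(u x + (starRingEnd ℂ) (u x)))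
      (-(deriv u x + (starRingEnd ℂ) (deriv u x))) x :=
    ((hu.hasDerivAt x).add (hasDerivAt_conj (hu.hasDerivAt x))).neg
  rw [mul_comm]
  exact h.cexp

theorem ofReal_im_eq (z : ℂ) : (z.im : ℂ) = -Complex.I / 2 * (z - (starRingEnd ℂ) z) := by
  rw [Complex.sub_conj]; push_cast; linear_combination (z.im : ℂ) * Complex.I_sq

theorem hilbert_deriv_eq (hu : Sob 2 u) (h : hilbert u = u) : hilbert (deriv u) = deriv u := by
  rw [← deriv_hilbert hu, h]

theorem deriv_drift (hu : Sob 2 u) (x : ℝ) :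
    deriv (drift u) x = -Complex.I * hilbert (deriv (cSq u)) x := by
  have h : Sob 2 fun x => cSq u x - 1 := UnifSob.cSq one_le_two_real hu
  have h1 : Sob 2 (hilbert fun x => cSq u x - 1) := UnifSob.hilbert one_le_two_real h
  unfold drift
  rw [deriv_const_mul _ (h1.hasDerivAt x).differentiableAt, deriv_hilbert h]
  congr 2
  ext y
  rw [deriv_sub_const]

/-- The holomorphic part `b - i (c² - 1)` of the transport velocity. -/
def holVel (u : ℝ → ℂ) (x : ℝ) : ℂ := drift u x - Complex.I * (cSq u x - 1)

theorem sob_holVel {s : ℝ} (hs : 1 ≤ s) (hu : Sob s u) : Sob s (holVel u) :=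
  UnifSob.sub hs (UnifSob.drift hs hu) ((UnifSob.cSq hs hu).const_mul Complex.I)

/-- The function equals `-i (I + ℍ)(c² - 1)`, and `ℍ (I + ℍ) = I + ℍ`. -/
theorem hilbert_holVel (hu : Sob 1 u) : hilbert (holVel u) = holVel u := by
  have h : Sob 1 fun x => cSq u x - 1 := UnifSob.cSq le_rfl hu
  have hH : Sob 1 (hilbert fun x => cSq u x - 1) := UnifSob.hilbert le_rfl h
  unfold holVel drift
  rw [hilbert_sub (UnifSob.const_mul hH _) (UnifSob.const_mul h _), hilbert_const_mul hH,
    hilbert_const_mul h, hilbert_hilbert h]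
  ext x; ring

/-- Differentiating `c²` inside `holVel u` produces exactly the term `i c² conj u'`, so the
antiholomorphic contribution disappears from the right-hand side. -/
theorem rate_eq (hu : Sob 2 u) (x : ℝ) : rate u x =
    (holVel u x * deriv u x - Complex.I * deriv u x) + deriv (holVel u) x := by
  have h : deriv (holVel u) x = deriv (drift u) x -
      Complex.I * (-(deriv u x + (starRingEnd ℂ) (deriv u x)) * cSq u x) := by
    have h1 : Sob 2 (drift u) := UnifSob.drift one_le_two_real hu
    exact ((h1.hasDerivAt x).sub (((hasDerivAt_cSq hu x).sub_const 1).const_mul Complex.I)).deriv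
  rw [h, rate, holVel]
  ring

/-- All ingredients of `rate_eq` extend holomorphically, hence so does the rate. Consequently the
real or the imaginary part of `∂ₜ u = -rate u` determines the whole equation. -/
theorem hilbert_rate (hu : Sob 2 u) (h : hilbert u = u) : hilbert (rate u) = rate u := by
  have hr : Sob 1 (rate u) := UnifSob.rate hu
  have hu1 : Sob 1 u := UnifSob.mono hu one_le_two_real
  have hd := hu.deriv.hardyExt (hilbert_deriv_eq hu h)
  have hv := (sob_holVel le_rfl hu1).hardyExt (hilbert_holVel hu1)
  have hv2 := sob_holVel one_le_two_real hu
  have hv' := hv2.deriv.hardyExt (hilbert_deriv_eq hv2 (hilbert_holVel hu1))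
  have hI := Sob.hardyExt (UnifSob.const_mul hu.deriv Complex.I) (by
    rw [hilbert_const_mul hu.deriv, hilbert_deriv_eq hu h])
  have key := ((hv.mul hd).sub hI).add hv'
  have e : rate u = fun x => (holVel u x * deriv u x - Complex.I * deriv u x) + deriv (holVel u) x :=
    funext (rate_eq hu)
  rw [← e] at key
  exact key.hilbert_eq hr

variable {Z : ℝ → ℂ}

theorem bOf_eq (hu : Sob 1 u) (hZ : ∀ x, deriv Z x = Complex.exp (u x)) : bOf Z = drift u := by
  have h : Sob 1 fun x => cSq u x - 1 := UnifSob.cSq le_rfl hu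
  ext x
  rw [bOf, drift, ← hilbert_const_add h.continuous 1]
  congr 3
  ext y
  rw [hZ, ← cSq_eq, add_sub_cancel]

theorem invZα_eq (hZ : ∀ x, deriv Z x = Complex.exp (u x)) :
    invZα Z = fun x => Complex.exp (-u x) := by
  ext x; rw [invZα, hZ, Complex.exp_neg, one_div]

theorem hasDerivAt_invZα (hu : Sob 2 u) (hZ : ∀ x, deriv Z x = Complex.exp (u x)) (x : ℝ) :
    HasDerivAt (invZα Z) (-deriv u x * Complex.exp (-u x)) x := by
  rw [invZα_eq hZ, mul_comm]
  exact HasDerivAt.cexp (hu.hasDerivAt x).neg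

theorem hilbert_deriv_invZα (hu : Sob 2 u) (h : hilbert u = u)
    (hZ : ∀ x, deriv Z x = Complex.exp (u x)) :
    hilbert (deriv (invZα Z)) = deriv (invZα Z) := by
  have hu1 : Sob 1 u := UnifSob.mono hu one_le_two_real
  have hn : Sob 2 fun x => -u x := UnifSob.neg hu
  have hw : Sob 2 fun x => Complex.exp (-u x) - 1 := UnifSob.exp one_le_two_real hn
  have k := (Sob.hardyExt (UnifSob.neg hu1) (by rw [hilbert_neg hu1, h])).exp
  have e : deriv (invZα Z) = deriv fun x => Complex.exp (-u x) - 1 := by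
    ext x; rw [deriv_sub_const, invZα_eq hZ]
  rw [e]
  exact hilbert_deriv_eq hw (k.hilbert_eq (UnifSob.mono hw one_le_two_real))

/-- Put `f = c² u'`. Since `∂ (1/Z_{,α'})` is fixed by `ℍ`, the commutator is `-f + ℍ f`, and `b' =
-2 Im ℍ f` because `∂ (c²) = -(f + conj f)`. Therefore `B₁ = 2 Im f + b'`. -/
theorem B1Of_eq (hu : Sob 2 u) (h : hilbert u = u) (hZ : ∀ x, deriv Z x = Complex.exp (u x)) (x : ℝ) :
    (B1Of Z x : ℂ) = Complex.I * cSq u x * ((starRingEnd ℂ) (deriv u x) - deriv u x) +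
      deriv (drift u) x := by
  have hu1 : Sob 1 u := UnifSob.mono hu one_le_two_real
  have hc : Sob 1 fun x => cSq u x - 1 := UnifSob.cSq le_rfl hu1
  set f : ℝ → ℂ := fun x => cSq u x * deriv u x with hf
  have hfs : Sob 1 f := by
    have := UnifSob.add le_rfl (UnifSob.mul le_rfl hc hu.deriv) hu.deriv
    convert this using 3
    rw [hf]; ring
  have e1 : (fun β => (starRingEnd ℂ) (invZα Z β) * deriv (invZα Z) β) = fun x => -f x := by
    ext y
    rw [(hasDerivAt_invZα hu hZ y).deriv, invZα_eq hZ, hf]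
    beta_reduce
    rw [cSq_eq_mul]; ring
  have e2 : deriv (cSq u) = fun x => -(f x + (starRingEnd ℂ) (f x)) := by
    ext y
    rw [(hasDerivAt_cSq hu y).deriv, hf]
    beta_reduce
    rw [map_mul, conj_cSq]; ring
  have e3 := congrFun e1 x
  beta_reduce at e3
  rw [B1Of, hilbert_deriv_invZα hu h hZ, e1, hilbert_neg hfs, e3, deriv_drift hu, e2,
    hilbert_neg (UnifSob.add le_rfl hfs (UnifSob.conj hfs)), hilbert_add hfs (UnifSob.conj hfs),
    hilbert_conj hfs]
  push_cast
  rw [ofReal_im_eq]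
  simp only [map_sub, map_neg, hf, map_mul, conj_cSq]
  ring

/-- After division by `1/Z_{,α'} = e^{-u}` the term `i c² u'` from the right-hand side cancels the
one in `B₁`, leaving `i c² conj u'`. -/
theorem evolution_iff (hu : Sob 2 u) (h : hilbert u = u) (hZ : ∀ x, deriv Z x = Complex.exp (u x))
    (x : ℝ) (dt : ℂ) :
    dt + bOf Z x * deriv (invZα Z) x =
      -Complex.I * ((1 / ‖deriv Z x‖ ^ 2 : ℝ) : ℂ) * deriv (invZα Z) x + (B1Of Z x : ℂ) * invZα Z x ↔
    dt = rate u x * Complex.exp (-u x) := by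
  have hu1 : Sob 1 u := UnifSob.mono hu one_le_two_real
  rw [bOf_eq hu1 hZ, (hasDerivAt_invZα hu hZ x).deriv, B1Of_eq hu h hZ, hZ, ← cSq_eq, invZα_eq hZ,
    rate, ← eq_sub_iff_add_eq]
  refine eq_iff_eq_cancel_left.2 ?_ |> fun h => h
  ring

end SingleTime

section LogTransform

variable {g : ℝ → ℝ}

theorem hilbert_logTransform (hg : Sob 1 fun x => (g x : ℂ)) :
    hilbert (logTransform g) = logTransform g := by
  have hH : Sob 1 (hilbert fun x => (g x : ℂ)) := UnifSob.hilbert le_rfl hg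
  unfold logTransform
  rw [hilbert_const_mul (UnifSob.add le_rfl hg hH), hilbert_add hg hH, hilbert_hilbert hg]
  ext x; ring

theorem conj_hilbert_ofReal (hg : Sob 1 fun x => (g x : ℂ)) (x : ℝ) :
    (starRingEnd ℂ) (hilbert (fun β => (g β : ℂ)) x) = -hilbert (fun β => (g β : ℂ)) x := by
  have h := congrFun (hilbert_conj hg) x
  simp only [Complex.conj_ofReal] at h
  linear_combination h

theorem hilbert_ofReal_re (hg : Sob 1 fun x => (g x : ℂ)) (x : ℝ) :
    (hilbert (fun β => (g β : ℂ)) x).re = 0 := by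
  have h := congrArg Complex.re (conj_hilbert_ofReal hg x)
  simp only [Complex.conj_re, Complex.neg_re] at h
  linarith

theorem im_logTransform (hg : Sob 1 fun x => (g x : ℂ)) (x : ℝ) : (logTransform g x).im = g x := by
  simp [logTransform, hilbert_ofReal_re hg]

/-- From `ℍ u = u` and `ℍ (conj u) = -conj u` one gets `ℍ (Im u) = -i Re u`: a holomorphic boundary
value is recovered from its imaginary part. -/
theorem logTransform_im {u : ℝ → ℂ} (hu : Sob 1 u) (h : hilbert u = u) :
    logTransform (fun x => (u x).im) = u := by
  have e : (fun x => ((u x).im : ℂ)) = fun x => -Complex.I / 2 * (u x - (starRingEnd ℂ) (u x)) :=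
    funext fun x => ofReal_im_eq (u x)
  have hc : Sob 1 fun x => (starRingEnd ℂ) (u x) := UnifSob.conj hu
  have e2 : hilbert (fun x => ((u x).im : ℂ)) =
      fun x => -Complex.I / 2 * (u x + (starRingEnd ℂ) (u x)) := by
    rw [e, hilbert_const_mul (UnifSob.sub le_rfl hu hc), hilbert_sub hu hc, hilbert_conj hu, h]
    ext x; ring
  ext x
  rw [logTransform, e2, ofReal_im_eq]
  linear_combination (-u x) * Complex.I_sq

theorem cOf_sq (hg : Sob 1 fun x => (g x : ℂ)) (x : ℝ) : cOf g x ^ 2 = cSq (logTransform g) x := by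
  rw [cOf, cSq, ← Complex.exp_nat_mul, logTransform, map_mul, map_add, conj_hilbert_ofReal hg,
    Complex.conj_I, Complex.conj_ofReal]
  congr 1; push_cast; ring

theorem bStarOf_eq (hg : Sob 1 fun x => (g x : ℂ)) : bStarOf g = drift (logTransform g) := by
  have hu : Sob 1 (logTransform g) := UnifSob.logTransform le_rfl hg
  have h : Sob 1 fun x => cSq (logTransform g) x - 1 := UnifSob.cSq le_rfl hu
  ext x
  rw [bStarOf, drift, ← hilbert_const_add h.continuous 1]
  congr 3
  ext y
  rw [cOf_sq hg, add_sub_cancel]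

/-- As `Re u = i ℍ g` and `|∂| = i ∂ ℍ`, one has `|∂| g = Re u'`. The drift, its derivative and `c²`
are real, so the imaginary part of the rate is `b g' + c² |∂| g`. -/
theorem gEvolution_iff (hg : Sob 2 fun x => (g x : ℂ)) (x dt : ℝ) :
    (dt : ℂ) + bStarOf g x * ((deriv g x : ℝ) : ℂ) =
      -(cOf g x ^ 2) * absDeriv (fun β => (g β : ℂ)) x ↔
    dt = -(rate (logTransform g) x).im := by
  have hg1 : Sob 1 fun x => (g x : ℂ) := UnifSob.mono hg one_le_two_real
  set u := logTransform g with hu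
  have hus : Sob 2 u := UnifSob.logTransform one_le_two_real hg
  have hu1 : Sob 1 u := UnifSob.mono hus one_le_two_real
  have hH : Sob 2 (hilbert fun x => (g x : ℂ)) := UnifSob.hilbert one_le_two_real hg
  have hgd : HasDerivAt g (deriv u x).im x := by
    have h1 : HasDerivAt (fun x => (u x).im) (deriv u x).im x :=
      Complex.imCLM.hasFDerivAt.comp_hasDerivAt x (hus.hasDerivAt x)
    simpa only [hu, im_logTransform hg1] using h1
  have hgd' : deriv (fun x => (g x : ℂ)) x = ((deriv u x).im : ℂ) := hgd.ofReal_comp.deriv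
  have hud : deriv u x = Complex.I * (((deriv u x).im : ℂ) + deriv (hilbert fun x => (g x : ℂ)) x) := by
    rw [← hgd']
    exact (((hg.hasDerivAt x).add (hH.hasDerivAt x)).const_mul Complex.I).deriv
  have habs : absDeriv (fun β => (g β : ℂ)) x = ((deriv u x).re : ℂ) := by
    rw [absDeriv_eq hg]
    have := Complex.re_add_im (deriv u x)
    linear_combination -hud - this
  rw [cOf_sq hg1, bStarOf_eq hg1, habs, hgd.deriv]
  have hb := Complex.conj_eq_iff_im.1 (conj_drift hu1 x)
  have hb' := Complex.conj_eq_iff_im.1 (conj_deriv (conj_drift hu1) x)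
  have hc := Complex.conj_eq_iff_im.1 (conj_cSq u x)
  have hr : (rate u x).im = (drift u x).re * (deriv u x).im + (cSq u x).re * (deriv u x).re := by
    simp [rate, hb, hb', hc]
  have eb : drift u x = ((drift u x).re : ℂ) := Complex.ext (by simp) (by simp [hb])
  have ec : cSq u x = ((cSq u x).re : ℂ) := Complex.ext (by simp) (by simp [hc])
  rw [hr, ← hu, eb, ec]
  norm_cast
  constructor <;> intro h <;> linarith

end LogTransform

/-! ### From the Riemann mapping system to the `g`-system. -/

theorem UnifSob.eLpNorm_le {ι : Type*} {s : ℝ} {f : ι → ℝ → ℂ} (hs : 1 ≤ s) (hf : UnifSob s f) :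
    ∃ C : ℝ≥0, ∀ i, eLpNorm (f i) 2 volume ≤ C := by
  obtain ⟨C, hC⟩ := hf.sobolevNorm_le hs
  refine ⟨C, fun i => le_trans ?_ (hC i)⟩
  rw [← eLpNorm_fourierL2 (hf.memLp hs i), sobolevNorm]
  refine eLpNorm_mono fun η => ?_
  rw [norm_mul, Complex.norm_real]
  refine le_mul_of_one_le_left (norm_nonneg _) ?_
  refine le_trans ?_ (le_abs_self _)
  exact Real.one_le_rpow (le_add_of_nonneg_right (sq_nonneg _)) (by linarith)

/-- Dividing by `f t` brings the value at `t` to `1`, inside the slit plane, so the principal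
logarithm may be differentiated there; its real part is globally the logarithm of the modulus. -/
theorem hasDerivWithinAt_log_norm {f : ℝ → ℂ} {f' : ℂ} {S : Set ℝ} {t : ℝ} (ht : t ∈ S)
    (h0 : ∀ τ ∈ S, f τ ≠ 0) (hf : HasDerivWithinAt f f' S t) :
    HasDerivWithinAt (fun τ => Real.log ‖f τ‖) (f' / f t).re S t := by
  have h1 : HasDerivWithinAt (fun τ => Complex.log (f τ / f t)) (f' / f t / (f t / f t)) S t :=
    (hf.div_const (f t)).clog_real (by rw [div_self (h0 t ht)]; exact Complex.one_mem_slitPlane)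
  rw [div_self (h0 t ht), div_one] at h1
  have h2 : HasDerivWithinAt (fun τ => (Complex.log (f τ / f t)).re + Real.log ‖f t‖)
      (f' / f t).re S t :=
    (Complex.reCLM.hasFDerivAt.comp_hasDerivWithinAt t h1).add_const _
  have e : ∀ τ ∈ S, Real.log ‖f τ‖ = (Complex.log (f τ / f t)).re + Real.log ‖f t‖ := fun τ hτ => by
    rw [Complex.log_re, norm_div, Real.log_div (norm_ne_zero_iff.2 (h0 τ hτ))
      (norm_ne_zero_iff.2 (h0 t ht)), sub_add_cancel]
  exact h2.congr e (e t ht)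

/-- `log |w| ≤ |w - 1|` bounds the logarithm from above, and the same inequality for `1/w` from
below. It converts the two `L²` hypotheses into an `L²` bound on the logarithm. -/
theorem abs_log_norm_le {w : ℂ} (h : w ≠ 0) : |Real.log ‖w‖| ≤ ‖w - 1‖ + ‖1 / w - 1‖ := by
  have key : ∀ {w : ℂ}, w ≠ 0 → Real.log ‖w‖ ≤ ‖w - 1‖ := fun {w} hw => by
    have h1 := Real.log_le_sub_one_of_pos (norm_pos_iff.2 hw)
    have h2 := norm_sub_norm_le w 1
    rw [norm_one] at h2
    exact h1.trans h2
  have h1 := key h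
  have h2 := key (one_div_ne_zero h)
  rw [norm_div, norm_one, one_div, Real.log_inv] at h2
  rw [abs_le]
  constructor <;> linarith [norm_nonneg (w - 1), norm_nonneg (1 / w - 1)]

/-- The boundary value of the logarithm of a nonvanishing holomorphic function with boundary
value `W`. -/
def logBdry (W : ℝ → ℂ) (x : ℝ) : ℂ :=
  (Real.log ‖W x‖ : ℂ) + hilbert (fun y => (Real.log ‖W y‖ : ℂ)) x

/-- The derivative is `Re (W'/W)`, where `W'/W = W' (1/W - 1) + W'` lies in the algebra `H^{s-1}`;
the `L²` bound comes from `abs_log_norm_le`. -/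
theorem unifSob_log_norm {ι : Type*} {s : ℝ} {W : ι → ℝ → ℂ} (hs : 2 ≤ s)
    (h0 : ∀ i x, W i x ≠ 0) (hp : UnifSob s fun i x => W i x - 1)
    (hr : UnifSob s fun i x => 1 / W i x - 1) :
    UnifSob s fun i x => (Real.log ‖W i x‖ : ℂ) := by
  have hs1 : 1 ≤ s := by linarith
  have hs2 : 1 ≤ s - 1 := by linarith
  obtain ⟨C, hC⟩ := hp.eLpNorm_le hs1
  obtain ⟨D, hD⟩ := hr.eLpNorm_le hs1
  have hp' := hp.deriv hs
  have hd : ∀ i x, HasDerivAt (fun x => (Real.log ‖W i x‖ : ℂ))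
      (((deriv (fun x => W i x - 1) x * (1 / W i x - 1) + deriv (fun x => W i x - 1) x).re : ℝ) : ℂ)
      x := fun i x => by
    have h1 : HasDerivAt (W i) (deriv (fun x => W i x - 1) x) x := by
      simpa using (hp.hasDerivAt hs i x).add_const 1
    have h2 := hasDerivWithinAt_log_norm (mem_univ x) (fun y _ => h0 i y) h1.hasDerivWithinAt
    rw [hasDerivWithinAt_univ] at h2
    convert h2.ofReal_comp using 3
    ring
  have hm : ∀ i, AEStronglyMeasurable (fun x => (Real.log ‖W i x‖ : ℂ)) volume := fun i =>
    (continuous_iff_continuousAt.2 fun x => (hd i x).continuousAt).aestronglyMeasurable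
  have hle : ∀ i, eLpNorm (fun x => (Real.log ‖W i x‖ : ℂ)) 2 volume ≤ (C + D : ℝ≥0) := fun i => by
    have hmp := (hp.memLp hs1 i).1.norm
    have hmr := (hr.memLp hs1 i).1.norm
    calc _ ≤ eLpNorm ((fun x => ‖W i x - 1‖) + fun x => ‖1 / W i x - 1‖) 2 volume := by
          refine eLpNorm_mono fun x => ?_
          rw [Complex.norm_real, Real.norm_eq_abs, Real.norm_eq_abs]
          exact (abs_log_norm_le (h0 i x)).trans (le_abs_self _)
      _ ≤ eLpNorm (fun x => ‖W i x - 1‖) 2 volume + eLpNorm (fun x => ‖1 / W i x - 1‖) 2 volume :=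
          eLpNorm_add_le hmp hmr (by norm_num)
      _ ≤ _ := by
          rw [eLpNorm_norm, eLpNorm_norm, ENNReal.coe_add]
          exact add_le_add (hC i) (hD i)
  exact UnifSob.of_hasDerivAt hs hd
    (((hp'.mul hs2 (hr.mono (by linarith))).add hs2 hp').re hs2)
    (fun i => ⟨hm i, (hle i).trans_lt ENNReal.coe_lt_top⟩) hle

theorem UnifSob.logBdry {ι : Type*} {s : ℝ} {W : ι → ℝ → ℂ} (hs : 1 ≤ s)
    (h : UnifSob s fun i x => (Real.log ‖W i x‖ : ℂ)) : UnifSob s fun i => logBdry (W i) :=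
  h.add hs (h.hilbert hs)

section

variable {W : ℝ → ℂ}

theorem hilbert_logBdry (h : Sob 1 fun x => (Real.log ‖W x‖ : ℂ)) :
    hilbert (logBdry W) = logBdry W := by
  unfold logBdry
  rw [hilbert_add h (UnifSob.hilbert le_rfl h), hilbert_hilbert h]
  ext x; ring

theorem logBdry_re (h : Sob 1 fun x => (Real.log ‖W x‖ : ℂ)) (x : ℝ) :
    (logBdry W x).re = Real.log ‖W x‖ := by
  rw [logBdry, Complex.add_re, hilbert_ofReal_re h, Complex.ofReal_re, add_zero]

/-- The extension of `W` divided by the exponential of the extension of `logBdry W` has no zeros,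
has modulus one on the line and tends to `1`, hence equals `1`. -/
theorem eq_exp_logBdry (h0 : ∀ x, W x ≠ 0) (hW : Sob 1 fun x => W x - 1)
    (h : Sob 1 fun x => (Real.log ‖W x‖ : ℂ)) (hd : DifferentiableOn ℂ (poissonExt W) lowerHalfPlane)
    (hne : ∀ z ∈ lowerHalfPlane, poissonExt W z ≠ 0) (hl : Tendsto (poissonExt W) atInfty (𝓝 1)) :
    (∀ x, W x = Complex.exp (logBdry W x)) ∧ IsLogExtension W (bdryExt (logBdry W)) := by
  have hu : Sob 1 (logBdry W) := UnifSob.logBdry le_rfl h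
  have hV := hu.hardyExt (hilbert_logBdry h)
  obtain ⟨C, hC⟩ := hW.bounded
  have eP : EqOn (bdryExt W) (fun z => 1 + bdryExt (fun x => W x - 1) z) (closure lowerHalfPlane) := by
    intro z _
    by_cases hz : z ∈ lowerHalfPlane
    · rw [bdryExt_of_mem _ hz]
      beta_reduce
      rw [bdryExt_of_mem _ hz, ← poissonExt_const_add hW.continuous hC 1 hz]
      simp
    · have hz' : ¬ z.im < 0 := hz
      simp [bdryExt, hz']
  have hPc : ContinuousOn (bdryExt W) (closure lowerHalfPlane) :=
    (continuousOn_const.add hW.continuousOn_bdryExt).congr eP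
  have key := eq_one_of_norm_boundary (f := fun z => bdryExt W z * Complex.exp (-bdryExt (logBdry W) z))
    (hPc.mul (Complex.continuous_exp.comp_continuousOn hV.1.neg))
    ((hd.congr fun z hz => bdryExt_of_mem _ hz).mul hV.2.neg.cexp)
    (fun z hz => by
      refine mul_ne_zero ?_ (Complex.exp_ne_zero _)
      by_cases hz : z ∈ lowerHalfPlane
      · rw [bdryExt_of_mem _ hz]; exact hne z hz
      · have hz' : ¬ z.im < 0 := hz
        simp [bdryExt, hz', h0])
    (fun x => by
      rw [bdryExt_ofReal, bdryExt_ofReal, norm_mul, Complex.norm_exp, Complex.neg_re, logBdry_re h,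
        Real.exp_neg, Real.exp_log (norm_pos_iff.2 (h0 x)),
        mul_inv_cancel₀ (norm_ne_zero_iff.2 (h0 x))])
    (by
      have h1 : Tendsto (bdryExt W) atInfty (𝓝 1) := hl.congr' (by
        filter_upwards [eventually_mem_lowerHalfPlane] with z hz
        rw [bdryExt_of_mem _ hz])
      have h2 := (Complex.continuous_exp.tendsto _).comp hV.3.neg
      simpa [Function.comp_def] using h1.mul h2)
  have hex : ∀ z ∈ closure lowerHalfPlane, Complex.exp (bdryExt (logBdry W) z) = bdryExt W z := by
    intro z hz
    have := key z hz
    rw [Complex.exp_neg, ← div_eq_mul_inv, div_eq_one_iff_eq (Complex.exp_ne_zero _)] at this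
    exact this.symm
  refine ⟨fun x => ?_, hV.1, fun z hz => ?_, hV.3⟩
  · have := hex x (ofReal_mem_closure x)
    rw [bdryExt_ofReal, bdryExt_ofReal] at this
    exact this.symm
  · rw [hex z (subset_closure hz), bdryExt_of_mem _ hz]

end

theorem IsLogExtension.eqOn {W : ℝ → ℂ} {ℓ ℓ' : ℂ → ℂ} (h : IsLogExtension W ℓ)
    (h' : IsLogExtension W ℓ') : EqOn ℓ ℓ' (closure lowerHalfPlane) :=
  eqOn_of_exp_eq h.1 h'.1 h.2.2 h'.2.2 fun z hz => (h.2.1 z hz).trans (h'.2.1 z hz).symm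

namespace RiemannMappingSolution

variable {s T : ℝ} {Z : ℝ → ℝ → ℂ}

theorem continuous_deriv (hZ : RiemannMappingSolution s T Z) {t : ℝ} (ht : t ∈ Icc 0 T) :
    Continuous (deriv (Z t)) :=
  (hZ.contDiff t ht).continuous_deriv le_rfl

theorem unifSob (hZ : RiemannMappingSolution s T Z) (hs : 1 ≤ s) :
    UnifSob s fun (t : Icc (0 : ℝ) T) x => deriv (Z t) x - 1 :=
  (inLinftyHs_iff hs fun _ ht => (hZ.continuous_deriv ht).sub continuous_const).1 hZ.regularity

theorem unifSob_inv (hZ : RiemannMappingSolution s T Z) (hs : 1 ≤ s) :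
    UnifSob s fun (t : Icc (0 : ℝ) T) x => 1 / deriv (Z t) x - 1 :=
  (inLinftyHs_iff hs fun t ht => (continuous_const.div (hZ.continuous_deriv ht)
    (hZ.deriv_ne_zero t ht)).sub continuous_const).1 hZ.regularity_inv

theorem unifSob_log (hZ : RiemannMappingSolution s T Z) (hs : 2 ≤ s) :
    UnifSob s fun (t : Icc (0 : ℝ) T) x => (Real.log ‖deriv (Z t) x‖ : ℂ) :=
  unifSob_log_norm hs (fun t => hZ.deriv_ne_zero t t.2) (hZ.unifSob (by linarith))
    (hZ.unifSob_inv (by linarith))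

theorem log_spec (hZ : RiemannMappingSolution s T Z) (hs : 2 ≤ s) {t : ℝ} (ht : t ∈ Icc 0 T) :
    (∀ x, deriv (Z t) x = Complex.exp (logBdry (deriv (Z t)) x)) ∧
      IsLogExtension (deriv (Z t)) (bdryExt (logBdry (deriv (Z t)))) :=
  eq_exp_logBdry (hZ.deriv_ne_zero t ht)
    (((hZ.unifSob (by linarith)).mono (by linarith)).apply ⟨t, ht⟩)
    (((hZ.unifSob_log hs).mono (by linarith)).apply ⟨t, ht⟩)
    (hZ.holomorphic t ht) (hZ.ext_ne_zero t ht) (hZ.ext_tendsto t ht)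

theorem isImLog (hZ : RiemannMappingSolution s T Z) (hs : 2 ≤ s) :
    IsImLog T Z fun t x => (logBdry (deriv (Z t)) x).im := fun t ht =>
  ⟨_, (hZ.log_spec hs ht).2, fun α => by rw [bdryExt_ofReal]⟩

theorem eq_of_isImLog (hZ : RiemannMappingSolution s T Z) (hs : 2 ≤ s) {g : ℝ → ℝ → ℝ}
    (hg : IsImLog T Z g) {t : ℝ} (ht : t ∈ Icc 0 T) :
    g t = fun x => (logBdry (deriv (Z t)) x).im := by
  obtain ⟨ℓ, hℓ, e⟩ := hg t ht
  ext x
  rw [e, hℓ.eqOn (hZ.log_spec hs ht).2 (ofReal_mem_closure x), bdryExt_ofReal]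

/-- The equation for `1/Z_{,α'}` yields the derivative of `log |Z_{,α'}|` without any choice of
branch. The argument is `Im ℍ log |Z_{,α'}|`, so its derivative follows by applying `ℍ`, and
`hilbert_rate` identifies the result. -/
theorem hasDerivWithinAt_im_log (hZ : RiemannMappingSolution s T Z) (hs : 2 ≤ s) {t : ℝ}
    (ht : t ∈ Icc 0 T) (α : ℝ) :
    HasDerivWithinAt (fun τ => (logBdry (deriv (Z τ)) α).im)
      (-(rate (logBdry (deriv (Z t))) α).im) (Icc 0 T) t := by
  have hL2 := (hZ.unifSob_log hs).mono hs
  have hL1 := hL2.mono one_le_two_real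
  have hu2 := hL2.logBdry one_le_two_real
  have hr := hu2.rate
  have hd : ∀ t ∈ Icc 0 T, ∀ x, HasDerivWithinAt (fun τ => (Real.log ‖deriv (Z τ) x‖ : ℂ))
      (-((rate (logBdry (deriv (Z t))) x).re : ℂ)) (Icc 0 T) t := fun t ht x => by
    obtain ⟨dt, h1, h2⟩ := hZ.evolution t ht x
    have hW := (hZ.log_spec hs ht).1
    rw [evolution_iff (hu2.apply ⟨t, ht⟩) (hilbert_logBdry (hL1.apply ⟨t, ht⟩)) hW] at h2
    have h3 := (hasDerivWithinAt_log_norm ht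
      (fun τ hτ => one_div_ne_zero (hZ.deriv_ne_zero τ hτ x)) h1).neg.ofReal_comp
    have e : dt / (1 / deriv (Z t) x) = rate (logBdry (deriv (Z t))) x := by
      rw [h2, hW x, one_div, ← Complex.exp_neg, mul_div_assoc, div_self (Complex.exp_ne_zero _), mul_one]
    rw [e, Complex.ofReal_neg] at h3
    exact h3.congr (fun τ _ => by simp) (by simp)
  have h1 := hasDerivWithinAt_hilbert hL1 (hr.re le_rfl).neg hd α ht
  have hrt : Sob 1 (rate (logBdry (deriv (Z t)))) := hr.apply ⟨t, ht⟩
  have hrc : Sob 1 fun x => (starRingEnd ℂ) (rate (logBdry (deriv (Z t))) x) := UnifSob.conj hrt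
  have hH := hilbert_rate (hu2.apply ⟨t, ht⟩) (hilbert_logBdry (hL1.apply ⟨t, ht⟩))
  have e : (fun x => -((rate (logBdry (deriv (Z t))) x).re : ℂ)) = fun x => -1 / 2 *
      (rate (logBdry (deriv (Z t))) x + (starRingEnd ℂ) (rate (logBdry (deriv (Z t))) x)) := by
    ext x; rw [Complex.add_conj]; push_cast; ring
  rw [e, hilbert_const_mul (UnifSob.add le_rfl hrt hrc), hilbert_add hrt hrc, hilbert_conj hrt, hH]
    at h1
  have h2 := Complex.imCLM.hasFDerivAt.comp_hasDerivWithinAt t h1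
  refine (h2.congr_deriv ?_).congr (fun τ _ => by simp [logBdry]) (by simp [logBdry])
  change (-1 / 2 * (rate (logBdry (deriv (Z t))) α +
    -(starRingEnd ℂ) (rate (logBdry (deriv (Z t))) α))).im = _
  rw [← sub_eq_add_neg, Complex.sub_conj]
  simp
  ring

theorem gSolution (hZ : RiemannMappingSolution s T Z) (hs : 2 ≤ s) {g : ℝ → ℝ → ℝ}
    (hg : IsImLog T Z g) : GSolution s T g ∧ IsExpTransform T g Z := by
  have hs1 : 1 ≤ s := by linarith
  have hL := hZ.unifSob_log hs
  have hL1 := hL.mono hs1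
  have hu := hL.logBdry hs1
  have e : ∀ t ∈ Icc 0 T, g t = fun x => (logBdry (deriv (Z t)) x).im := fun t ht =>
    hZ.eq_of_isImLog hs hg ht
  have hg' : UnifSob s fun (t : Icc (0 : ℝ) T) x => (g t x : ℂ) := by
    convert hu.im hs1 using 3 with t x
    rw [e t t.2]
  have hlog : ∀ t ∈ Icc 0 T, logTransform (g t) = logBdry (deriv (Z t)) := fun t ht => by
    rw [e t ht]
    exact logTransform_im ((hu.mono hs1).apply ⟨t, ht⟩) (hilbert_logBdry (hL1.apply ⟨t, ht⟩))
  have hgc : ∀ t ∈ Icc 0 T, Continuous (g t) := fun t ht => by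
    rw [e t ht]
    exact Complex.continuous_im.comp (hu.continuous hs1 ⟨t, ht⟩)
  refine ⟨⟨hgc, ?_, fun t ht α => ⟨-(rate (logTransform (g t)) α).im, ?_, ?_⟩⟩, fun t ht α => ?_⟩
  · exact (inLinftyHs_iff hs1 fun t ht => Complex.continuous_ofReal.comp (hgc t ht)).2 hg'
  · rw [hlog t ht]
    exact (hZ.hasDerivWithinAt_im_log hs ht α).congr (fun τ hτ => by rw [e τ hτ]) (by rw [e t ht])
  · exact (gEvolution_iff ((hg'.mono hs).apply ⟨t, ht⟩) α _).2 rfl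
  · rw [(hZ.log_spec hs ht).1 α, ← hlog t ht]
    rfl

end RiemannMappingSolution

/-! ### Holomorphic primitives on the half plane. -/

theorem norm_exp_sub_one_le_of_re_nonpos {w : ℂ} (hw : w.re ≤ 0) : ‖Complex.exp w - 1‖ ≤ ‖w‖ := by
  have h := (convex_halfSpace_re_le 0).norm_image_sub_le_of_norm_hasDerivWithin_le (C := 1)
    (f := Complex.exp) (f' := Complex.exp) (x := 0) (y := w)
    (fun z _ => (Complex.hasDerivAt_exp z).hasDerivWithinAt)
    (fun z hz => by rw [Complex.norm_exp, Real.exp_le_one_iff]; exact hz) (by simp) hw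
  simpa using h

section ExpPrimitive

variable {F : ℝ → ℂ}

theorem norm_exp_mul_le (hneg : ∀ η, 0 < η → F η = 0) {z : ℂ} (hz : z.im ≤ 0) (η : ℝ) :
    ‖Complex.exp (2 * π * Complex.I * η * z) * (2 * π * Complex.I * η * F η)‖ ≤
      ‖2 * π * Complex.I * η * F η‖ := by
  rcases le_or_gt η 0 with h | h
  · rw [norm_mul]
    refine mul_le_of_le_one_left (norm_nonneg _) ?_
    rw [Complex.norm_exp, Real.exp_le_one_iff]
    have : 0 ≤ η * z.im := mul_nonneg_of_nonpos_of_nonpos h hz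
    have e : (2 * π * Complex.I * η * z).re = -(2 * π * (η * z.im)) := by simp; ring
    rw [e]
    have := Real.pi_pos
    nlinarith
  · simp [hneg η h]

/-- Subtracting `1` from the exponential gains a factor `η`, so only `η F` has to be integrable;
`F`, obtained from a symbol by division by `2πiη`, may be singular at `η = 0`. -/
theorem norm_exp_sub_one_mul_le (hneg : ∀ η, 0 < η → F η = 0) {z : ℂ} (hz : z.im ≤ 0) (η : ℝ) :
    ‖(Complex.exp (2 * π * Complex.I * η * z) - 1) * F η‖ ≤ ‖z‖ * ‖2 * π * Complex.I * η * F η‖ := by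
  rcases le_or_gt η 0 with h | h
  · have : 0 ≤ η * z.im := mul_nonneg_of_nonpos_of_nonpos h hz
    have e : (2 * π * Complex.I * η * z).re = -(2 * π * (η * z.im)) := by simp; ring
    have h1 := norm_exp_sub_one_le_of_re_nonpos (w := 2 * π * Complex.I * η * z) (by
      rw [e]
      have := Real.pi_pos
      nlinarith)
    rw [norm_mul]
    calc _ ≤ ‖2 * π * Complex.I * η * z‖ * ‖F η‖ := by gcongr
      _ = _ := by rw [norm_mul _ z, norm_mul _ (F η)]; ring
  · simp [hneg η h]

/-- A holomorphic function on the half plane whose derivative has symbol `2πiη F(η)`. -/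
def expPrim (F : ℝ → ℂ) (z : ℂ) : ℂ := ∫ η : ℝ, (Complex.exp (2 * π * Complex.I * η * z) - 1) * F η

theorem aestronglyMeasurable_expPrim (hm : Measurable F) (z : ℂ) : AEStronglyMeasurable
    (fun η : ℝ => (Complex.exp (2 * π * Complex.I * η * z) - 1) * F η) volume :=
  AEStronglyMeasurable.mul (Continuous.aestronglyMeasurable (by fun_prop)) hm.aestronglyMeasurable

theorem hasDerivAt_exp_sub_one_mul (F : ℝ → ℂ) (η : ℝ) (z : ℂ) :
    HasDerivAt (fun z : ℂ => (Complex.exp (2 * π * Complex.I * η * z) - 1) * F η)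
      (Complex.exp (2 * π * Complex.I * η * z) * (2 * π * Complex.I * η * F η)) z := by
  have h := ((((hasDerivAt_id z).const_mul (2 * π * Complex.I * η : ℂ)).cexp).sub_const 1).mul_const
    (F η)
  refine h.congr_deriv ?_
  simp only [id, mul_one]
  ring

theorem hasDerivAt_expPrim (hm : Measurable F) (hE : Integrable fun η : ℝ => 2 * π * Complex.I * η * F η)
    (hneg : ∀ η, 0 < η → F η = 0) {z : ℂ} (hz : z ∈ lowerHalfPlane) :
    HasDerivAt (expPrim F) (symbolExt (fun η : ℝ => 2 * π * Complex.I * η * F η) z) z := by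
  rw [symbolExt_eq fun η hη => by simp [hneg η hη]]
  exact (hasDerivAt_integral_of_dominated_loc_of_deriv_le (μ := volume)
    (bound := fun η => ‖2 * π * Complex.I * η * F η‖)
    (isOpen_lowerHalfPlane.mem_nhds hz)
    (Eventually.of_forall (aestronglyMeasurable_expPrim hm))
    ((hE.norm.const_mul ‖z‖).mono' (aestronglyMeasurable_expPrim hm z)
      (Eventually.of_forall (norm_exp_sub_one_mul_le hneg (le_of_lt hz))))
    (AEStronglyMeasurable.mul (Continuous.aestronglyMeasurable (by fun_prop)) hE.1)
    (Eventually.of_forall fun η w hw => norm_exp_mul_le hneg (le_of_lt hw) η) hE.norm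
    (Eventually.of_forall fun η w _ => hasDerivAt_exp_sub_one_mul F η w)).2

theorem hasDerivAt_expPrim_ofReal (hm : Measurable F)
    (hE : Integrable fun η : ℝ => 2 * π * Complex.I * η * F η)
    (hneg : ∀ η, 0 < η → F η = 0) (x : ℝ) :
    HasDerivAt (fun x : ℝ => expPrim F x) (𝓕⁻ (fun η : ℝ => 2 * π * Complex.I * η * F η) x) x := by
  rw [fourierInv_eq_integral]
  exact (hasDerivAt_integral_of_dominated_loc_of_deriv_le (μ := volume)
    (F := fun (x η : ℝ) => (Complex.exp (2 * π * Complex.I * η * x) - 1) * F η)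
    (F' := fun (x η : ℝ) => Complex.exp (2 * π * Complex.I * η * x) * (2 * π * Complex.I * η * F η))
    (bound := fun η => ‖2 * π * Complex.I * η * F η‖) univ_mem
    (Eventually.of_forall fun x => aestronglyMeasurable_expPrim hm x)
    ((hE.norm.const_mul ‖(x : ℂ)‖).mono' (aestronglyMeasurable_expPrim hm x)
      (Eventually.of_forall (norm_exp_sub_one_mul_le hneg (by simp))))
    (AEStronglyMeasurable.mul (Continuous.aestronglyMeasurable (by fun_prop)) hE.1)
    (Eventually.of_forall fun η w _ => norm_exp_mul_le hneg (by simp) η) hE.norm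
    (Eventually.of_forall fun η w _ => (hasDerivAt_exp_sub_one_mul F η w).comp_ofReal)).2

theorem continuousOn_expPrim (hm : Measurable F)
    (hE : Integrable fun η : ℝ => 2 * π * Complex.I * η * F η)
    (hneg : ∀ η, 0 < η → F η = 0) : ContinuousOn (expPrim F) (closure lowerHalfPlane) := by
  intro z _
  refine continuousWithinAt_of_dominated
    (bound := fun η => (‖z‖ + 1) * ‖2 * π * Complex.I * η * F η‖)
    (F := fun (z : ℂ) (η : ℝ) => (Complex.exp (2 * π * Complex.I * η * z) - 1) * F η)
    (Eventually.of_forall fun w => aestronglyMeasurable_expPrim hm w) ?_ (hE.norm.const_mul _)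
    (Eventually.of_forall fun η => (hasDerivAt_exp_sub_one_mul F η z).continuousAt.continuousWithinAt)
  have hn : ∀ᶠ w in 𝓝[closure lowerHalfPlane] z, ‖w‖ ≤ ‖z‖ + 1 :=
    (continuous_norm.continuousAt.continuousWithinAt.eventually_lt_const (lt_add_one _)).mono
      fun _ => le_of_lt
  filter_upwards [self_mem_nhdsWithin, hn] with w hw hw'
  rw [closure_lowerHalfPlane] at hw
  refine Eventually.of_forall fun η => (norm_exp_sub_one_mul_le hneg hw η).trans ?_
  gcongr

end ExpPrimitive

theorem Sob.hasDerivAt_bdryExt {f : ℝ → ℂ} (hf : Sob 2 f) (h : hilbert f = f) {z : ℂ}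
    (hz : z ∈ lowerHalfPlane) : HasDerivAt (bdryExt f) (bdryExt (_root_.deriv f) z) z := by
  obtain ⟨M, F, hF, rfl, hneg⟩ := hf.exists_symbol_of_hilbert_eq one_le_two_real h
  have hi := hF.integrable one_le_two_real
  have hE := hF.deriv.integrable (by norm_num)
  have e : _root_.deriv (𝓕⁻ F) = 𝓕⁻ (fun η : ℝ => 2 * π * Complex.I * η * F η) :=
    funext fun x => (hF.hasDerivAt le_rfl x).deriv
  rw [e, bdryExt_fourierInv hE (subset_closure hz)]
  have h1 := (hasDerivAt_expPrim hF.1 hE hneg hz).add_const (∫ η, F η)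
  refine h1.congr_of_eventuallyEq ?_
  filter_upwards [isOpen_lowerHalfPlane.mem_nhds hz] with w hw
  rw [bdryExt_fourierInv hi (subset_closure hw), symbolExt_eq hneg, expPrim]
  have hi2 : Integrable fun η : ℝ => (Complex.exp (2 * π * Complex.I * η * w) - 1) * F η :=
    (hE.norm.const_mul ‖w‖).mono' (aestronglyMeasurable_expPrim hF.1 w)
      (Eventually.of_forall (norm_exp_sub_one_mul_le hneg (le_of_lt hw)))
  rw [← integral_add hi2 hi]
  refine integral_congr_ae (Eventually.of_forall fun η => ?_)
  ring

/-- Holomorphic functions with boundary values in the Sobolev space have a primitive which is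
differentiable along the boundary. -/
theorem Sob.exists_primitive {f : ℝ → ℂ} (hf : Sob 1 f) (h : hilbert f = f) :
    ∃ G : ℂ → ℂ, ContinuousOn G (closure lowerHalfPlane) ∧
      (∀ z ∈ lowerHalfPlane, HasDerivAt G (bdryExt f z) z) ∧
      (∀ x : ℝ, HasDerivAt (fun x : ℝ => G x) (f x) x) ∧ G 0 = 0 := by
  obtain ⟨M, E, hE, rfl, hneg⟩ := hf.exists_symbol_of_hilbert_eq le_rfl h
  have hi := hE.integrable le_rfl
  set F : ℝ → ℂ := fun η => E η / (2 * π * Complex.I * η) with hF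
  have hm : Measurable F :=
    hE.1.div (Measurable.const_mul (Complex.measurable_ofReal) _)
  have hn : ∀ η, 0 < η → F η = 0 := fun η hη => by simp [hF, hneg η hη]
  have ae : (fun η : ℝ => 2 * π * Complex.I * η * F η) =ᵐ[volume] E := by
    filter_upwards [compl_mem_ae_iff.2 (measure_singleton (0 : ℝ))] with η hη
    have h1 : (2 * π * Complex.I * η : ℂ) ≠ 0 := by
      have h0 : (η : ℂ) ≠ 0 := by simpa using hη
      have := Complex.I_ne_zero
      have hp : (π : ℂ) ≠ 0 := by simp
      simp [h0, this, hp]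
    exact mul_div_cancel₀ _ h1
  have hi' := hi.congr ae.symm
  refine ⟨expPrim F, continuousOn_expPrim hm hi' hn, fun z hz => ?_, fun x => ?_, by simp [expPrim]⟩
  · rw [bdryExt_fourierInv hi (subset_closure hz)]
    convert hasDerivAt_expPrim hm hi' hn hz using 1
    refine integral_congr_ae ?_
    filter_upwards [ae] with η hη
    rw [hη]
  · rw [← fourierInv_congr ae x]
    exact hasDerivAt_expPrim_ofReal hm hi' hn x

theorem smul_mem_closure {z : ℂ} (hz : z ∈ lowerHalfPlane) {r : ℝ} (hr : 0 ≤ r) :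
    (r : ℂ) * z ∈ closure lowerHalfPlane := by
  rw [closure_lowerHalfPlane]
  have : z.im < 0 := hz
  simp only [mem_ofPred_eq, Complex.mul_im, Complex.ofReal_re, Complex.ofReal_im, zero_mul, add_zero]
  nlinarith

theorem smul_mem_lowerHalfPlane {z : ℂ} (hz : z ∈ lowerHalfPlane) {r : ℝ} (hr : 0 < r) :
    (r : ℂ) * z ∈ lowerHalfPlane := by
  have : z.im < 0 := hz
  simp only [mem_lowerHalfPlane, Complex.mul_im, Complex.ofReal_re, Complex.ofReal_im, zero_mul,
    add_zero]
  nlinarith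

theorem continuousOn_segment {f : ℂ → ℂ} (hf : ContinuousOn f (closure lowerHalfPlane)) {z : ℂ}
    (hz : z ∈ lowerHalfPlane) : ContinuousOn (fun r : ℝ => f (r * z)) (Icc 0 1) :=
  hf.comp (by fun_prop) fun _ hr => smul_mem_closure hz hr.1

/-- The fundamental theorem of calculus along a segment from the origin. -/
theorem integral_segment {f f' : ℂ → ℂ} (hf : ContinuousOn f (closure lowerHalfPlane))
    (hf' : ContinuousOn f' (closure lowerHalfPlane))
    (hd : ∀ z ∈ lowerHalfPlane, HasDerivAt f (f' z) z) {z : ℂ} (hz : z ∈ lowerHalfPlane) :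
    z * ∫ r in Ioc (0 : ℝ) 1, f' (r * z) = f z - f 0 := by
  have h := intervalIntegral.integral_eq_sub_of_hasDerivAt_of_le zero_le_one
    (f := fun r : ℝ => f (r * z)) (f' := fun r : ℝ => f' (r * z) * z) (continuousOn_segment hf hz)
    (fun r hr => by
      have h1 : HasDerivAt (fun r : ℝ => (r : ℂ) * z) z r := by
        simpa using (Complex.ofRealCLM.hasDerivAt (x := r)).mul_const z
      exact (hd _ (smul_mem_lowerHalfPlane hz hr.1)).comp r h1)
    (by
      refine ContinuousOn.intervalIntegrable ?_
      rw [uIcc_of_le zero_le_one]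
      exact (continuousOn_segment hf' hz).mul continuousOn_const)
  rw [intervalIntegral.integral_mul_const, intervalIntegral.integral_of_le zero_le_one] at h
  simpa [mul_comm] using h

theorem norm_bdryExt_le {f : ℝ → ℂ} {C : ℝ} (hC : ∀ x, ‖f x‖ ≤ C) (z : ℂ) : ‖bdryExt f z‖ ≤ C := by
  by_cases hz : z.im < 0
  · rw [bdryExt, if_pos hz]
    have hy : 0 < -z.im := neg_pos.2 hz
    have hi := ((integrable_poissonKer hy).comp_sub_left z.re).mul_const C
    refine (norm_integral_le_of_norm_le hi (Eventually.of_forall fun β => ?_)).trans (le_of_eq ?_)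
    · rw [norm_mul, Complex.norm_real, Real.norm_of_nonneg (poissonKer_nonneg hy _)]
      exact mul_le_mul_of_nonneg_left (hC β) (poissonKer_nonneg hy _)
    · rw [integral_mul_const, integral_sub_left_eq_self (poissonKer (-z.im)) volume z.re,
        integral_poissonKer hy, one_mul]
  · rw [bdryExt, if_neg hz]
    exact hC _

theorem bdryExt_neg (f : ℝ → ℂ) (z : ℂ) : bdryExt (fun x => -f x) z = -bdryExt f z := by
  unfold bdryExt poissonExt
  split_ifs
  · simp only [mul_neg, integral_neg]
  · rfl

theorem hasDerivWithinAt_bdryExt {T C : ℝ} {f f' : ℝ → ℝ → ℂ}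
    (hf : UnifSob 1 fun t : Icc (0 : ℝ) T => f t) (hC : ∀ t ∈ Icc 0 T, ∀ x, ‖f' t x‖ ≤ C)
    (hd : ∀ t ∈ Icc 0 T, ∀ x, HasDerivWithinAt (fun τ => f τ x) (f' t x) (Icc 0 T) t) (z : ℂ) {t : ℝ}
    (ht : t ∈ Icc 0 T) :
    HasDerivWithinAt (fun τ => bdryExt (f τ) z) (bdryExt (f' t) z) (Icc 0 T) t := by
  unfold bdryExt
  split_ifs with hz
  · have hy : 0 < -z.im := neg_pos.2 hz
    obtain ⟨D, hD⟩ := hf.bounded le_rfl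
    exact hasDerivWithinAt_integral_mul (integrable_poissonKer_sub hy z.re) hd hC
      (fun t ht => integrable_poissonKer_mul (hf.continuous le_rfl ⟨t, ht⟩) (hD ⟨t, ht⟩) hy _) ht
  · exact hd t ht _

theorem exists_hasDerivWithinAt_Icc {T : ℝ} (hT : 0 ≤ T) {A : ℝ → ℂ} (hA : ContinuousOn A (Icc 0 T)) :
    ∃ a : ℝ → ℂ, ∀ t ∈ Icc 0 T, HasDerivWithinAt a (A t) (Icc 0 T) t := by
  have hc : Continuous (IccExtend hT ((Icc 0 T).domRestrict A)) :=
    (continuousOn_iff_continuous_domRestrict.1 hA).Icc_extend'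
  refine ⟨fun t => ∫ r in (0 : ℝ)..t, IccExtend hT ((Icc 0 T).domRestrict A) r, fun t ht => ?_⟩
  have h := (hc.integral_hasStrictDerivAt 0 t).hasDerivAt.hasDerivWithinAt (s := Icc 0 T)
  rwa [IccExtend_of_mem hT _ ht] at h

/-! ### From the `g`-system to the Riemann mapping system. -/

namespace GSolution

variable {s T : ℝ} {g : ℝ → ℝ → ℝ}

theorem unifSob (hg : GSolution s T g) (hs : 1 ≤ s) :
    UnifSob s fun (t : Icc (0 : ℝ) T) x => (g t x : ℂ) :=
  (inLinftyHs_iff hs fun t ht => Complex.continuous_ofReal.comp (hg.continuous t ht)).1 hg.regularity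

theorem unifSob_logTransform (hg : GSolution s T g) (hs : 1 ≤ s) :
    UnifSob s fun t : Icc (0 : ℝ) T => logTransform (g t) := (hg.unifSob hs).logTransform hs

theorem hilbert_logTransform (hg : GSolution s T g) (hs : 1 ≤ s) {t : ℝ} (ht : t ∈ Icc 0 T) :
    hilbert (logTransform (g t)) = logTransform (g t) :=
  Muskat.hilbert_logTransform (((hg.unifSob hs).mono hs).apply ⟨t, ht⟩)

theorem unifSob_rate (hg : GSolution s T g) (hs : 2 ≤ s) :
    UnifSob 1 fun t : Icc (0 : ℝ) T => rate (logTransform (g t)) :=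
  ((hg.unifSob_logTransform (by linarith)).mono hs).rate

/-- The equation for `g` is the imaginary part; `ℍ` supplies the real part, and `logTransform_im`
reassembles the two because the rate is fixed by `ℍ`. -/
theorem hasDerivWithinAt_logTransform (hg : GSolution s T g) (hs : 2 ≤ s) {t : ℝ} (ht : t ∈ Icc 0 T)
    (x : ℝ) : HasDerivWithinAt (fun τ => logTransform (g τ) x) (-rate (logTransform (g t)) x)
      (Icc 0 T) t := by
  have hs1 : 1 ≤ s := by linarith
  have hr := hg.unifSob_rate hs
  have hd : ∀ t ∈ Icc 0 T, ∀ x, HasDerivWithinAt (fun τ => (g τ x : ℂ))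
      (-((rate (logTransform (g t)) x).im : ℂ)) (Icc 0 T) t := fun t ht x => by
    obtain ⟨dt, h1, h2⟩ := hg.evolution t ht x
    rw [gEvolution_iff (((hg.unifSob hs1).mono hs).apply ⟨t, ht⟩)] at h2
    have h3 := h1.ofReal_comp
    rwa [h2, Complex.ofReal_neg] at h3
  have h1 := hasDerivWithinAt_hilbert ((hg.unifSob hs1).mono hs1) (hr.im le_rfl).neg hd x ht
  have h2 := ((hd t ht x).add h1).const_mul Complex.I
  refine h2.congr_deriv ?_
  have hrt : Sob 1 (rate (logTransform (g t))) := hr.apply ⟨t, ht⟩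
  have him : Sob 1 fun x => ((rate (logTransform (g t)) x).im : ℂ) := UnifSob.im le_rfl hrt
  have e := congrFun (logTransform_im hrt (hilbert_rate
    (((hg.unifSob_logTransform hs1).mono hs).apply ⟨t, ht⟩) (hg.hilbert_logTransform hs1 ht))) x
  rw [logTransform] at e
  rw [hilbert_neg him]
  linear_combination -e

/-- The velocity `b - i (c² - 1)` is continuous in time. -/
theorem continuousOn_holVel (hg : GSolution s T g) (hs : 2 ≤ s) (x : ℝ) :
    ContinuousOn (fun t => holVel (logTransform (g t)) x) (Icc 0 T) := by
  have hs1 : 1 ≤ s := by linarith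
  have hr := hg.unifSob_rate hs
  have hc := ((hg.unifSob_logTransform hs1).mono hs1).cSq le_rfl
  have hd : ∀ t ∈ Icc 0 T, ∀ x, HasDerivWithinAt (fun τ => cSq (logTransform (g τ)) x - 1)
      ((cSq (logTransform (g t)) x - 1) * (rate (logTransform (g t)) x +
        (starRingEnd ℂ) (rate (logTransform (g t)) x)) + (rate (logTransform (g t)) x +
        (starRingEnd ℂ) (rate (logTransform (g t)) x))) (Icc 0 T) t := fun t ht x => by
    have h1 := hg.hasDerivWithinAt_logTransform hs ht x
    have h2 : HasDerivWithinAt (fun τ => (starRingEnd ℂ) (logTransform (g τ) x))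
        ((starRingEnd ℂ) (-rate (logTransform (g t)) x)) (Icc 0 T) t := h1.star
    have h3 : HasDerivWithinAt (fun τ => -(logTransform (g τ) x +
        (starRingEnd ℂ) (logTransform (g τ) x))) (-(-rate (logTransform (g t)) x +
        (starRingEnd ℂ) (-rate (logTransform (g t)) x))) (Icc 0 T) t := (h1.add h2).neg
    refine (h3.cexp.sub_const 1).congr_deriv ?_
    rw [map_neg, cSq]
    ring
  have hsum := hr.add le_rfl hr.conj
  intro t ht
  have h1 := hasDerivWithinAt_hilbert hc ((hc.mul le_rfl hsum).add le_rfl hsum) hd x ht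
  have h2 := (h1.const_mul (-Complex.I)).sub ((hd t ht x).const_mul Complex.I)
  exact h2.continuousWithinAt

/-- A solution of the Riemann mapping system with `Z_{,α'} = e^{i (I + ℍ) g}`. -/
theorem exists_riemannMappingSolution (hg : GSolution s T g) (hs : 2 ≤ s) (hT : 0 < T) :
    ∃ Z : ℝ → ℝ → ℂ, IsExpTransform T g Z ∧ RiemannMappingSolution s T Z ∧ IsImLog T Z g := by
  have hs1 : 1 ≤ s := by linarith
  set u : ℝ → ℝ → ℂ := fun t => logTransform (g t) with hu
  have hus : UnifSob s fun t : Icc (0 : ℝ) T => u t := hg.unifSob_logTransform hs1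
  have hu1 : ∀ t ∈ Icc 0 T, Sob 1 (u t) := fun t ht => (hus.mono hs1).apply ⟨t, ht⟩
  have hu2 : ∀ t ∈ Icc 0 T, Sob 2 (u t) := fun t ht => (hus.mono hs).apply ⟨t, ht⟩
  have hH : ∀ t ∈ Icc 0 T, hilbert (u t) = u t := fun t ht => hg.hilbert_logTransform hs1 ht
  have hV : ∀ t ∈ Icc 0 T, HardyExt (u t) (bdryExt (u t)) := fun t ht => (hu1 t ht).hardyExt (hH t ht)
  have hr : ∀ t ∈ Icc 0 T, Sob 1 (rate (u t)) := fun t ht => (hg.unifSob_rate hs).apply ⟨t, ht⟩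
  have hΦ : ∀ t ∈ Icc 0 T, HardyExt (rate (u t)) (bdryExt (rate (u t))) := fun t ht =>
    (hr t ht).hardyExt (hilbert_rate (hu2 t ht) (hH t ht))
  have hQ : ∀ t ∈ Icc 0 T, HardyExt (holVel (u t)) (bdryExt (holVel (u t))) := fun t ht =>
    (sob_holVel le_rfl (hu1 t ht)).hardyExt (hilbert_holVel (hu1 t ht))
  have hE := hus.exp hs1
  have hE1 : ∀ t ∈ Icc 0 T, Sob 1 fun x => Complex.exp (u t x) - 1 := fun t ht =>
    (hE.mono hs1).apply ⟨t, ht⟩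
  have hexp : ∀ t ∈ Icc 0 T, HardyExt (fun x => Complex.exp (u t x) - 1)
    (fun z => Complex.exp (bdryExt (u t) z) - 1) := fun t ht => (hV t ht).exp
  -- spatial primitives
  have hprim : ∀ t, ∃ G : ℂ → ℂ, t ∈ Icc 0 T → ContinuousOn G (closure lowerHalfPlane) ∧
      (∀ z ∈ lowerHalfPlane, HasDerivAt G (Complex.exp (bdryExt (u t) z)) z) ∧
      (∀ x : ℝ, HasDerivAt (fun x : ℝ => G x) (Complex.exp (u t x)) x) ∧ G 0 = 0 := fun t => by
    by_cases ht : t ∈ Icc 0 T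
    · obtain ⟨G, h1, h2, h3, h4⟩ := (hE1 t ht).exists_primitive ((hexp t ht).hilbert_eq (hE1 t ht))
      -- Only `e^U - 1` has boundary values in a Sobolev class; the remaining constant `1`
      -- contributes the primitive `z`.
      refine ⟨fun z => z + G z, fun _ => ⟨continuousOn_id.add h1, fun z hz => ?_, fun x => ?_, ?_⟩⟩
      · refine ((hasDerivAt_id z).add (h2 z hz)).congr_deriv ?_
        rw [bdryExt_of_mem _ hz, ← (hexp t ht).eq_poissonExt (hE1 t ht) hz, add_sub_cancel]
      · refine ((Complex.ofRealCLM.hasDerivAt (x := x)).add (h3 x)).congr_deriv ?_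
        simp
      · simp [h4]
    · exact ⟨0, fun h => absurd h ht⟩
  choose G hG using hprim
  -- The prescribed derivative is the value at `z = 0` of `-(Q - i) e^U - i`, the intended `∂ₜ Ψ`.
  -- Here `Q` extends `holVel (u t)`. The final `-i` makes this velocity vanish at infinity, where
  -- `Q → 0` and `U → 0`.
  obtain ⟨a, ha⟩ := exists_hasDerivWithinAt_Icc hT.le
    (A := fun t => -((holVel (u t) 0 - Complex.I) * Complex.exp (u t 0)) - Complex.I) (by
      refine (((hg.continuousOn_holVel hs 0).sub continuousOn_const).mul ?_).neg.sub
        continuousOn_const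
      exact Complex.continuous_exp.comp_continuousOn fun t ht =>
        (hg.hasDerivWithinAt_logTransform hs ht 0).continuousWithinAt)
  set Z : ℝ → ℝ → ℂ := fun t x => a t + G t x with hZdef
  have hZd : ∀ t ∈ Icc 0 T, ∀ x, HasDerivAt (Z t) (Complex.exp (u t x)) x := fun t ht x =>
    ((hG t ht).2.2.1 x).const_add (a t)
  have hZ' : ∀ t ∈ Icc 0 T, deriv (Z t) = fun x => Complex.exp (u t x) := fun t ht =>
    funext fun x => (hZd t ht x).deriv
  have hP : ∀ t ∈ Icc 0 T, ∀ z ∈ lowerHalfPlane,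
      poissonExt (deriv (Z t)) z = Complex.exp (bdryExt (u t) z) := fun t ht z hz => by
    obtain ⟨C, hC⟩ := (hE1 t ht).bounded
    have h1 := poissonExt_const_add (hE1 t ht).continuous hC 1 hz
    rw [← (hexp t ht).eq_poissonExt (hE1 t ht) hz] at h1
    simp only [add_sub_cancel] at h1
    rw [hZ' t ht, h1]
  have hPev : ∀ t ∈ Icc 0 T, (fun z => Complex.exp (bdryExt (u t) z)) =ᶠ[atInfty]
      poissonExt (deriv (Z t)) := fun t ht => by
    filter_upwards [eventually_mem_lowerHalfPlane] with z hz
    rw [hP t ht z hz]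
  -- the time derivative of the conformal map
  have hΨ : ∀ t ∈ Icc 0 T, ∀ z ∈ lowerHalfPlane, HasDerivWithinAt (fun τ => a τ + G τ z)
      (-((bdryExt (holVel (u t)) z - Complex.I) * Complex.exp (bdryExt (u t) z)) - Complex.I)
      (Icc 0 T) t := fun t ht z hz => by
    obtain ⟨C, hC⟩ := (hg.unifSob_rate hs).bounded le_rfl
    obtain ⟨D, hD⟩ := hus.bounded hs1
    have hVt : ∀ t ∈ Icc 0 T, ∀ w, HasDerivWithinAt (fun τ => bdryExt (u τ) w)
        (-bdryExt (rate (u t)) w) (Icc 0 T) t := fun t ht w => by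
      rw [← bdryExt_neg]
      exact hasDerivWithinAt_bdryExt (f' := fun t x => -rate (u t) x) (C := C) (hus.mono hs1)
        (fun t ht x => by rw [norm_neg]; exact hC ⟨t, ht⟩ x)
        (fun t ht x => hg.hasDerivWithinAt_logTransform hs ht x) w ht
    have hcont : ∀ t ∈ Icc 0 T, ContinuousOn (fun w => Complex.exp (bdryExt (u t) w))
        (closure lowerHalfPlane) := fun t ht =>
      Complex.continuous_exp.comp_continuousOn (hV t ht).1
    -- The primitive is an integral of `e^U` over the segment from `0` to `z`, so its time
    -- derivative is taken under this integral.
    have h1 := hasDerivWithinAt_integral_mul (μ := volume.restrict (Ioc (0 : ℝ) 1)) (T := T)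
      (k := fun _ => 1) (C := Real.exp D * C)
      (f := fun τ r => Complex.exp (bdryExt (u τ) (r * z)))
      (f' := fun t r => Complex.exp (bdryExt (u t) (r * z)) * -bdryExt (rate (u t)) (r * z))
      (integrable_const 1)
      (fun t ht r => (hVt t ht _).cexp)
      (fun t ht r => by
        rw [norm_mul, norm_neg]
        refine mul_le_mul ?_ (norm_bdryExt_le (hC ⟨t, ht⟩) _) (norm_nonneg _) (Real.exp_nonneg _)
        rw [Complex.norm_exp]
        exact Real.exp_le_exp.2 ((Complex.re_le_norm _).trans (norm_bdryExt_le (hD ⟨t, ht⟩) _)))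
      (fun t ht => by
        simp only [one_mul]
        have := (continuousOn_segment (hcont t ht) hz).integrableOn_Icc (μ := volume)
        exact this.mono_set Ioc_subset_Icc_self) ht
    simp only [one_mul] at h1
    have h2 := (ha t ht).add (h1.const_mul z)
    have hseg : ∀ τ ∈ Icc 0 T, z * ∫ r in Ioc (0 : ℝ) 1, Complex.exp (bdryExt (u τ) (r * z)) = G τ z :=
      fun τ hτ => by
        rw [integral_segment (hG τ hτ).1 (hcont τ hτ) (hG τ hτ).2.1 hz, (hG τ hτ).2.2.2, sub_zero]
    refine (h2.congr_deriv ?_).congr (fun τ hτ => ?_) ?_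
    -- The `z`-derivative of `-(Q - i) e^U` is `∂ₜ e^U`, so the segment integral returns its
    -- increment between `0` and `z`. The value at `0` cancels against `a'`.
    · have hQ' : ∀ w ∈ lowerHalfPlane, HasDerivAt
          (fun w => -((bdryExt (holVel (u t)) w - Complex.I) * Complex.exp (bdryExt (u t) w)))
          (Complex.exp (bdryExt (u t) w) * -bdryExt (rate (u t)) w) w := fun w hw => by
        have d1 := (sob_holVel one_le_two_real (hu2 t ht)).hasDerivAt_bdryExt
          (hilbert_holVel (hu1 t ht)) hw
        have d2 := (hu2 t ht).hasDerivAt_bdryExt (hH t ht) hw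
        refine ((d1.sub_const Complex.I).mul d2.cexp).neg.congr_deriv ?_
        have hd1 := (hu2 t ht).deriv.hardyExt (hilbert_deriv_eq (hu2 t ht) (hH t ht))
        have hv2 := sob_holVel one_le_two_real (hu2 t ht)
        have hd2 := hv2.deriv.hardyExt (hilbert_deriv_eq hv2 (hilbert_holVel (hu1 t ht)))
        -- The formula `rate_eq` on the line passes to the half plane, since a holomorphic extension
        -- with zero boundary values vanishes.
        have hI := (hΦ t ht).sub ((((hQ t ht).mul hd1).sub
          (hd1.const_mul Complex.I)).add hd2)
        have hI0 := eq_of_boundary hI.1 hI.2 (fun x => by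
          rw [hI.4, rate_eq (hu2 t ht), sub_self]) hI.3 hw
        rw [sub_eq_zero.1 hI0]
        ring
      have h3 := integral_segment
        (f := fun w => -((bdryExt (holVel (u t)) w - Complex.I) * Complex.exp (bdryExt (u t) w)))
        (f' := fun w => Complex.exp (bdryExt (u t) w) * -bdryExt (rate (u t)) w) (((hQ t ht).1.sub continuousOn_const).mul (hcont t ht)).neg
        ((hcont t ht).mul (hΦ t ht).1.neg) hQ' hz
      beta_reduce at h3
      rw [h3]
      have h4 : ∀ f : ℝ → ℂ, bdryExt f 0 = f 0 := fun f => by simpa using bdryExt_ofReal f 0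
      rw [h4, h4]
      ring
    · rw [← hseg τ hτ]; rfl
    · rw [← hseg t ht]; rfl
  have hImLog : IsImLog T Z g := fun t ht => ⟨bdryExt (u t), ⟨(hV t ht).1, fun z hz =>
    (hP t ht z hz).symm, (hV t ht).3⟩, fun x => by
      rw [bdryExt_ofReal, im_logTransform (((hg.unifSob hs1).mono hs1).apply ⟨t, ht⟩)]⟩
  refine ⟨Z, fun t ht x => (hZd t ht x).deriv, ?_, hImLog⟩
  have huc : ∀ t ∈ Icc 0 T, Continuous (u t) := fun t ht => (hu1 t ht).continuous
  exact {
    contDiff := fun t ht => by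
      rw [contDiff_one_iff_deriv]
      refine ⟨fun x => (hZd t ht x).differentiableAt, ?_⟩
      rw [hZ' t ht]
      exact Complex.continuous_exp.comp (huc t ht)
    deriv_ne_zero := fun t ht x => by rw [hZ' t ht]; exact Complex.exp_ne_zero _
    regularity := by
      refine (inLinftyHs_iff hs1 fun t ht => ?_).2 ?_
      · rw [hZ' t ht]
        exact (Complex.continuous_exp.comp (huc t ht)).sub continuous_const
      · convert hE using 3 with t x
        rw [hZ' t t.2]
    regularity_inv := by
      refine (inLinftyHs_iff hs1 fun t ht => ?_).2 ?_
      · rw [hZ' t ht]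
        exact (continuous_const.div (Complex.continuous_exp.comp (huc t ht)) fun x =>
          Complex.exp_ne_zero _).sub continuous_const
      · convert hus.neg.exp hs1 using 3 with t x
        rw [hZ' t t.2, Complex.exp_neg, one_div]
    evolution := fun t ht x => by
      refine ⟨rate (u t) x * Complex.exp (-u t x), ?_,
        (evolution_iff (hu2 t ht) (hH t ht) (fun x => (hZd t ht x).deriv) x _).2 rfl⟩
      have e : ∀ τ ∈ Icc 0 T, invZα (Z τ) x = Complex.exp (-u τ x) := fun τ hτ => by
        rw [invZα_eq fun x => (hZd τ hτ x).deriv]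
      refine HasDerivWithinAt.congr ?_ e (e t ht)
      refine (hg.hasDerivWithinAt_logTransform hs ht x).neg.cexp.congr_deriv ?_
      simp only [hu, neg_neg, Pi.neg_apply]
      ring
    holomorphic := fun t ht => (hV t ht).2.cexp.congr (hP t ht)
    ext_ne_zero := fun t ht z hz => by rw [hP t ht z hz]; exact Complex.exp_ne_zero _
    ext_tendsto := fun t ht => by
      refine Tendsto.congr' (hPev t ht) ?_
      simpa [Function.comp_def] using (Complex.continuous_exp.tendsto _).comp (hV t ht).3
    normalization := by
      refine ⟨fun t z => a t + G t z, fun t z => -((bdryExt (holVel (u t)) z - Complex.I) *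
        Complex.exp (bdryExt (u t) z)) - Complex.I, fun t ht => ⟨continuousOn_const.add (hG t ht).1,
        fun x => rfl, fun z hz => ?_, fun z hz => hΨ t ht z hz, ?_⟩⟩
      · rw [hP t ht z hz]
        exact ((hG t ht).2.1 z hz).const_add (a t)
      · have h1 := (Complex.continuous_exp.tendsto _).comp (hV t ht).3
        have h2 := ((((hQ t ht).3.sub_const Complex.I).mul h1).neg).sub_const Complex.I
        simpa [Function.comp_def] using h2 }

end GSolution

/-! ### Uniqueness up to a constant, and the equivalence. -/

/-- Solutions of the Riemann mapping system with the same derivative differ by a constant. -/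
theorem RiemannMappingSolution.eq_add_const {s T : ℝ} {Z₁ Z₂ : ℝ → ℝ → ℂ} (hT : 0 < T)
    (h₁ : RiemannMappingSolution s T Z₁) (h₂ : RiemannMappingSolution s T Z₂)
    (h : ∀ t ∈ Icc 0 T, deriv (Z₁ t) = deriv (Z₂ t)) :
    ∃ a : ℂ, ∀ t ∈ Icc 0 T, ∀ α : ℝ, Z₂ t α = Z₁ t α + a := by
  obtain ⟨Ψ₁, dΨ₁, k₁⟩ := h₁.normalization
  obtain ⟨Ψ₂, dΨ₂, k₂⟩ := h₂.normalization
  have hI : -Complex.I ∈ lowerHalfPlane := by simp [mem_lowerHalfPlane]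
  set c : ℝ → ℂ := fun t => Ψ₂ t (-Complex.I) - Ψ₁ t (-Complex.I) with hc
  have hconst : ∀ t ∈ Icc 0 T, ∀ z ∈ lowerHalfPlane, Ψ₂ t z - Ψ₁ t z = c t := fun t ht z hz => by
    have hd : ∀ w ∈ lowerHalfPlane, HasDerivWithinAt (fun w => Ψ₂ t w - Ψ₁ t w) 0 lowerHalfPlane w :=
      fun w hw => by
        have := (((k₂ t ht).2.2.1 w hw).sub ((k₁ t ht).2.2.1 w hw)).hasDerivWithinAt
          (s := lowerHalfPlane)
        rwa [h t ht, sub_self] at this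
    have := convex_lowerHalfPlane.norm_image_sub_le_of_norm_hasDerivWithin_le (C := 0) hd
      (fun _ _ => norm_zero.le) hI hz
    rw [zero_mul] at this
    exact sub_eq_zero.1 (norm_le_zero_iff.1 this)
  have hbdry : ∀ t ∈ Icc 0 T, ∀ x : ℝ, Z₂ t x - Z₁ t x = c t := fun t ht x => by
    rw [← (k₁ t ht).2.1, ← (k₂ t ht).2.1]
    exact Set.EqOn.of_subset_closure (s := lowerHalfPlane) (hconst t ht)
      ((k₂ t ht).1.sub (k₁ t ht).1) continuousOn_const subset_closure subset_rfl
      (ofReal_mem_closure x)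
  have hd : ∀ t ∈ Icc 0 T, ∀ z ∈ lowerHalfPlane,
      HasDerivWithinAt c (dΨ₂ t z - dΨ₁ t z) (Icc 0 T) t := fun t ht z hz =>
    (((k₂ t ht).2.2.2.1 z hz).sub ((k₁ t ht).2.2.2.1 z hz)).congr
      (fun τ hτ => (hconst τ hτ z hz).symm) (hconst t ht z hz).symm
  have hd0 : ∀ t ∈ Icc 0 T, HasDerivWithinAt c 0 (Icc 0 T) t := fun t ht => by
    have hlim : Tendsto (fun z => dΨ₂ t z - dΨ₁ t z) atInfty (𝓝 0) := by
      simpa using (k₂ t ht).2.2.2.2.sub (k₁ t ht).2.2.2.2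
    -- At every `z` the difference of the velocities is the derivative of the same function `c`, so
    -- it is constant in `z` and equals its limit at infinity. Uniqueness of one-sided derivatives
    -- uses that the time interval is nondegenerate.
    have e : dΨ₂ t (-Complex.I) - dΨ₁ t (-Complex.I) = 0 := by
      refine tendsto_nhds_unique (tendsto_const_nhds.congr' ?_) hlim
      filter_upwards [eventually_mem_lowerHalfPlane] with z hz
      exact (uniqueDiffOn_Icc hT t ht).eq_deriv _ (hd t ht _ hI) (hd t ht z hz)
    have := hd t ht _ hI
    rwa [e] at this
  have h0 : (0 : ℝ) ∈ Icc 0 T := ⟨le_rfl, hT.le⟩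
  refine ⟨c 0, fun t ht α => ?_⟩
  have hct := (convex_Icc 0 T).norm_image_sub_le_of_norm_hasDerivWithin_le (C := 0) hd0
    (fun _ _ => norm_zero.le) h0 ht
  rw [zero_mul] at hct
  rw [← sub_eq_zero.1 (norm_le_zero_iff.1 hct), ← hbdry t ht α, add_sub_cancel]

end Muskat

end

theorem mainTheorem7 (s T : ℝ) (hs : 2 ≤ s) (hT : 0 < T) :
    -- from the Riemann mapping system to the system for `g`
    (∀ Z : ℝ → ℝ → ℂ, Muskat.RiemannMappingSolution s T Z →
      (∃ g : ℝ → ℝ → ℝ, Muskat.IsImLog T Z g) ∧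
      ∀ g : ℝ → ℝ → ℝ, Muskat.IsImLog T Z g →
        Muskat.GSolution s T g ∧ Muskat.IsExpTransform T g Z) ∧
    -- from the system for `g` to the Riemann mapping system
    (∀ g : ℝ → ℝ → ℝ, Muskat.GSolution s T g →
      (∃ Z : ℝ → ℝ → ℂ, Muskat.IsExpTransform T g Z ∧
        Muskat.RiemannMappingSolution s T Z ∧ Muskat.IsImLog T Z g) ∧
      ∀ Z₁ Z₂ : ℝ → ℝ → ℂ,
        Muskat.IsExpTransform T g Z₁ → Muskat.RiemannMappingSolution s T Z₁ →
        Muskat.IsExpTransform T g Z₂ → Muskat.RiemannMappingSolution s T Z₂ →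
        ∃ a : ℂ, ∀ t ∈ Set.Icc 0 T, ∀ α : ℝ, Z₂ t α = Z₁ t α + a) := by
  refine ⟨fun Z hZ => ⟨⟨_, hZ.isImLog hs⟩, fun g hg => hZ.gSolution hs hg⟩, fun g hg =>
    ⟨hg.exists_riemannMappingSolution hs hT, fun Z₁ Z₂ e₁ h₁ e₂ h₂ =>
      h₁.eq_add_const hT h₂ fun t ht => ?_⟩⟩
  ext α
  rw [e₁ t ht, e₂ t ht]
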